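/- **Setting.** Let $d\ge 2$ and let $\Omega\subset\mathbb{R}^d$ be a bounded open set with smooth boundary, with outward unit normal $\nu$. Let $A=(a_{ij})\in C^2(\mathbb{R}^d,\mathbb{R}^{d\times d})\cap L^\infty$ be symmetric with $A(x)\xi\cdot\xi\ge\mu|\xi|^2$ for all $x,\xi\in\mathbb{R}^d$, where $\mu>0$, and let $b\in C^1(\mathbb{R}^d,\mathbb{R}^d)\cap L^\infty$, $c\in C^1(\mathbb{R}^d,\mathbb{R})\cap L^\infty$. Put $$\mathcal{L}v=\operatorname{Div}(A\nabla v)+b\cdot\nabla v+cv,$$ acting componentwise on vector-valued functions. Fix $T>0$ and an integer $N\ge1$. Let $\{\Psi_n\}_{n\ge1}$ be the orthonormal basis of $L^2(0,T)$ obtained by Gram–Schmidt from $\phi_n(t)=(t-T/2)^{n-1}e^{t-T/2}$, $n\ge 1$, and let $S=(s_{mn})_{m,n=1}^N$ with $s_{mn}=\int_0^T\Psi_m(t)\Psi_n'(t)\,dt$. Write $\|u\|_{H^k(\Omega)}^2=\sum_{j\le k}\int_\Omega|\nabla^j u|^2$, summed over components for vector functions. For $\epsilon>0$ let $$J_\epsilon(U)=\int_\Omega|\mathcal{L}U-SU|^2\,dx+\epsilon\|U\|_{H^3(\Omega)^N}^2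 .$$ All boundary conditions are understood in the sense of traces. **Theorem.** Let $F^*,G^*$ (exact data) and $F^\delta,G^\delta$ (noisy data) be $\mathbb{R}^N$-valued functions on $\partial\Omega$, and let $\epsilon>0$, $\delta>0$. Assume that 1. $U^*\in H^3(\Omega)^N$ satisfies $\mathcal{L}U^*=SU^*$ a.e. in $\Omega$, with $U^*=F^*$ and $A\nabla U^*\cdot\nu=G^*$ on $\partial\Omega$; 2. $U^\delta$ minimizes $J_\epsilon$ over $\{V\in H^3(\Omega)^N:\ V=F^\delta,\ A\nabla V\cdot\nu=G^\delta\text{ on }\partial\Omega\}$, and belongs to this set; 3. there is $\mathcal{E}\in H^3(\Omega)^N$ with $\mathcal{E}=F^\delta-F^*$ and $A\nabla\mathcal{E}\cdot\nu=G^\delta-G^*$ on $\partial\Omega$, and $\|\mathcal{E}\|_{H^3(\Omega)^N}<\delta$. Then $$\|U^\delta-U^*\|_{H^1(\Omega)^N}^2\le C\left(\delta^2+\epsilon\|U^*\|_{H^3(\Omega)^N}^2\right),$$ where $C>0$ depends only on $\Omega$, $\mu$, an upper bound for $\|A\|_{C^1(\overline\Omega)}$, and the lower-order and discretization parameters $N$,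 $T$ and an upper bound for $\sup_\Omega|b|$ and $\sup_\Omega|c|$. In particular $C$ does not depend on $\epsilon$, $\delta$, the data, $U^*$, $U^\delta$ or $\mathcal{E}$. -/

import Mathlib

open MeasureTheory Set Filter Topology
open scoped ContDiff

namespace QuasiReversibility

/-- The Euclidean space `ℝᵈ`. -/
abbrev Space (d : ℕ) : Type := EuclideanSpace ℝ (Fin d)

noncomputable section

/-! ### Smooth boundaries, outward normals, surface measure -/

/-- `ρ` is a smooth local defining function of the open set `Ω` at `p`: `dρ(p) ≠ 0`, and near `p`
the set `Ω` is `{ρ < 0}`. -/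
def IsLocalDefiningFunction {d : ℕ} (Ω : Set (Space d)) (p : Space d) (ρ : Space d → ℝ) : Prop :=
  ContDiff ℝ ∞ ρ ∧ fderiv ℝ ρ p ≠ 0 ∧ ∀ᶠ x in 𝓝 p, (x ∈ Ω ↔ ρ x < 0)

/-- The boundary of `Ω` is smooth, `Ω` lying locally on one side of it. -/
def HasSmoothBoundary {d : ℕ} (Ω : Set (Space d)) : Prop :=
  ∀ p ∈ frontier Ω, ∃ ρ : Space d → ℝ, IsLocalDefiningFunction Ω p ρ

open Classical in
/-- The outward unit normal `ν(p) = ∇ρ(p) / |∇ρ(p)|` at a boundary point `p`, where `ρ` is a smooth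
local defining function of `Ω` at `p` (the result does not depend on which one); `0` if there is
none. -/
def outwardNormal {d : ℕ} (Ω : Set (Space d)) (p : Space d) : Space d :=
  if h : ∃ ρ : Space d → ℝ, IsLocalDefiningFunction Ω p ρ then
    ‖gradient h.choose p‖⁻¹ • gradient h.choose p
  else 0

/-- The surface measure of `∂Ω`: the `(d-1)`-dimensional Hausdorff measure, in its Euclidean
normalization, restricted to `∂Ω`. -/
def surfaceMeasure {d : ℕ} (Ω : Set (Space d)) : Measure (Space d) :=
  (Measure.euclideanHausdorffMeasure (d - 1)).restrict (frontier Ω)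

/-! ### Weak derivatives and the Sobolev spaces `Hᵏ(Ω)` -/

/-- The classical partial derivative `∂ᵢ φ`. -/
def partialDeriv {d : ℕ} (i : Fin d) (φ : Space d → ℝ) (x : Space d) : ℝ :=
  fderiv ℝ φ x (EuclideanSpace.single i 1)

/-- `v` is a weak partial derivative `∂ᵢ u` on the open set `Ω`. -/
def HasWeakPartial {d : ℕ} (Ω : Set (Space d)) (i : Fin d) (u v : Space d → ℝ) : Prop :=
  LocallyIntegrableOn u Ω ∧ LocallyIntegrableOn v Ω ∧
    ∀ φ : Space d → ℝ, ContDiff ℝ ∞ φ → HasCompactSupport φ → tsupport φ ⊆ Ω →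
      ∫ x in Ω, u x * partialDeriv i φ x = -∫ x in Ω, v x * φ x

open Classical in
/-- The weak partial derivative `∂ᵢ u` on `Ω`, unique up to a null subset of `Ω`
(`0` if `u` has none). -/
def weakPartial {d : ℕ} (Ω : Set (Space d)) (i : Fin d) (u : Space d → ℝ) : Space d → ℝ :=
  if h : ∃ v : Space d → ℝ, HasWeakPartial Ω i u v then h.choose else 0

/-- `u ∈ Hᵏ(Ω)`: all weak derivatives of `u` of order at most `k` exist and lie in `L²(Ω)`. -/
def MemH {d : ℕ} (Ω : Set (Space d)) : ℕ → (Space d → ℝ) → Prop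
  | 0, u => MemLp u 2 (volume.restrict Ω)
  | k + 1, u => MemLp u 2 (volume.restrict Ω) ∧
      ∀ i : Fin d, ∃ v : Space d → ℝ, HasWeakPartial Ω i u v ∧ MemH Ω k v

/-- `‖u‖²_{Hᵏ(Ω)} = ∑_{j ≤ k} ∫_Ω |∇ʲ u|²`, where
`|∇ʲ u|² = ∑_{i₁, …, i_j} |∂_{i₁} ⋯ ∂_{i_j} u|²`. -/
def normSqH {d : ℕ} (Ω : Set (Space d)) : ℕ → (Space d → ℝ) → ℝ
  | 0, u => ∫ x in Ω, u x ^ 2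
  | k + 1, u => (∫ x in Ω, u x ^ 2) + ∑ i : Fin d, normSqH Ω k (weakPartial Ω i u)

/-- `U ∈ Hᵏ(Ω)ᴺ`. -/
def MemHVec {d N : ℕ} (Ω : Set (Space d)) (k : ℕ) (U : Fin N → Space d → ℝ) : Prop :=
  ∀ m, MemH Ω k (U m)

/-- The norm of `Hᵏ(Ω)ᴺ`. -/
def normH {d N : ℕ} (Ω : Set (Space d)) (k : ℕ) (U : Fin N → Space d → ℝ) : ℝ :=
  Real.sqrt (∑ m, normSqH Ω k (U m))

/-! ### Boundary traces -/

/-- `g ∈ L²(∂Ω)` is the trace on `∂Ω` of `u ∈ H¹(Ω)`: it is the boundary function for which Green's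
formula `∫_Ω (u ∂ᵢφ + φ ∂ᵢu) = ∫_{∂Ω} g φ νᵢ` holds for all test functions `φ ∈ C_c^∞(ℝᵈ)`
and all `i`. -/
def IsTrace {d : ℕ} (Ω : Set (Space d)) (u g : Space d → ℝ) : Prop :=
  MemH Ω 1 u ∧ MemLp g 2 (surfaceMeasure Ω) ∧
    ∀ φ : Space d → ℝ, ContDiff ℝ ∞ φ → HasCompactSupport φ → ∀ i : Fin d,
      ∫ x in Ω, (u x * partialDeriv i φ x + weakPartial Ω i u x * φ x) =
        ∫ x, g x * φ x * outwardNormal Ω x i ∂(surfaceMeasure Ω)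

/-- `A ∇u · ν = g` on `∂Ω`, the values of `∇u` on `∂Ω` being its traces. -/
def HasConormal {d : ℕ} (Ω : Set (Space d)) (A : Space d → Matrix (Fin d) (Fin d) ℝ)
    (u g : Space d → ℝ) : Prop :=
  ∃ w : Fin d → Space d → ℝ, (∀ j, IsTrace Ω (weakPartial Ω j u) (w j)) ∧
    ∀ᵐ x ∂(surfaceMeasure Ω), g x = ∑ i, (∑ j, A x i j * w j x) * outwardNormal Ω x i

/-- The Cauchy data of `U` on `∂Ω`: `U = F` and `A ∇U · ν = G`, componentwise. -/
def HasCauchyData {d N : ℕ} (Ω : Set (Space d)) (A : Space d → Matrix (Fin d) (Fin d) ℝ)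
    (U F G : Fin N → Space d → ℝ) : Prop :=
  ∀ m, IsTrace Ω (U m) (F m) ∧ HasConormal Ω A (U m) (G m)

/-! ### The elliptic operator -/

/-- Conditions on the coefficients: `A` is `C²`, bounded, symmetric and uniformly elliptic with
constant `μ`; `b` and `c` are `C¹` and bounded. -/
structure IsCoefficients {d : ℕ} (μ : ℝ) (A : Space d → Matrix (Fin d) (Fin d) ℝ)
    (b : Space d → Space d) (c : Space d → ℝ) : Prop where
  contDiff_A : ∀ i j, ContDiff ℝ 2 fun x => A x i j
  bounded_A : ∃ K : ℝ, ∀ x i j, |A x i j| ≤ K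
  symm : ∀ x, (A x).IsSymm
  elliptic : ∀ x (ξ : Space d), μ * ‖ξ‖ ^ 2 ≤ ∑ i, ∑ j, A x i j * ξ j * ξ i
  contDiff_b : ContDiff ℝ 1 b
  bounded_b : ∃ K : ℝ, ∀ x, ‖b x‖ ≤ K
  contDiff_c : ContDiff ℝ 1 c
  bounded_c : ∃ K : ℝ, ∀ x, |c x| ≤ K

/-- `‖A‖_{C¹(Ω̄)} ≤ Λ`, for the maximum over `Ω̄` of the entries of `A` and of their first
partial derivatives, in absolute value. -/
def C1NormLE {d : ℕ} (Ω : Set (Space d)) (A : Space d → Matrix (Fin d) (Fin d) ℝ) (Λ : ℝ) : Prop :=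
  ∀ x ∈ closure Ω, ∀ i j, |A x i j| ≤ Λ ∧ ∀ k, |partialDeriv k (fun y => A y i j) x| ≤ Λ

/-- `ℒ v = Div(A ∇v) + b · ∇v + c v`, with weak derivatives on `Ω`. -/
def ellipticOp {d : ℕ} (Ω : Set (Space d)) (A : Space d → Matrix (Fin d) (Fin d) ℝ)
    (b : Space d → Space d) (c : Space d → ℝ) (v : Space d → ℝ) (x : Space d) : ℝ :=
  (∑ i, weakPartial Ω i (fun y => ∑ j, A y i j * weakPartial Ω j v y) x) +
    (∑ i, b x i * weakPartial Ω i v x) + c x * v x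

/-! ### The basis of `L²(0, T)` and the matrix `S` -/

/-- `t ↦ (t - T/2)ⁿ exp(t - T/2)`, for `n = 0, 1, 2, …`. -/
def expPoly (T : ℝ) (n : ℕ) (t : ℝ) : ℝ :=
  (t - T / 2) ^ n * Real.exp (t - T / 2)

/-- Gram–Schmidt orthogonalization in `L²(0, T)` of the sequence `expPoly T`. -/
def orthoSeq (T : ℝ) (n : ℕ) : ℝ → ℝ := fun t =>
  expPoly T n t - ∑ k : Fin n,
    (∫ s in (0 : ℝ)..T, expPoly T n s * orthoSeq T k s) /
      (∫ s in (0 : ℝ)..T, orthoSeq T k s ^ 2) * orthoSeq T k t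
termination_by n
decreasing_by all_goals exact k.isLt

/-- The orthonormal basis `Ψ₀, Ψ₁, …` of `L²(0, T)`, indexed from `0`. -/
def basisFn (T : ℝ) (n : ℕ) (t : ℝ) : ℝ :=
  orthoSeq T n t / Real.sqrt (∫ s in (0 : ℝ)..T, orthoSeq T n s ^ 2)

/-- The `N × N` matrix `S` with entries `s_{mn} = ∫₀ᵀ Ψ_m Ψ_n'`. -/
def matS (T : ℝ) (N : ℕ) : Matrix (Fin N) (Fin N) ℝ := fun m n =>
  ∫ t in (0 : ℝ)..T, basisFn T m t * deriv (basisFn T n) t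

/-! ### The approximate model and the quasi-reversibility method -/

/-- The `m`-th component of `ℒU - SU`. -/
def residual {d N : ℕ} (Ω : Set (Space d)) (A : Space d → Matrix (Fin d) (Fin d) ℝ)
    (b : Space d → Space d) (c : Space d → ℝ) (T : ℝ) (U : Fin N → Space d → ℝ) (m : Fin N)
    (x : Space d) : ℝ :=
  ellipticOp Ω A b c (U m) x - ∑ n, matS T N m n * U n x

/-- `U ∈ H³(Ω)ᴺ` solves `ℒU = SU` in `Ω` with Cauchy data `U = F`, `A ∇U · ν = G` on `∂Ω`. -/
def IsSolution {d N : ℕ} (Ω : Set (Space d)) (A : Space d → Matrix (Fin d) (Fin d) ℝ)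
    (b : Space d → Space d) (c : Space d → ℝ) (T : ℝ) (F G U : Fin N → Space d → ℝ) : Prop :=
  MemHVec Ω 3 U ∧ (∀ m, ∀ᵐ x ∂(volume.restrict Ω), residual Ω A b c T U m x = 0) ∧
    HasCauchyData Ω A U F G

/-- The functional `J_ε(U) = ∫_Ω |ℒU - SU|² + ε ‖U‖²_{H³(Ω)ᴺ}`. -/
def functionalJ {d N : ℕ} (Ω : Set (Space d)) (A : Space d → Matrix (Fin d) (Fin d) ℝ)
    (b : Space d → Space d) (c : Space d → ℝ) (T ε : ℝ) (U : Fin N → Space d → ℝ) : ℝ :=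
  (∫ x in Ω, ∑ m, residual Ω A b c T U m x ^ 2) + ε * normH Ω 3 U ^ 2

/-- The set of admissible functions `{V ∈ H³(Ω)ᴺ : V = F and A ∇V · ν = G on ∂Ω}`. -/
def admissible {d N : ℕ} (Ω : Set (Space d)) (A : Space d → Matrix (Fin d) (Fin d) ℝ)
    (F G : Fin N → Space d → ℝ) : Set (Fin N → Space d → ℝ) :=
  {V | MemHVec Ω 3 V ∧ HasCauchyData Ω A V F G}

/-- `U` is a regularized solution: a minimizer of `J_ε` over the admissible set for the
data `F`, `G`. -/
def IsRegularizedSolution {d N : ℕ} (Ω : Set (Space d))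
    (A : Space d → Matrix (Fin d) (Fin d) ℝ) (b : Space d → Space d) (c : Space d → ℝ) (T ε : ℝ)
    (F G U : Fin N → Space d → ℝ) : Prop :=
  U ∈ admissible Ω A F G ∧ IsMinOn (functionalJ Ω A b c T ε) (admissible Ω A F G) U

end

end QuasiReversibility

/-!
Write `W = Uδ - U* - E`. The minimizer `Uδ` is compared with the competitor `V = U* + E`, which has
the noisy Cauchy data, and whose residual `ℒV - SV` is that of `E` alone, hence at most a multiple
of `δ` (`exists_residual_bound`). Minimality then bounds `∫ |ℒUδ - SUδ|² + ε ‖Uδ‖²_{H³}` by a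
multiple of `δ² + ε (δ² + ‖U*‖²_{H³})`. If `ε ≥ 1`, the penalty term alone bounds `‖Uδ‖_{H³}`, and
the claim is trivial. If `ε ≤ 1`, the squared residual of `W = Uδ - V` is at most a multiple of
`δ² + ε ‖U*‖²_{H³}`, and it remains to control `‖W‖_{H¹}` by this residual
(`exists_stability_zeroData`).

This uses that the Cauchy data of `W` vanish. The trace of `∇W` is normal to `∂Ω`, because `W` has
zero trace (`IsTrace.mul_normal_comm`), and its normal part vanishes by ellipticity and the zero
conormal derivative (`HasConormal.isTrace_weakPartial`); so the extension of `W` by zero belongs to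
`H²(ℝᵈ)` and no boundary terms appear in what follows. Besides, the surface measure must be
finite and the normal independent of the defining function (`isFiniteMeasure_surfaceMeasure`,
`IsLocalDefiningFunction.outwardNormal_eq`).

For compactly supported functions on `ℝᵈ` a Carleman estimate with the weight `e^Φ`,
`Φ = τ e^{β xₒ}`, holds: with `h = ∂ₒ Φ`,
`∫ h e^{2Φ} (|∇w|² + w²) ≤ C ∫ e^{2Φ} |Div (A ∇w)|²`,
as soon as `h` is large on the support. It comes from a multiplier identity, which is a statement
about second-order jets (`Jet.multiplier_identity`): for `v = e^Φ w`, the main part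
`Div (A ∇v) + h² α v` of the conjugated operator, with `α = a_{oo}`, times `-2 h p - 2 β h α v`,
with `p = (A ∇v)ₒ`, is a divergence plus positive terms carrying a factor `β`, plus terms which they
absorb when first `β` and then `h` is large (`Jet.exists_carleman_parameters`). The estimate is
integrated for smooth functions (`exists_carleman_smooth`) and extended to `H²` by mollification
(`exists_carleman`). The factor `h` on the left absorbs the terms `b · ∇w`, `c w` and `S w`, and on
the bounded set `Ω` the weight is bounded above and below, which gives the stability estimate with a
constant depending only on the stated quantities.
-/

namespace QuasiReversibility

open scoped Convolution
open ContinuousLinearMap (lsmul)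

/-! ### Mollifiers -/

section mollifier

open scoped Pointwise

/-- A sequence of bump functions centred at `0`, with supports shrinking to `0`. -/
noncomputable def bumpSeq (d : ℕ) (k : ℕ) : ContDiffBump (0 : Space d) where
  rIn := 1 / (2 * ((k : ℝ) + 1))
  rOut := 1 / ((k : ℝ) + 1)
  rIn_pos := by positivity
  rIn_lt_rOut := by
    apply one_div_lt_one_div_of_lt <;> [positivity; linarith [(k.cast_nonneg : (0 : ℝ) ≤ k)]]

/-- The mollification of `f` by the `k`-th normalized bump function. -/
noncomputable def mollify {d : ℕ} (k : ℕ) (f : Space d → ℝ) : Space d → ℝ :=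
  (bumpSeq d k).normed volume ⋆[lsmul ℝ ℝ, volume] f

lemma tendsto_rOut_bumpSeq (d : ℕ) : Tendsto (fun k => (bumpSeq d k).rOut) atTop (𝓝 0) :=
  tendsto_one_div_add_atTop_nhds_zero_nat

lemma mollify_eq {d : ℕ} (k : ℕ) (f : Space d → ℝ) (x : Space d) :
    mollify k f x = ∫ y, (bumpSeq d k).normed volume (x - y) * f y := by
  simp [mollify, convolution_eq_swap]

lemma mollify_eq' {d : ℕ} (k : ℕ) (f : Space d → ℝ) (x : Space d) :
    mollify k f x = ∫ y, (bumpSeq d k).normed volume y * f (x - y) := by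
  simp [mollify, convolution_def]

lemma contDiff_mollify {d : ℕ} (k : ℕ) {f : Space d → ℝ} (hf : LocallyIntegrable f) :
    ContDiff ℝ ∞ (mollify k f) :=
  (bumpSeq d k).hasCompactSupport_normed.contDiff_convolution_left _
    (bumpSeq d k).contDiff_normed hf

lemma support_mollify_subset {d : ℕ} (k : ℕ) (f : Space d → ℝ) :
    Function.support (mollify k f) ⊆ Metric.thickening (bumpSeq d k).rOut (Function.support f) := by
  refine (support_convolution_subset _).trans ?_
  rw [(bumpSeq d k).support_normed_eq]
  rintro _ ⟨a, ha, b, hb, rfl⟩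
  rw [Metric.mem_thickening_iff]
  exact ⟨b, hb, by simpa [dist_eq_norm] using ha⟩

lemma tsupport_mollify_subset {d : ℕ} (k : ℕ) {f : Space d → ℝ} {K : Set (Space d)} {δ : ℝ}
    (hK : Function.support f ⊆ K) (hδ : (bumpSeq d k).rOut ≤ δ) :
    tsupport (mollify k f) ⊆ Metric.cthickening δ K :=
  closure_minimal (((support_mollify_subset k f).trans
    ((Metric.thickening_mono hδ _).trans (Metric.thickening_subset_of_subset δ hK))).trans
      (Metric.thickening_subset_cthickening _ _)) Metric.isClosed_cthickening

lemma tendsto_mollify {d : ℕ} {f : Space d → ℝ} (hf : Continuous f) (x : Space d) :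
    Tendsto (fun k => mollify k f x) atTop (𝓝 (f x)) :=
  ContDiffBump.convolution_tendsto_right_of_continuous (tendsto_rOut_bumpSeq d) hf x

lemma abs_mollify_le {d : ℕ} (k : ℕ) {f : Space d → ℝ} (hf : Continuous f) {M : ℝ}
    (hM : ∀ x, |f x| ≤ M) (x : Space d) : |mollify k f x| ≤ 3 * M := by
  have h := (bumpSeq d k).dist_normed_convolution_le (μ := volume) (x₀ := x) (ε := 2 * M)
    hf.aestronglyMeasurable (fun y _ => by
      rw [Real.dist_eq]
      exact (abs_sub _ _).trans (by linarith [hM x, hM y]))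
  rw [Real.dist_eq] at h
  have h2 : |mollify k f x| ≤ |mollify k f x - f x| + |f x| := by
    simpa using abs_add_le (mollify k f x - f x) (f x)
  have := hM x
  change |mollify k f x - f x| ≤ _ at h
  linarith

end mollifier

/-! ### Classical partial derivatives -/

section partialDeriv
variable {d : ℕ} {i : Fin d} {f g : Space d → ℝ} {x : Space d}

lemma partialDeriv_add (hf : DifferentiableAt ℝ f x) (hg : DifferentiableAt ℝ g x) :
    partialDeriv i (fun y => f y + g y) x = partialDeriv i f x + partialDeriv i g x := by
  simp [partialDeriv, fderiv_fun_add hf hg]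

lemma partialDeriv_sub (hf : DifferentiableAt ℝ f x) (hg : DifferentiableAt ℝ g x) :
    partialDeriv i (fun y => f y - g y) x = partialDeriv i f x - partialDeriv i g x := by
  simp [partialDeriv, fderiv_fun_sub hf hg]

lemma partialDeriv_mul (hf : DifferentiableAt ℝ f x) (hg : DifferentiableAt ℝ g x) :
    partialDeriv i (fun y => f y * g y) x =
      f x * partialDeriv i g x + partialDeriv i f x * g x := by
  simp [partialDeriv, fderiv_fun_mul hf hg]; ring

lemma partialDeriv_const_mul (c : ℝ) (hf : DifferentiableAt ℝ f x) :
    partialDeriv i (fun y => c * f y) x = c * partialDeriv i f x := by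
  simp [partialDeriv, fderiv_const_mul hf]

lemma partialDeriv_sum {ι : Type*} {s : Finset ι} {F : ι → Space d → ℝ}
    (hF : ∀ a ∈ s, DifferentiableAt ℝ (F a) x) :
    partialDeriv i (fun y => ∑ a ∈ s, F a y) x = ∑ a ∈ s, partialDeriv i (F a) x := by
  simp [partialDeriv, fderiv_fun_sum hF]

lemma contDiff_partialDeriv {m n : WithTop ℕ∞} (i : Fin d) (hf : ContDiff ℝ n f) (h : m + 1 ≤ n) :
    ContDiff ℝ m (partialDeriv i f) :=
  (hf.fderiv_right h).clm_apply contDiff_const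

lemma continuous_partialDeriv (i : Fin d) (hf : ContDiff ℝ 1 f) : Continuous (partialDeriv i f) :=
  (contDiff_partialDeriv (m := 0) i hf (by simp)).continuous

lemma tsupport_partialDeriv_subset (i : Fin d) (f : Space d → ℝ) :
    tsupport (partialDeriv i f) ⊆ tsupport f :=
  tsupport_fderiv_apply_subset ℝ _

lemma hasCompactSupport_partialDeriv (i : Fin d) (hf : HasCompactSupport f) :
    HasCompactSupport (partialDeriv i f) :=
  hf.of_isClosed_subset (isClosed_tsupport _) (tsupport_partialDeriv_subset i f)

lemma partialDeriv_comm {f : Space d → ℝ} (hf : ContDiff ℝ 2 f) (i j : Fin d) (x : Space d) :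
    partialDeriv i (partialDeriv j f) x = partialDeriv j (partialDeriv i f) x := by
  have hs : IsSymmSndFDerivAt ℝ f x := hf.contDiffAt.isSymmSndFDerivAt (by simp)
  have key : ∀ a b : Fin d, partialDeriv a (partialDeriv b f) x =
      fderiv ℝ (fderiv ℝ f) x (EuclideanSpace.single a 1) (EuclideanSpace.single b 1) := by
    intro a b
    have hd : DifferentiableAt ℝ (fderiv ℝ f) x :=
      ((hf.fderiv_right (m := 1) (by norm_num)).differentiable (by simp)).differentiableAt
    unfold partialDeriv
    rw [fderiv_clm_apply hd (differentiableAt_const _)]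
    simp
  rw [key, key, hs.eq]

end partialDeriv

/-- Classical differentiation commutes with mollification, for `C¹` functions of compact support. -/
lemma partialDeriv_mollify {d : ℕ} (k : ℕ) {f : Space d → ℝ} (hf : ContDiff ℝ 1 f)
    (hc : HasCompactSupport f) (i : Fin d) (x : Space d) :
    partialDeriv i (mollify k f) x = mollify k (partialDeriv i f) x := by
  have hl : LocallyIntegrable ((bumpSeq d k).normed volume) (volume : Measure (Space d)) :=
    (bumpSeq d k).continuous_normed.locallyIntegrable
  have h := hc.hasFDerivAt_convolution_right (lsmul ℝ ℝ) hl hf x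
  unfold partialDeriv
  rw [show fderiv ℝ (mollify k f) x = _ from h.fderiv,
    convolution_precompR_apply (lsmul ℝ ℝ) hl (hc.fderiv ℝ) (hf.continuous_fderiv (by simp))]
  rfl

/-! ### Weak partial derivatives -/

section weak
variable {d : ℕ} {Ω : Set (Space d)} {i : Fin d} {u u' v v' : Space d → ℝ}

/-- Dominated convergence for a locally integrable function tested against uniformly bounded
functions with supports in a fixed compact set. -/
lemma tendsto_setIntegral_mul {K : Set (Space d)} (hK : IsCompact K)
    (hu : LocallyIntegrableOn u Ω) (hKΩ : K ⊆ Ω)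
    {g : ℕ → Space d → ℝ} {g' : Space d → ℝ} {M : ℝ} (hg : ∀ k, Continuous (g k))
    (hsupp : ∀ᶠ k in atTop, Function.support (g k) ⊆ K) (hM : ∀ k x, |g k x| ≤ M)
    (hlim : ∀ x, Tendsto (fun k => g k x) atTop (𝓝 (g' x))) :
    Tendsto (fun k => ∫ x in Ω, u x * g k x) atTop (𝓝 (∫ x in Ω, u x * g' x)) := by
  have hint : Integrable (K.indicator fun x => ‖u x‖ * M) (volume.restrict Ω) := by
    rw [integrable_indicator_iff hK.measurableSet]
    exact (((hu.integrableOn_compact_subset hKΩ hK).norm.mul_const M).mono_measure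
      (Measure.restrict_mono_measure Measure.restrict_le_self K))
  refine tendsto_integral_filter_of_dominated_convergence _
    (Eventually.of_forall fun k => hu.aestronglyMeasurable.mul (hg k).aestronglyMeasurable)
    ?_ hint (Eventually.of_forall fun x => (hlim x).const_mul _)
  filter_upwards [hsupp] with k hk
  refine Eventually.of_forall fun x => ?_
  by_cases hx : x ∈ K
  · rw [indicator_of_mem hx, norm_mul]
    exact mul_le_mul_of_nonneg_left (hM k x) (norm_nonneg _)
  · have : g k x = 0 := by
      by_contra h
      exact hx (hk h)
    simp [hx, this]

/-- The defining identity of a weak derivative extends to test functions which are merely `C¹`. -/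
lemma HasWeakPartial.integral_mul_partialDeriv (hΩ : IsOpen Ω) (h : HasWeakPartial Ω i u v)
    {ψ : Space d → ℝ} (hψ : ContDiff ℝ 1 ψ) (hc : HasCompactSupport ψ) (hs : tsupport ψ ⊆ Ω) :
    ∫ x in Ω, u x * partialDeriv i ψ x = -∫ x in Ω, v x * ψ x := by
  obtain ⟨δ, hδ, hδΩ⟩ := IsCompact.exists_cthickening_subset_open hc hΩ hs
  set K := Metric.cthickening δ (tsupport ψ)
  have hK : IsCompact K := IsCompact.cthickening hc
  have hcd : Continuous (partialDeriv i ψ) := continuous_partialDeriv i hψ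
  have hcs := hasCompactSupport_partialDeriv i hc
  obtain ⟨M, hM⟩ := hψ.continuous.bounded_above_of_compact_support hc
  obtain ⟨M', hM'⟩ := hcd.bounded_above_of_compact_support hcs
  have hr : ∀ᶠ k in atTop, (bumpSeq d k).rOut ≤ δ :=
    (tendsto_rOut_bumpSeq d).eventually (eventually_le_nhds hδ)
  have hsm : ∀ k, ContDiff ℝ ∞ (mollify k ψ) := fun k =>
    contDiff_mollify k hψ.continuous.locallyIntegrable
  have hsup : ∀ᶠ k in atTop, tsupport (mollify k ψ) ⊆ K := by
    filter_upwards [hr] with k hk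
    exact tsupport_mollify_subset k (subset_tsupport ψ) hk
  have e1 : Tendsto (fun k => ∫ x in Ω, v x * mollify k ψ x) atTop
      (𝓝 (∫ x in Ω, v x * ψ x)) := by
    refine tendsto_setIntegral_mul hK h.2.1 hδΩ (M := 3 * M) (fun k => (hsm k).continuous) ?_
      (fun k x => abs_mollify_le k hψ.continuous hM x) (fun x => tendsto_mollify hψ.continuous x)
    filter_upwards [hsup] with k hk using (subset_tsupport _).trans hk
  have e2 : Tendsto (fun k => ∫ x in Ω, u x * partialDeriv i (mollify k ψ) x) atTop
      (𝓝 (∫ x in Ω, u x * partialDeriv i ψ x)) := by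
    refine tendsto_setIntegral_mul hK h.1 hδΩ (M := 3 * M')
      (fun k => continuous_partialDeriv i ((hsm k).of_le (by simp))) ?_
      (fun k x => ?_) (fun x => ?_)
    · filter_upwards [hsup] with k hk
      exact (subset_tsupport _).trans ((tsupport_partialDeriv_subset i _).trans hk)
    · rw [partialDeriv_mollify k hψ hc]
      exact abs_mollify_le k hcd hM' x
    · simp_rw [partialDeriv_mollify _ hψ hc]
      exact tendsto_mollify hcd x
  refine tendsto_nhds_unique e2 (e1.neg.congr' ?_)
  filter_upwards [hsup] with k hk
  exact (h.2.2 _ (hsm k) (hK.of_isClosed_subset (isClosed_tsupport _) hk) (hk.trans hδΩ)).symm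

lemma integrable_mul_of_tsupport_subset (hu : LocallyIntegrableOn u Ω)
    {φ : Space d → ℝ} (hφ : Continuous φ) (hc : HasCompactSupport φ) (hs : tsupport φ ⊆ Ω) :
    Integrable (fun x => u x * φ x) (volume.restrict Ω) := by
  have h1 : IntegrableOn (fun x => u x * φ x) (tsupport φ) (volume.restrict Ω) :=
    ((hu.integrableOn_compact_subset hs hc).mono_measure Measure.restrict_le_self).mul_continuousOn
        hφ.continuousOn hc
  rw [← integrableOn_univ]
  refine (h1.of_forall_sdiff_eq_zero MeasurableSet.univ fun x hx => ?_)
  rw [image_eq_zero_of_notMem_tsupport hx.2, mul_zero]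

/-- Weak derivatives are unique almost everywhere, by the fundamental lemma of the calculus of
variations. -/
lemma HasWeakPartial.unique (hΩ : IsOpen Ω) (h : HasWeakPartial Ω i u v)
    (h' : HasWeakPartial Ω i u v') : v =ᵐ[volume.restrict Ω] v' := by
  have := hΩ.ae_eq_zero_of_integral_contDiff_smul_eq_zero (h.2.1.sub h'.2.1)
    (fun g hg hc hs => by
      have e1 := h.2.2 g hg hc hs
      have e2 := h'.2.2 g hg hc hs
      have e3 : ∫ x in Ω, (v x * g x - v' x * g x) = 0 := by
        rw [integral_sub (integrable_mul_of_tsupport_subset h.2.1 hg.continuous hc hs)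
          (integrable_mul_of_tsupport_subset h'.2.1 hg.continuous hc hs)]
        linarith
      rw [← e3, ← integral_indicator hΩ.measurableSet]
      congr 1
      ext x
      by_cases hx : x ∈ Ω
      · simp [hx]; ring
      · simp [hx, image_eq_zero_of_notMem_tsupport fun h => hx (hs h)])
  rw [Filter.EventuallyEq, ae_restrict_iff' hΩ.measurableSet]
  filter_upwards [this] with x hx hxΩ
  have := hx hxΩ
  simp only [Pi.sub_apply] at this
  linarith

lemma HasWeakPartial.congr (h : HasWeakPartial Ω i u v) (hu : u =ᵐ[volume.restrict Ω] u')
    (hv : v =ᵐ[volume.restrict Ω] v') : HasWeakPartial Ω i u' v' := by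
  refine ⟨h.1.congr hu, h.2.1.congr hv, fun φ h1 h2 h3 => ?_⟩
  have e1 : ∫ x in Ω, u x * partialDeriv i φ x = ∫ x in Ω, u' x * partialDeriv i φ x :=
    integral_congr_ae (hu.mono fun x hx => by simp only [hx])
  have e2 : ∫ x in Ω, v x * φ x = ∫ x in Ω, v' x * φ x :=
    integral_congr_ae (hv.mono fun x hx => by simp only [hx])
  rw [← e1, ← e2]
  exact h.2.2 φ h1 h2 h3

lemma weakPartial_congr (hu : u =ᵐ[volume.restrict Ω] u') :
    weakPartial Ω i u = weakPartial Ω i u' := by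
  have : (fun v => HasWeakPartial Ω i u v) = fun v => HasWeakPartial Ω i u' v := by
    ext v
    exact ⟨fun h => h.congr hu .rfl, fun h => h.congr hu.symm .rfl⟩
  unfold weakPartial
  congr! 2

lemma HasWeakPartial.weakPartial_spec (h : HasWeakPartial Ω i u v) :
    HasWeakPartial Ω i u (weakPartial Ω i u) := by
  have hex : ∃ v, HasWeakPartial Ω i u v := ⟨v, h⟩
  rw [QuasiReversibility.weakPartial, dif_pos hex]
  exact hex.choose_spec

lemma HasWeakPartial.ae_eq (hΩ : IsOpen Ω) (h : HasWeakPartial Ω i u v) :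
    QuasiReversibility.weakPartial Ω i u =ᵐ[volume.restrict Ω] v :=
  h.weakPartial_spec.unique hΩ h

lemma HasWeakPartial.add (h : HasWeakPartial Ω i u v) (h' : HasWeakPartial Ω i u' v') :
    HasWeakPartial Ω i (fun x => u x + u' x) (fun x => v x + v' x) := by
  refine ⟨h.1.add h'.1, h.2.1.add h'.2.1, fun φ h1 h2 h3 => ?_⟩
  have hcd := continuous_partialDeriv i (h1.of_le (m := 1) (by simp))
  have hcs := hasCompactSupport_partialDeriv i h2
  have hss := (tsupport_partialDeriv_subset i φ).trans h3
  simp_rw [add_mul]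
  rw [integral_add (integrable_mul_of_tsupport_subset h.1 hcd hcs hss)
    (integrable_mul_of_tsupport_subset h'.1 hcd hcs hss),
    integral_add (integrable_mul_of_tsupport_subset h.2.1 h1.continuous h2 h3)
    (integrable_mul_of_tsupport_subset h'.2.1 h1.continuous h2 h3), h.2.2 φ h1 h2 h3,
    h'.2.2 φ h1 h2 h3]
  ring

lemma HasWeakPartial.const_mul (c : ℝ) (h : HasWeakPartial Ω i u v) :
    HasWeakPartial Ω i (fun x => c * u x) (fun x => c * v x) := by
  refine ⟨h.1.smul c, h.2.1.smul c, fun φ h1 h2 h3 => ?_⟩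
  simp_rw [mul_assoc, integral_const_mul]
  rw [h.2.2 φ h1 h2 h3]
  ring

lemma HasWeakPartial.zero (Ω : Set (Space d)) (i : Fin d) :
    HasWeakPartial Ω i (fun _ => 0) (fun _ => 0) :=
  ⟨locallyIntegrableOn_zero, locallyIntegrableOn_zero, by simp⟩

lemma HasWeakPartial.sum {ι : Type*} (s : Finset ι) {U V : ι → Space d → ℝ}
    (h : ∀ a ∈ s, HasWeakPartial Ω i (U a) (V a)) :
    HasWeakPartial Ω i (fun x => ∑ a ∈ s, U a x) (fun x => ∑ a ∈ s, V a x) := by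
  classical
  induction s using Finset.induction_on with
  | empty => simpa using HasWeakPartial.zero Ω i
  | insert a s ha ih =>
    simp_rw [Finset.sum_insert ha]
    exact (h a (Finset.mem_insert_self a s)).add
      (ih fun b hb => h b (Finset.mem_insert_of_mem hb))

/-- The Leibniz rule for the product of a `C¹` function and a weakly differentiable one. -/
lemma HasWeakPartial.contDiff_mul (hΩ : IsOpen Ω) (h : HasWeakPartial Ω i u v) {a : Space d → ℝ}
    (ha : ContDiff ℝ 1 a) :
    HasWeakPartial Ω i (fun x => a x * u x) (fun x => partialDeriv i a x * u x + a x * v x) := by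
  have hca := continuous_partialDeriv i ha
  have hl : ∀ {b w : Space d → ℝ}, Continuous b → LocallyIntegrableOn w Ω →
      LocallyIntegrableOn (fun x => b x * w x) Ω := fun hb hw =>
    hw.continuousOn_mul hb.continuousOn hΩ.isLocallyClosed
  refine ⟨hl ha.continuous h.1, (hl hca h.1).add (hl ha.continuous h.2.1), fun φ h1 h2 h3 => ?_⟩
  have h1' : ContDiff ℝ 1 φ := h1.of_le (by simp)
  have hs : tsupport (fun x => a x * φ x) ⊆ tsupport φ := tsupport_mul_subset_right
  have e := h.integral_mul_partialDeriv hΩ (ha.mul h1') (h2.mul_left) (hs.trans h3)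
  have e1 : ∀ x, partialDeriv i (fun x => a x * φ x) x =
      a x * partialDeriv i φ x + partialDeriv i a x * φ x := fun x =>
    partialDeriv_mul (ha.differentiable (by simp) x) (h1'.differentiable (by simp) x)
  have hcd := continuous_partialDeriv i h1'
  have hcs := hasCompactSupport_partialDeriv i h2
  have hss := (tsupport_partialDeriv_subset i φ).trans h3
  have i1 := integrable_mul_of_tsupport_subset (hl ha.continuous h.1) hcd hcs hss
  have i2 := integrable_mul_of_tsupport_subset (hl hca h.1) h1.continuous h2 h3
  have i3 := integrable_mul_of_tsupport_subset (hl ha.continuous h.2.1) h1.continuous h2 h3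
  have e2 : ∫ x in Ω, u x * partialDeriv i (fun x => a x * φ x) x =
      (∫ x in Ω, a x * u x * partialDeriv i φ x) + ∫ x in Ω, partialDeriv i a x * u x * φ x := by
    rw [← integral_add i1 i2]
    congr 1; ext x; rw [e1]; ring
  have e3 : ∫ x in Ω, (partialDeriv i a x * u x + a x * v x) * φ x =
      (∫ x in Ω, partialDeriv i a x * u x * φ x) + ∫ x in Ω, a x * v x * φ x := by
    rw [← integral_add i2 i3]
    congr 1; ext x; ring
  have e4 : ∫ x in Ω, v x * (a x * φ x) = ∫ x in Ω, a x * v x * φ x := by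
    congr 1; ext x; ring
  rw [e3, ← e4]
  have e' := e2.symm.trans e
  linarith

end weak

/-! ### Geometry of the boundary -/

section boundary
variable {d : ℕ} {Ω : Set (Space d)} {p : Space d} {ρ ρ' : Space d → ℝ}

lemma IsLocalDefiningFunction.eventually (h : IsLocalDefiningFunction Ω p ρ) :
    ∀ᶠ q in 𝓝 p, IsLocalDefiningFunction Ω q ρ := by
  have h1 : ∀ᶠ q in 𝓝 p, fderiv ℝ ρ q ≠ 0 :=
    ((h.1.continuous_fderiv (by simp)).tendsto p).eventually (isOpen_ne.mem_nhds h.2.1)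
  filter_upwards [h1, h.2.2.eventually_nhds] with q hq1 hq2 using ⟨h.1, hq1, hq2⟩

lemma IsLocalDefiningFunction.eq_zero (h : IsLocalDefiningFunction Ω p ρ) (hp : p ∈ frontier Ω) :
    ρ p = 0 := by
  have hc : Tendsto ρ (𝓝 p) (𝓝 (ρ p)) := h.1.continuous.tendsto p
  rcases lt_trichotomy (ρ p) 0 with hlt | heq | hgt
  · refine absurd ?_ hp.2
    rw [mem_interior_iff_mem_nhds]
    filter_upwards [h.2.2, hc.eventually (eventually_lt_nhds hlt)] with x hx hx' using hx.2 hx'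
  · exact heq
  · obtain ⟨x, hx, hx1, hx2⟩ := ((mem_closure_iff_frequently.1 hp.1).and_eventually
      (h.2.2.and (hc.eventually (eventually_gt_nhds hgt)))).exists
    exact absurd (hx1.1 hx) (not_lt.2 hx2.le)

/-- A direction in which `ρ` decreases points into `Ω`, so no other defining function can increase
along it. -/
lemma IsLocalDefiningFunction.fderiv_nonpos (h : IsLocalDefiningFunction Ω p ρ)
    (h' : IsLocalDefiningFunction Ω p ρ') (hp : p ∈ frontier Ω) {v : Space d}
    (hv : fderiv ℝ ρ p v < 0) : fderiv ℝ ρ' p v ≤ 0 := by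
  have key : ∀ {σ : Space d → ℝ}, IsLocalDefiningFunction Ω p σ →
      Tendsto (fun t : ℝ => t⁻¹ * σ (p + t • v)) (𝓝[>] 0) (𝓝 (fderiv ℝ σ p v)) := by
    intro σ hσ
    have hl : HasLineDerivAt ℝ σ (fderiv ℝ σ p v) p v :=
      (hσ.1.differentiable (by simp) p).hasFDerivAt.hasLineDerivAt v
    have := hl.tendsto_slope_zero_right
    simpa [hσ.eq_zero hp] using this
  have hline : Tendsto (fun t : ℝ => p + t • v) (𝓝[>] 0) (𝓝 p) := by
    have : Continuous fun t : ℝ => p + t • v := by fun_prop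
    simpa using (this.tendsto 0).mono_left nhdsWithin_le_nhds
  refine le_of_tendsto (key h') ?_
  filter_upwards [(key h).eventually (eventually_lt_nhds hv), hline.eventually h.2.2,
    hline.eventually h'.2.2, self_mem_nhdsWithin] with t h1 h2 h3 (ht : 0 < t)
  have hneg : ρ (p + t • v) < 0 := by
    by_contra hcon
    exact absurd h1 (not_lt.2 (mul_nonneg (inv_nonneg.2 ht.le) (not_lt.1 hcon)))
  exact mul_nonpos_of_nonneg_of_nonpos (inv_nonneg.2 ht.le) (h3.1 (h2.2 hneg)).le

lemma gradient_ne_zero (h : IsLocalDefiningFunction Ω p ρ) : gradient ρ p ≠ 0 := by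
  simpa [gradient] using h.2.1

/-- The unit vector `∇ρ / |∇ρ|` does not depend on the defining function: otherwise
`v = |∇ρ| ∇ρ' - |∇ρ'| ∇ρ` would satisfy `dρ v < 0 < dρ' v`. -/
lemma IsLocalDefiningFunction.normalize_gradient_eq (h : IsLocalDefiningFunction Ω p ρ)
    (h' : IsLocalDefiningFunction Ω p ρ') (hp : p ∈ frontier Ω) :
    ‖gradient ρ p‖⁻¹ • gradient ρ p = ‖gradient ρ' p‖⁻¹ • gradient ρ' p := by
  set g := gradient ρ p with hg
  set g' := gradient ρ' p with hg'
  have hg0 : 0 < ‖g‖ := norm_pos_iff.2 (gradient_ne_zero h)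
  have hg0' : 0 < ‖g'‖ := norm_pos_iff.2 (gradient_ne_zero h')
  have e : ∀ v, fderiv ℝ ρ p v = inner ℝ g v := fun v => by simp [hg, gradient]
  have e' : ∀ v, fderiv ℝ ρ' p v = inner ℝ g' v := fun v => by simp [hg', gradient]
  have hcs : inner ℝ g g' ≤ ‖g‖ * ‖g'‖ := real_inner_le_norm g g'
  have heq : inner ℝ g g' = ‖g‖ * ‖g'‖ := by
    by_contra hne
    have hlt := lt_of_le_of_ne hcs hne
    have hv : fderiv ℝ ρ p (‖g‖ • g' - ‖g'‖ • g) < 0 := by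
      rw [e, inner_sub_right, inner_smul_right, inner_smul_right, real_inner_self_eq_norm_sq]
      nlinarith
    have := h.fderiv_nonpos h' hp hv
    rw [e', inner_sub_right, inner_smul_right, inner_smul_right, real_inner_self_eq_norm_sq,
      real_inner_comm] at this
    nlinarith
  have := inner_eq_norm_mul_iff_real.1 heq
  rw [inv_smul_eq_iff₀ hg0.ne', smul_smul, mul_comm, ← smul_smul, ← this, smul_smul,
    inv_mul_cancel₀ hg0'.ne', one_smul]

lemma IsLocalDefiningFunction.outwardNormal_eq (h : IsLocalDefiningFunction Ω p ρ)
    (hp : p ∈ frontier Ω) : outwardNormal Ω p = ‖gradient ρ p‖⁻¹ • gradient ρ p := by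
  have hex : ∃ ρ, IsLocalDefiningFunction Ω p ρ := ⟨ρ, h⟩
  rw [outwardNormal, dif_pos hex]
  exact hex.choose_spec.normalize_gradient_eq h hp

lemma norm_outwardNormal (hΩ : HasSmoothBoundary Ω) (hp : p ∈ frontier Ω) :
    ‖outwardNormal Ω p‖ = 1 := by
  obtain ⟨ρ, hρ⟩ := hΩ p hp
  rw [hρ.outwardNormal_eq hp, norm_smul, norm_inv, norm_norm,
    inv_mul_cancel₀ (norm_ne_zero_iff.2 (gradient_ne_zero hρ))]

lemma continuousOn_outwardNormal (hΩ : HasSmoothBoundary Ω) :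
    ContinuousOn (outwardNormal Ω) (frontier Ω) := by
  intro p hp
  obtain ⟨ρ, hρ⟩ := hΩ p hp
  have hgc : Continuous (gradient ρ) :=
    (InnerProductSpace.toDual ℝ (Space d)).symm.continuous.comp
      (hρ.1.continuous_fderiv (by simp))
  have hc : ContinuousAt (fun q => ‖gradient ρ q‖⁻¹ • gradient ρ q) p :=
    (hgc.continuousAt.norm.inv₀ (norm_ne_zero_iff.2 (gradient_ne_zero hρ))).smul hgc.continuousAt
  refine hc.continuousWithinAt.congr_of_eventuallyEq ?_ (hρ.outwardNormal_eq hp)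
  filter_upwards [hρ.eventually.filter_mono nhdsWithin_le_nhds, self_mem_nhdsWithin] with q h1 h2
    using h1.outwardNormal_eq h2

lemma norm_le_card_mul {ξ : Space d} {M : ℝ} (hM : ∀ i, |ξ i| ≤ M) : ‖ξ‖ ≤ d * M := by
  have h1 : ‖ξ‖ ≤ ∑ i, ‖EuclideanSpace.single i (ξ i)‖ := by
    conv_lhs => rw [show ξ = ∑ i, EuclideanSpace.single i (ξ i) by
      ext j; simp [Finset.sum_apply]]
    exact norm_sum_le _ _
  refine h1.trans ((Finset.sum_le_sum (g := fun _ => M) fun i _ => by simpa using hM i).trans ?_)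
  simp

/-- Near a boundary point, `∂Ω ⊆ {ρ = 0}`, on which dropping a coordinate `k` with `∂ₖρ ≠ 0` is
bi-Lipschitz; hence `∂Ω` has locally finite `(d - 1)`-dimensional measure. -/
lemma finiteAtFilter_frontier (h : IsLocalDefiningFunction Ω p ρ) :
    (Measure.euclideanHausdorffMeasure (d - 1)).FiniteAtFilter (𝓝[frontier Ω] p) := by
  -- a coordinate direction transversal to `{ρ = 0}`
  obtain ⟨k, hk⟩ : ∃ k, fderiv ℝ ρ p (EuclideanSpace.single k 1) ≠ 0 := by
    by_contra hcon
    push Not at hcon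
    apply h.2.1
    ext v
    rw [show v = ∑ i, v i • EuclideanSpace.single i (1 : ℝ) by
      ext j; simp [Finset.sum_apply, Pi.single_apply]]
    simp only [map_sum, map_smul, hcon]
    simp
  set ρ' := fderiv ℝ ρ p with hρ'
  set a := ρ' (EuclideanSpace.single k 1) with ha
  have ha0 : 0 < |a| := abs_pos.2 hk
  have hst : HasStrictFDerivAt ρ ρ' p := h.1.contDiffAt.hasStrictFDerivAt (by simp)
  obtain ⟨s, hs, hap⟩ := hst.approximates_deriv_on_nhds (c := (|a| / 2).toNNReal)
    (Or.inr (Real.toNNReal_pos.2 (half_pos ha0)))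
  obtain ⟨r, hr, hrs⟩ := Metric.mem_nhds_iff.1 (inter_mem hs h.eventually)
  set t := frontier Ω ∩ Metric.ball p r with ht
  refine ⟨t, inter_mem self_mem_nhdsWithin
    (mem_nhdsWithin_of_mem_nhds (Metric.ball_mem_nhds p hr)), ?_⟩
  -- the projection `P` along that direction; `K` is the Lipschitz constant of its inverse on `t`
  let ι := {j : Fin d // j ≠ k}
  let P : Space d → (ι → ℝ) := fun x j => x j
  set K : ℝ := (1 + 2 * (|a| / 2 + ‖ρ'‖) / |a|) * d with hK
  have hK0 : 0 ≤ K := by positivity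
  have hanti : ∀ x ∈ t, ∀ y ∈ t, dist x y ≤ K * dist (P x) (P y) := by
    intro x hx y hy
    have hx0 : ρ x = 0 := (hrs hx.2).2.eq_zero hx.1
    have hy0 : ρ y = 0 := (hrs hy.2).2.eq_zero hy.1
    have h1 : |ρ' (x - y)| ≤ |a| / 2 * ‖x - y‖ := by
      have := hap x (hrs hx.2).1 y (hrs hy.2).1
      rw [Real.coe_toNNReal _ (half_pos ha0).le] at this
      rw [map_sub, abs_sub_comm]
      simpa [hx0, hy0] using this
    set z := x - y with hz
    set z' := z - EuclideanSpace.single k (z k) with hz'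
    have hz's : ∀ i, |z' i| ≤ dist (P x) (P y) := by
      intro i
      by_cases hik : i = k
      · subst hik; simp [hz', dist_nonneg]
      · have := dist_le_pi_dist (P x) (P y) ⟨i, hik⟩
        simpa [hz', hz, hik, P, Real.dist_eq] using this
    have h2 : ‖z'‖ ≤ d * dist (P x) (P y) := norm_le_card_mul hz's
    have hzz : z = z' + z k • EuclideanSpace.single k (1 : ℝ) := by
      ext j; simp [hz', PiLp.single_apply]
    have h3 : ρ' z = ρ' z' + z k * a := by
      conv_lhs => rw [hzz]
      simp [ha]
    have h4 : ‖z‖ ≤ ‖z'‖ + |z k| := by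
      conv_lhs => rw [hzz]
      refine (norm_add_le _ _).trans ?_
      simp [norm_smul]
    have h5 : |ρ' z'| ≤ ‖ρ'‖ * ‖z'‖ := ρ'.le_opNorm z'
    have h6 : |z k| * |a| ≤ |ρ' z| + |ρ' z'| := by
      rw [← abs_mul, show z k * a = ρ' z - ρ' z' by rw [h3]; ring]
      exact abs_sub _ _
    have h7 : |z k| * |a| ≤ 2 * (|a| / 2 + ‖ρ'‖) * ‖z'‖ := by nlinarith
    have h8 : |z k| ≤ 2 * (|a| / 2 + ‖ρ'‖) / |a| * ‖z'‖ := by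
      rw [div_mul_eq_mul_div, le_div_iff₀ ha0]; exact h7
    have h9 : ‖z‖ ≤ (1 + 2 * (|a| / 2 + ‖ρ'‖) / |a|) * ‖z'‖ := by linarith
    rw [dist_eq_norm]
    refine h9.trans ?_
    rw [hK, mul_assoc]
    exact mul_le_mul_of_nonneg_left h2 (by positivity)
  have hinj : InjOn P t := fun x hx y hy hxy => by
    have := hanti x hx y hy
    rw [hxy, dist_self, mul_zero] at this
    exact dist_le_zero.1 this
  have : Nonempty (Space d) := ⟨p⟩
  have hlip : LipschitzOnWith K.toNNReal (Function.invFunOn P t) (P '' t) := by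
    refine LipschitzOnWith.of_dist_le_mul ?_
    rintro _ ⟨x, hx, rfl⟩ _ ⟨y, hy, rfl⟩
    rw [Real.coe_toNNReal _ hK0, hinj.leftInvOn_invFunOn hx, hinj.leftInvOn_invFunOn hy]
    exact hanti x hx y hy
  have himg : Function.invFunOn P t '' (P '' t) = t := hinj.invFunOn_image subset_rfl
  have hcard : ((Fintype.card ι : ℕ) : ℝ) = ((d - 1 : ℕ) : ℝ) := by
    simp [ι, Fintype.card_subtype_compl]
  have hbdd : Bornology.IsBounded (P '' t) := by
    have hP : LipschitzWith 1 P := LipschitzWith.of_dist_le_mul fun x y => by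
      rw [NNReal.coe_one, one_mul]
      refine (dist_pi_le_iff dist_nonneg).2 fun j => ?_
      have := EuclideanSpace.dist_eq x y
      rw [this]
      exact Real.le_sqrt_of_sq_le
        (Finset.single_le_sum (f := fun i => dist (x i) (y i) ^ 2) (fun i _ => by positivity)
          (Finset.mem_univ (j : Fin d)))
    exact hP.isBounded_image (Metric.isBounded_ball.subset inter_subset_right)
  -- on `ι → ℝ` the Hausdorff measure of top dimension is Lebesgue measure
  have hfin : Measure.hausdorffMeasure (d - 1 : ℕ) (P '' t) < ⊤ := by
    rw [← hcard, hausdorffMeasure_pi_real]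
    exact hbdd.measure_lt_top
  have hfin' : Measure.hausdorffMeasure (d - 1 : ℕ) t < ⊤ := by
    rw [← himg]
    refine (hlip.hausdorffMeasure_image_le (Nat.cast_nonneg _)).trans_lt ?_
    exact ENNReal.mul_lt_top (ENNReal.rpow_lt_top_of_nonneg (Nat.cast_nonneg _) (by simp)) hfin
  rw [Measure.euclideanHausdorffMeasure_def]
  simp only [Measure.smul_apply]
  exact ENNReal.mul_lt_top (by simp) hfin'

lemma isFiniteMeasure_surfaceMeasure (hb : Bornology.IsBounded Ω) (hΩ : HasSmoothBoundary Ω) :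
    IsFiniteMeasure (surfaceMeasure Ω) := by
  have hcomp : IsCompact (frontier Ω) :=
    hb.isCompact_closure.of_isClosed_subset isClosed_frontier frontier_subset_closure
  have : Measure.euclideanHausdorffMeasure (d - 1) (frontier Ω) < ⊤ :=
    hcomp.measure_lt_top_of_nhdsWithin fun p hp => finiteAtFilter_frontier (hΩ p hp).choose_spec
  exact ⟨by simpa [surfaceMeasure] using this⟩

lemma aestronglyMeasurable_outwardNormal (hΩ : HasSmoothBoundary Ω) (i : Fin d) :
    AEStronglyMeasurable (fun x => outwardNormal Ω x i) (surfaceMeasure Ω) := by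
  have : ContinuousOn (fun x => outwardNormal Ω x i) (frontier Ω) :=
    (EuclideanSpace.proj (𝕜 := ℝ) i).continuous.comp_continuousOn (continuousOn_outwardNormal hΩ)
  exact this.aestronglyMeasurable isClosed_frontier.measurableSet

lemma abs_outwardNormal_le (hΩ : HasSmoothBoundary Ω) (i : Fin d) :
    ∀ᵐ x ∂(surfaceMeasure Ω), ‖outwardNormal Ω x i‖ ≤ 1 := by
  refine (ae_restrict_iff' isClosed_frontier.measurableSet).2 (Eventually.of_forall fun x hx => ?_)
  rw [← norm_outwardNormal hΩ hx]
  exact PiLp.norm_apply_le _ _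

end boundary

/-! ### Sobolev spaces and traces -/

section sobolev
variable {d : ℕ} {Ω : Set (Space d)} {i : Fin d} {u u' v v' : Space d → ℝ} {k : ℕ}

lemma MemH.memLp (h : MemH Ω k u) : MemLp u 2 (volume.restrict Ω) := by
  cases k with
  | zero => exact h
  | succ k => exact h.1

lemma MemH.hasWeakPartial (h : MemH Ω (k + 1) u) (i : Fin d) :
    HasWeakPartial Ω i u (weakPartial Ω i u) := by
  obtain ⟨v, hv, -⟩ := h.2 i
  exact hv.weakPartial_spec

lemma MemH.congr (h : MemH Ω k u) (hu : u =ᵐ[volume.restrict Ω] u') : MemH Ω k u' := by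
  cases k with
  | zero => exact (memLp_congr_ae hu).1 h
  | succ k =>
    refine ⟨(memLp_congr_ae hu).1 h.1, fun i => ?_⟩
    obtain ⟨v, hv, hv'⟩ := h.2 i
    exact ⟨v, hv.congr hu .rfl, hv'⟩

lemma MemH.weakPartial (hΩ : IsOpen Ω) (h : MemH Ω (k + 1) u) (i : Fin d) :
    MemH Ω k (weakPartial Ω i u) := by
  obtain ⟨v, hv, hv'⟩ := h.2 i
  exact hv'.congr (hv.ae_eq hΩ).symm

lemma MemH.of_succ (h : MemH Ω (k + 1) u) : MemH Ω k u := by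
  induction k generalizing u with
  | zero => exact h.1
  | succ k ih =>
    refine ⟨h.1, fun i => ?_⟩
    obtain ⟨v, hv, hv'⟩ := h.2 i
    exact ⟨v, hv, ih hv'⟩

lemma HasWeakPartial.linComb (a b : ℝ) (h : HasWeakPartial Ω i u v)
    (h' : HasWeakPartial Ω i u' v') :
    HasWeakPartial Ω i (fun x => a * u x + b * u' x) (fun x => a * v x + b * v' x) :=
  (h.const_mul a).add (h'.const_mul b)

lemma MemH.linComb (a b : ℝ) (h : MemH Ω k u) (h' : MemH Ω k u') :
    MemH Ω k (fun x => a * u x + b * u' x) := by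
  induction k generalizing u u' with
  | zero => exact (MemLp.const_mul h a).add (MemLp.const_mul h' b)
  | succ k ih =>
    refine ⟨(h.1.const_mul a).add (h'.1.const_mul b), fun i => ?_⟩
    obtain ⟨v, hv, hv1⟩ := h.2 i
    obtain ⟨v', hv', hv1'⟩ := h'.2 i
    exact ⟨_, hv.linComb a b hv', ih hv1 hv1'⟩

lemma weakPartial_linComb (hΩ : IsOpen Ω) (a b : ℝ) (h : MemH Ω (k + 1) u)
    (h' : MemH Ω (k + 1) u') (i : Fin d) :
    weakPartial Ω i (fun x => a * u x + b * u' x) =ᵐ[volume.restrict Ω]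
      fun x => a * weakPartial Ω i u x + b * weakPartial Ω i u' x :=
  ((h.hasWeakPartial i).linComb a b (h'.hasWeakPartial i)).ae_eq hΩ

/-- Weak derivatives commute. -/
lemma HasWeakPartial.comm (hΩ : IsOpen Ω) {i j : Fin d} {ui uj uij uji : Space d → ℝ}
    (hj : HasWeakPartial Ω j u uj) (hij : HasWeakPartial Ω i uj uij)
    (hi : HasWeakPartial Ω i u ui) (hji : HasWeakPartial Ω j ui uji) :
    uij =ᵐ[volume.restrict Ω] uji := by
  refine hij.unique hΩ ⟨hij.1, hji.2.1, fun φ h1 h2 h3 => ?_⟩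
  have hsm : ∀ a : Fin d, ContDiff ℝ ∞ (partialDeriv a φ) := fun a =>
    contDiff_partialDeriv a h1 (by simp)
  have hcs := fun a : Fin d => hasCompactSupport_partialDeriv a h2
  have hts := fun a : Fin d => (tsupport_partialDeriv_subset a φ).trans h3
  have e1 := hj.2.2 _ (hsm i) (hcs i) (hts i)
  have e2 := hi.2.2 _ (hsm j) (hcs j) (hts j)
  have e3 := hji.2.2 φ h1 h2 h3
  have e4 : ∀ x, partialDeriv j (partialDeriv i φ) x = partialDeriv i (partialDeriv j φ) x :=
    partialDeriv_comm (h1.of_le (WithTop.coe_le_coe.2 le_top)) j i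
  simp_rw [e4] at e1
  linarith

lemma integrable_mul_continuous (hu : MemLp u 2 (volume.restrict Ω)) {φ : Space d → ℝ}
    (hφ : Continuous φ) (hc : HasCompactSupport φ) :
    Integrable (fun x => u x * φ x) (volume.restrict Ω) :=
  hu.integrable_mul (((hφ.memLp_of_hasCompactSupport hc).restrict Ω) : MemLp φ 2 _)

/-- A square-integrable boundary function may be tested against `φ νᵢ`, the surface measure being
finite and the normal bounded. -/
lemma integrable_boundary (hb : Bornology.IsBounded Ω) (hs : HasSmoothBoundary Ω)
    {g φ : Space d → ℝ} (hg : MemLp g 2 (surfaceMeasure Ω)) (hφ : Continuous φ)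
    (hc : HasCompactSupport φ) (i : Fin d) :
    Integrable (fun x => g x * φ x * outwardNormal Ω x i) (surfaceMeasure Ω) := by
  have := isFiniteMeasure_surfaceMeasure hb hs
  obtain ⟨M, hM⟩ := hφ.bounded_above_of_compact_support hc
  have h1 : Integrable (fun x => g x * φ x) (surfaceMeasure Ω) :=
    (hg.integrable (by norm_num)).mul_bdd hφ.aestronglyMeasurable (Eventually.of_forall hM)
  exact h1.mul_bdd (aestronglyMeasurable_outwardNormal hs i) (abs_outwardNormal_le hs i)

lemma IsTrace.linComb (hΩ : IsOpen Ω) (hb : Bornology.IsBounded Ω) (hs : HasSmoothBoundary Ω)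
    (a b : ℝ) {g g' : Space d → ℝ} (h : IsTrace Ω u g) (h' : IsTrace Ω u' g') :
    IsTrace Ω (fun x => a * u x + b * u' x) (fun x => a * g x + b * g' x) := by
  refine ⟨h.1.linComb a b h'.1, (h.2.1.const_mul a).add (h'.2.1.const_mul b),
    fun φ h1 h2 i => ?_⟩
  have hcd := continuous_partialDeriv i (h1.of_le (m := 1) (by simp))
  have hcs := hasCompactSupport_partialDeriv i h2
  have hi : ∀ {w : Space d → ℝ}, MemH Ω 1 w → Integrable
      (fun x => w x * partialDeriv i φ x + weakPartial Ω i w x * φ x) (volume.restrict Ω) :=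
    fun hw => (integrable_mul_continuous hw.1 hcd hcs).add
      (integrable_mul_continuous (hw.weakPartial hΩ i).memLp h1.continuous h2)
  have e1 : ∫ x in Ω, ((a * u x + b * u' x) * partialDeriv i φ x +
      weakPartial Ω i (fun x => a * u x + b * u' x) x * φ x) =
      a * (∫ x in Ω, (u x * partialDeriv i φ x + weakPartial Ω i u x * φ x)) +
      b * (∫ x in Ω, (u' x * partialDeriv i φ x + weakPartial Ω i u' x * φ x)) := by
    rw [← integral_const_mul, ← integral_const_mul,
      ← integral_add ((hi h.1).const_mul a) ((hi h'.1).const_mul b)]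
    refine integral_congr_ae ?_
    filter_upwards [weakPartial_linComb hΩ a b h.1 h'.1 i] with x hx
    rw [hx]; ring
  rw [e1, h.2.2 φ h1 h2 i, h'.2.2 φ h1 h2 i, ← integral_const_mul, ← integral_const_mul,
    ← integral_add ((integrable_boundary hb hs h.2.1 h1.continuous h2 i).const_mul a)
      ((integrable_boundary hb hs h'.2.1 h1.continuous h2 i).const_mul b)]
  congr 1; ext x; ring

lemma IsTrace.congr {g g' : Space d → ℝ} (h : IsTrace Ω u g)
    (hu : u =ᵐ[volume.restrict Ω] u') (hg : g =ᵐ[surfaceMeasure Ω] g') : IsTrace Ω u' g' := by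
  refine ⟨h.1.congr hu, (memLp_congr_ae hg).1 h.2.1, fun φ h1 h2 i => ?_⟩
  have e := h.2.2 φ h1 h2 i
  rw [weakPartial_congr hu] at e
  have e1 : ∫ x in Ω, (u x * partialDeriv i φ x + weakPartial Ω i u' x * φ x) =
      ∫ x in Ω, (u' x * partialDeriv i φ x + weakPartial Ω i u' x * φ x) :=
    integral_congr_ae (hu.mono fun x hx => by simp only [hx])
  have e2 : ∫ x, g x * φ x * outwardNormal Ω x i ∂(surfaceMeasure Ω) =
      ∫ x, g' x * φ x * outwardNormal Ω x i ∂(surfaceMeasure Ω) :=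
    integral_congr_ae (hg.mono fun x hx => by simp only [hx])
  rw [← e1, e, e2]

lemma HasConormal.linComb (hΩ : IsOpen Ω) (hb : Bornology.IsBounded Ω)
    (hs : HasSmoothBoundary Ω) {A : Space d → Matrix (Fin d) (Fin d) ℝ} (a b : ℝ)
    {g g' : Space d → ℝ} (hu : MemH Ω 1 u) (hu' : MemH Ω 1 u')
    (h : HasConormal Ω A u g) (h' : HasConormal Ω A u' g') :
    HasConormal Ω A (fun x => a * u x + b * u' x) (fun x => a * g x + b * g' x) := by
  obtain ⟨w, hw, hg⟩ := h
  obtain ⟨w', hw', hg'⟩ := h'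
  refine ⟨fun j x => a * w j x + b * w' j x, fun j =>
    ((hw j).linComb hΩ hb hs a b (hw' j)).congr (weakPartial_linComb hΩ a b hu hu' j).symm .rfl, ?_⟩
  filter_upwards [hg, hg'] with x h1 h2
  rw [h1, h2, Finset.mul_sum, Finset.mul_sum, ← Finset.sum_add_distrib]
  refine Finset.sum_congr rfl fun i _ => ?_
  rw [← mul_assoc, ← mul_assoc, ← add_mul, Finset.mul_sum, Finset.mul_sum, ← Finset.sum_add_distrib]
  congr 1
  exact Finset.sum_congr rfl fun j _ => by ring

lemma HasCauchyData.linComb {N : ℕ} (hΩ : IsOpen Ω) (hb : Bornology.IsBounded Ω)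
    (hs : HasSmoothBoundary Ω) {A : Space d → Matrix (Fin d) (Fin d) ℝ} (a b : ℝ)
    {U F G U' F' G' : Fin N → Space d → ℝ} (h : HasCauchyData Ω A U F G)
    (h' : HasCauchyData Ω A U' F' G') :
    HasCauchyData Ω A (fun m x => a * U m x + b * U' m x) (fun m x => a * F m x + b * F' m x)
      (fun m x => a * G m x + b * G' m x) := fun m =>
  ⟨(h m).1.linComb hΩ hb hs a b (h' m).1,
    (h m).2.linComb hΩ hb hs a b (h m).1.1 (h' m).1.1 (h' m).2⟩

/-- A function with zero trace, extended by zero, is weakly differentiable on the whole space. -/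
lemma IsTrace.hasWeakPartial_indicator (hΩ : IsOpen Ω) (h : IsTrace Ω u fun _ => 0)
    (i : Fin d) :
    HasWeakPartial univ i (Ω.indicator u) (Ω.indicator (weakPartial Ω i u)) := by
  have hl : ∀ {w : Space d → ℝ}, MemLp w 2 (volume.restrict Ω) →
      LocallyIntegrableOn (Ω.indicator w) univ := fun hw =>
    (((memLp_indicator_iff_restrict hΩ.measurableSet).2 hw).locallyIntegrable
      (by norm_num)).locallyIntegrableOn _
  have hd := (h.1.weakPartial hΩ i).memLp
  refine ⟨hl h.1.1, hl hd, fun φ h1 h2 _ => ?_⟩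
  have hcd := continuous_partialDeriv i (h1.of_le (m := 1) (by simp))
  have hcs := hasCompactSupport_partialDeriv i h2
  have e := h.2.2 φ h1 h2 i
  rw [integral_add (integrable_mul_continuous h.1.1 hcd hcs)
    (integrable_mul_continuous hd h1.continuous h2)] at e
  have hi : ∀ w ψ : Space d → ℝ, ∫ x, Ω.indicator w x * ψ x = ∫ x in Ω, w x * ψ x := by
    intro w ψ
    rw [← integral_indicator hΩ.measurableSet]
    congr 1; ext x; by_cases hx : x ∈ Ω <;> simp [hx]
  rw [Measure.restrict_univ, hi, hi]
  simp only [zero_mul, integral_zero] at e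
  linarith

/-- If `u` has zero trace, then the trace of `∇u` is normal to the boundary: integrating by parts
twice shows that the tangential components `wⱼ νᵢ - wᵢ νⱼ` integrate to zero against every
test function. -/
lemma IsTrace.mul_normal_comm (hΩ : IsOpen Ω) (hb : Bornology.IsBounded Ω)
    (hs : HasSmoothBoundary Ω) (h : IsTrace Ω u fun _ => 0) {w : Fin d → Space d → ℝ}
    (hw : ∀ j, IsTrace Ω (weakPartial Ω j u) (w j)) (i j : Fin d) :
    ∀ᵐ x ∂(surfaceMeasure Ω), w j x * outwardNormal Ω x i = w i x * outwardNormal Ω x j := by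
  have := isFiniteMeasure_surfaceMeasure hb hs
  have hint : ∀ a b, Integrable (fun x => w a x * outwardNormal Ω x b) (surfaceMeasure Ω) :=
    fun a b => ((hw a).2.1.integrable (by norm_num)).mul_bdd
      (aestronglyMeasurable_outwardNormal hs b) (abs_outwardNormal_le hs b)
  have key := ae_eq_of_integral_contDiff_smul_eq (hint j i).locallyIntegrable
    (hint i j).locallyIntegrable ?_
  · exact key
  intro φ h1 h2
  have hcs := fun a : Fin d => hasCompactSupport_partialDeriv a h2
  have hsm : ∀ a : Fin d, ContDiff ℝ ∞ (partialDeriv a φ) := fun a =>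
    contDiff_partialDeriv a h1 (by simp)
  have hcd := fun a : Fin d => (hsm a).continuous
  have hcdd := fun a b : Fin d =>
    continuous_partialDeriv b ((hsm a).of_le (m := 1) (by simp))
  have hcsd := fun a b : Fin d => hasCompactSupport_partialDeriv b (hcs a)
  have hD := fun a : Fin d => (h.1.weakPartial hΩ a).memLp
  have hDD := fun a b : Fin d => ((hw a).1.weakPartial hΩ b).memLp
  have key : ∀ a b : Fin d, ∫ x, φ x * (w a x * outwardNormal Ω x b) ∂(surfaceMeasure Ω) =
      (-∫ x in Ω, u x * partialDeriv a (partialDeriv b φ) x) +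
        ∫ x in Ω, weakPartial Ω b (weakPartial Ω a u) x * φ x := by
    intro a b
    have e1 := (hw a).2.2 φ h1 h2 b
    have e2 := h.2.2 _ (hsm b) (hcs b) a
    rw [integral_add (integrable_mul_continuous (hD a) (hcd b) (hcs b))
      (integrable_mul_continuous (hDD a b) h1.continuous h2)] at e1
    rw [integral_add (integrable_mul_continuous h.1.1 (hcdd b a) (hcsd b a))
      (integrable_mul_continuous (hD a) (hcd b) (hcs b))] at e2
    simp only [zero_mul, integral_zero] at e2
    have e3 : ∫ x, φ x * (w a x * outwardNormal Ω x b) ∂(surfaceMeasure Ω) =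
        ∫ x, w a x * φ x * outwardNormal Ω x b ∂(surfaceMeasure Ω) := by
      congr 1; ext x; ring
    rw [e3, ← e1]
    linarith
  simp only [smul_eq_mul]
  rw [key, key]
  have e4 : ∀ x, partialDeriv j (partialDeriv i φ) x = partialDeriv i (partialDeriv j φ) x :=
    partialDeriv_comm (h1.of_le (WithTop.coe_le_coe.2 le_top)) j i
  simp_rw [e4]
  congr 1
  refine integral_congr_ae ?_
  filter_upwards [HasWeakPartial.comm hΩ (h.1.hasWeakPartial j) ((hw j).1.hasWeakPartial i)
    (h.1.hasWeakPartial i) ((hw i).1.hasWeakPartial j)] with x hx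
  rw [hx]

/-- Zero Cauchy data force the whole gradient to have zero trace: it is normal to the boundary,
and its normal component vanishes by ellipticity. -/
lemma HasConormal.isTrace_weakPartial (hΩ : IsOpen Ω) (hb : Bornology.IsBounded Ω)
    (hs : HasSmoothBoundary Ω) {A : Space d → Matrix (Fin d) (Fin d) ℝ} {μ : ℝ} (hμ : 0 < μ)
    (hA : ∀ x (ξ : Space d), μ * ‖ξ‖ ^ 2 ≤ ∑ i, ∑ j, A x i j * ξ j * ξ i)
    (h : IsTrace Ω u fun _ => 0) (hc : HasConormal Ω A u fun _ => 0) (j : Fin d) :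
    IsTrace Ω (QuasiReversibility.weakPartial Ω j u) fun _ => 0 := by
  obtain ⟨w, hw, h0⟩ := hc
  refine (hw j).congr .rfl ?_
  have hcomm : ∀ᵐ x ∂(surfaceMeasure Ω), ∀ i j,
      w j x * outwardNormal Ω x i = w i x * outwardNormal Ω x j :=
    ae_all_iff.2 fun i => ae_all_iff.2 fun j => h.mul_normal_comm hΩ hb hs hw i j
  have hfr : ∀ᵐ x ∂(surfaceMeasure Ω), x ∈ frontier Ω :=
    ae_restrict_mem isClosed_frontier.measurableSet
  filter_upwards [hcomm, hfr, h0] with x h1 h2 h3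
  set ν := outwardNormal Ω x with hν
  have hn : ∑ i, ν i ^ 2 = 1 := by
    have := norm_outwardNormal hs h2
    rw [EuclideanSpace.norm_eq, Real.sqrt_eq_one] at this
    simpa using this
  set s := ∑ i, w i x * ν i with hsdef
  -- `wⱼ νᵢ = wᵢ νⱼ` and `|ν| = 1` make `w` a multiple of `ν`
  have hws : ∀ j, w j x = s * ν j := by
    intro j
    calc w j x = w j x * ∑ i, ν i ^ 2 := by rw [hn, mul_one]
      _ = ∑ i, (w j x * ν i) * ν i := by
        rw [Finset.mul_sum]; exact Finset.sum_congr rfl fun i _ => by ring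
      _ = ∑ i, (w i x * ν j) * ν i := Finset.sum_congr rfl fun i _ => by rw [h1 i j]
      _ = s * ν j := by
        rw [hsdef, Finset.sum_mul]; exact Finset.sum_congr rfl fun i _ => by ring
  have hel := hA x ν
  rw [norm_outwardNormal hs h2] at hel
  -- hence the conormal derivative is `s (A ν · ν)`
  have h4 : 0 = s * ∑ i, ∑ j, A x i j * ν j * ν i := by
    rw [h3, Finset.mul_sum]
    refine Finset.sum_congr rfl fun i _ => ?_
    rw [Finset.sum_mul, Finset.mul_sum]
    exact Finset.sum_congr rfl fun j _ => by rw [hws j]; ring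
  have hs0 : s = 0 := by
    rcases mul_eq_zero.1 h4.symm with h5 | h5
    · exact h5
    · rw [h5] at hel; nlinarith
  rw [hws j, hs0, zero_mul]

end sobolev

/-! ### Convergence of mollifications in `L²` -/

section mollifyL2
variable {d : ℕ} {f u v : Space d → ℝ}

lemma integrable_bump_mul {k : ℕ} (hf : LocallyIntegrable f) (x : Space d) :
    Integrable fun y => (bumpSeq d k).normed volume y * f (x - y) :=
  (bumpSeq d k).hasCompactSupport_normed.convolutionExists_left (lsmul ℝ ℝ)
    (bumpSeq d k).continuous_normed hf x

/-- Jensen's inequality for the averaging operator `mollify k`. -/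
lemma sq_mollify_le (k : ℕ) (hf : MemLp f 2) (x : Space d) :
    mollify k f x ^ 2 ≤ mollify k (fun y => f y ^ 2) x := by
  set ρ := (bumpSeq d k).normed volume with hρ
  set m := mollify k f x with hm
  have i1 : Integrable fun y => ρ y * f (x - y) :=
    integrable_bump_mul (hf.locallyIntegrable (by norm_num)) x
  have i2 : Integrable fun y => ρ y * f (x - y) ^ 2 :=
    integrable_bump_mul (hf.integrable_sq.locallyIntegrable) x
  have i3 : Integrable ρ := (bumpSeq d k).integrable_normed
  have h0 : 0 ≤ ∫ y, ρ y * (f (x - y) - m) ^ 2 :=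
    integral_nonneg fun y => mul_nonneg ((bumpSeq d k).nonneg_normed y) (sq_nonneg _)
  have e : ∫ y, ρ y * (f (x - y) - m) ^ 2 =
      (∫ y, ρ y * f (x - y) ^ 2) - 2 * m * (∫ y, ρ y * f (x - y)) + m ^ 2 * ∫ y, ρ y := by
    have i4 : Integrable fun y => ρ y * f (x - y) ^ 2 - 2 * m * (ρ y * f (x - y)) :=
      i2.sub (i1.const_mul _)
    rw [← integral_const_mul, ← integral_const_mul, ← integral_sub i2 (i1.const_mul _),
      ← integral_add i4 (i3.const_mul _)]
    congr 1; ext y; ring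
  have e2 : mollify k (fun y => f y ^ 2) x = ∫ y, ρ y * f (x - y) ^ 2 := mollify_eq' _ _ _
  rw [e, ← e2, ← mollify_eq', ← hm, hρ, (bumpSeq d k).integral_normed] at h0
  nlinarith

lemma integrable_mollify (k : ℕ) (hf : Integrable f) : Integrable (mollify k f) :=
  ((bumpSeq d k).integrable_normed (μ := volume)).integrable_convolution (lsmul ℝ ℝ) hf

lemma integral_mollify (k : ℕ) (hf : Integrable f) : ∫ x, mollify k f x = ∫ x, f x := by
  have := integral_convolution (lsmul ℝ ℝ)
    ((bumpSeq d k).integrable_normed (μ := volume)) hf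
  rw [(bumpSeq d k).integral_normed] at this
  refine Eq.trans ?_ (this.trans (by simp))
  rfl

lemma memLp_mollify (k : ℕ) (hf : MemLp f 2) : MemLp (mollify k f) 2 := by
  have hc := (contDiff_mollify k (hf.locallyIntegrable (by norm_num))).continuous
  rw [memLp_two_iff_integrable_sq hc.aestronglyMeasurable]
  refine (integrable_mollify k hf.integrable_sq).mono' (hc.pow 2).aestronglyMeasurable
    (Eventually.of_forall fun x => ?_)
  rw [Real.norm_of_nonneg (sq_nonneg _)]
  exact sq_mollify_le k hf x

lemma integral_sq_mollify_le (k : ℕ) (hf : MemLp f 2) :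
    ∫ x, mollify k f x ^ 2 ≤ ∫ x, f x ^ 2 := by
  rw [← integral_mollify k hf.integrable_sq]
  exact integral_mono (memLp_mollify k hf).integrable_sq (integrable_mollify k hf.integrable_sq)
    (sq_mollify_le k hf)

lemma tendsto_integral_sq_mollify_sub_of_continuous (hf : Continuous f)
    (hc : HasCompactSupport f) :
    Tendsto (fun k => ∫ x, (mollify k f x - f x) ^ 2) atTop (𝓝 0) := by
  obtain ⟨M, hM⟩ := hf.bounded_above_of_compact_support hc
  set K := Metric.cthickening 1 (tsupport f)
  have hK : IsCompact K := IsCompact.cthickening hc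
  have h0 : (0 : ℝ) = ∫ _ : Space d, (0 : ℝ) := by simp
  rw [h0]
  refine tendsto_integral_of_dominated_convergence (K.indicator fun _ => (4 * M) ^ 2)
    (fun k => (((contDiff_mollify k hf.locallyIntegrable).continuous.sub hf).pow
      2).aestronglyMeasurable) ?_ (fun k => Eventually.of_forall fun x => ?_)
    (Eventually.of_forall fun x => ?_)
  · rw [integrable_indicator_iff hK.measurableSet]
    exact integrableOn_const hK.measure_lt_top.ne
  · rw [Real.norm_of_nonneg (sq_nonneg _)]
    by_cases hx : x ∈ K
    · rw [indicator_of_mem hx, sq_le_sq]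
      have h1 := abs_mollify_le k hf hM x
      have h2 : |f x| ≤ M := hM x
      have h3 := abs_sub (mollify k f x) (f x)
      exact (h3.trans (by linarith)).trans (le_abs_self _)
    · have h1 : mollify k f x = 0 := by
        refine image_eq_zero_of_notMem_tsupport fun h => hx ?_
        refine tsupport_mollify_subset k (subset_tsupport f) ?_ h
        change 1 / ((k : ℝ) + 1) ≤ 1
        rw [div_le_one (by positivity)]
        linarith [(k.cast_nonneg : (0 : ℝ) ≤ k)]
      have h2 : f x = 0 := image_eq_zero_of_notMem_tsupport fun h =>
        hx (Metric.self_subset_cthickening _ h)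
      simp [hx, h1, h2]
  · have := ((tendsto_mollify hf x).sub_const (f x)).pow 2
    simpa using this

lemma mollify_sub (k : ℕ) {g : Space d → ℝ} (hf : LocallyIntegrable f) (hg : LocallyIntegrable g)
    (x : Space d) : mollify k (fun y => f y - g y) x = mollify k f x - mollify k g x := by
  rw [mollify_eq', mollify_eq', mollify_eq',
    ← integral_sub (integrable_bump_mul hf x) (integrable_bump_mul hg x)]
  congr 1; ext y; ring

/-- Mollifications converge in `L²`: by density of `C_c` and the uniform bound
`integral_sq_mollify_le`. -/
lemma tendsto_integral_sq_mollify_sub (hf : MemLp f 2) :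
    Tendsto (fun k => ∫ x, (mollify k f x - f x) ^ 2) atTop (𝓝 0) := by
  rw [Metric.tendsto_atTop]
  intro ε hε
  obtain ⟨g, hgc, hgε, hg, hg2⟩ := MemLp.exists_hasCompactSupport_integral_rpow_sub_le (p := 2)
    (by norm_num) (by simpa using hf) (ε := ε / 12) (by positivity)
  have hg2 : MemLp g 2 := by simpa using hg2
  have hgε : ∫ x, (f x - g x) ^ 2 ≤ ε / 12 := by simpa using hgε
  -- `mollify k f - f = mollify k (f - g) + (mollify k g - g) + (g - f)`, and `3 (a + b + c)` with
  -- `a, c ≤ ε / 12` and `b < ε / 6` is less than `ε`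
  obtain ⟨n, hn⟩ := (Metric.tendsto_atTop.1 (tendsto_integral_sq_mollify_sub_of_continuous hg hgc))
    (ε / 6) (by positivity)
  refine ⟨n, fun k hk => ?_⟩
  have hk' := hn k hk
  rw [Real.dist_0_eq_abs, abs_of_nonneg (integral_nonneg fun _ => sq_nonneg _)] at hk' ⊢
  have hfg : MemLp (fun y => f y - g y) 2 := hf.sub hg2
  have i1 := (memLp_mollify k hfg).integrable_sq
  have i2 : Integrable fun x => (mollify k g x - g x) ^ 2 :=
    ((memLp_mollify k hg2).sub hg2).integrable_sq
  have i3 := hfg.integrable_sq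
  have hle : ∫ x, (mollify k f x - f x) ^ 2 ≤ 3 * (∫ x, mollify k (fun y => f y - g y) x ^ 2) +
      3 * (∫ x, (mollify k g x - g x) ^ 2) + 3 * ∫ x, (f x - g x) ^ 2 := by
    have i4 : Integrable fun x => 3 * mollify k (fun y => f y - g y) x ^ 2 +
        3 * (mollify k g x - g x) ^ 2 := (i1.const_mul 3).add (i2.const_mul 3)
    rw [← integral_const_mul, ← integral_const_mul, ← integral_const_mul,
      ← integral_add (i1.const_mul 3) (i2.const_mul 3),
      ← integral_add i4 (i3.const_mul 3)]
    refine integral_mono (((memLp_mollify k hf).sub hf).integrable_sq)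
      (i4.add (i3.const_mul 3)) fun x => ?_
    have e := mollify_sub k (hf.locallyIntegrable (by norm_num))
      (hg2.locallyIntegrable (by norm_num)) x
    change (mollify k f x - f x) ^ 2 ≤ _
    rw [e]
    nlinarith [sq_nonneg ((mollify k f x - mollify k g x) - (mollify k g x - g x)),
      sq_nonneg ((mollify k f x - mollify k g x) + (f x - g x)),
      sq_nonneg ((mollify k g x - g x) + (f x - g x))]
  have := integral_sq_mollify_le k hfg
  linarith

/-- Mollification commutes with weak differentiation. -/
lemma HasWeakPartial.partialDeriv_mollify {i : Fin d} (h : HasWeakPartial univ i u v) (k : ℕ)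
    (x : Space d) : partialDeriv i (mollify k u) x = mollify k v x := by
  set ρ := (bumpSeq d k).normed volume with hρ
  have hρs : ContDiff ℝ ∞ ρ := (bumpSeq d k).contDiff_normed
  have hρc : HasCompactSupport ρ := (bumpSeq d k).hasCompactSupport_normed
  have hu : LocallyIntegrable u := locallyIntegrableOn_univ.1 h.1
  have h1 := hρc.hasFDerivAt_convolution_right (lsmul ℝ ℝ).flip hu (hρs.of_le (by simp)) x
  rw [convolution_flip] at h1
  -- the derivative falls on the kernel, and `y ↦ ρ (x - y)` is a test function
  have e1 : partialDeriv i (mollify k u) x = ∫ y, u y * partialDeriv i ρ (x - y) := by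
    unfold partialDeriv
    rw [show fderiv ℝ (mollify k u) x = _ from h1.fderiv,
      convolution_precompR_apply (lsmul ℝ ℝ).flip hu (hρc.fderiv ℝ)
        (hρs.continuous_fderiv (by simp))]
    simp [convolution_def, mul_comm]
  have hφs : ContDiff ℝ ∞ fun y => ρ (x - y) := hρs.comp (contDiff_const.sub contDiff_id)
  have hφc : HasCompactSupport fun y => ρ (x - y) :=
    hρc.comp_homeomorph (Homeomorph.subLeft x)
  have hφd : ∀ y, partialDeriv i (fun y => ρ (x - y)) y = -partialDeriv i ρ (x - y) := by
    intro y
    have hd : HasFDerivAt (fun y => ρ (x - y))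
        ((fderiv ℝ ρ (x - y)).comp (-ContinuousLinearMap.id ℝ (Space d))) y :=
      HasFDerivAt.comp y (hρs.differentiable (by simp) (x - y)).hasFDerivAt
        ((hasFDerivAt_id y).const_sub x)
    unfold partialDeriv
    rw [hd.fderiv]
    simp
  have e2 := h.2.2 _ hφs hφc (subset_univ _)
  simp only [Measure.restrict_univ, hφd, mul_neg, integral_neg, neg_inj] at e2
  rw [e1, e2, mollify_eq]
  congr 1; ext y; ring

end mollifyL2

/-! ### The algebra of the Carleman estimate -/

/-- A pointwise jet: the values at a point of a symmetric coefficient matrix `a`, of its first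
derivatives `da i j l = ∂ᵢ a_{jl}`, and of a function `v` with gradient `g` and Hessian `H`.
`o` is the coordinate along which the weight varies. -/
structure Jet (d : ℕ) where
  o : Fin d
  a : Fin d → Fin d → ℝ
  da : Fin d → Fin d → Fin d → ℝ
  v : ℝ
  g : Fin d → ℝ
  H : Fin d → Fin d → ℝ
  a_symm : ∀ i j, a i j = a j i
  H_symm : ∀ i j, H i j = H j i

namespace Jet
variable {d : ℕ} (J : Jet d)

/-- The flux `A ∇v`. -/
def q (i : Fin d) : ℝ := ∑ j, J.a i j * J.g j

/-- The derivative `∂ᵢ (A ∇v)ⱼ`. -/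
def dq (i j : Fin d) : ℝ := ∑ l, (J.a j l * J.H i l + J.da i j l * J.g l)

/-- The divergence `Div (A ∇v)`. -/
def D : ℝ := ∑ i, J.dq i i

/-- The energy density `A ∇v · ∇v`. -/
def Q : ℝ := ∑ i, J.q i * J.g i

/-- The derivative `∂ᵢ (A ∇v · ∇v)`. -/
def dQ (i : Fin d) : ℝ := ∑ j, (J.q j * J.H i j + J.dq i j * J.g j)

/-- The divergence of the `o`-th column of `A`. -/
def s : ℝ := ∑ i, J.da i i J.o

/-- The indicator of the direction `o`. -/
def δ (i : Fin d) : ℝ := if i = J.o then 1 else 0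

/-- The derivative `∂ᵢ Fᵢ` of the field
`F = -2 h p A∇v + h Q a_o - 2 β h α v A∇v - h³ α v² a_o`, with `p = (A∇v)_o`, `α = a_{oo}`,
`a_o` the `o`-th column of `A` and `∂ᵢ h = β h δᵢ`. -/
def dF (β h : ℝ) (i : Fin d) : ℝ :=
  -2 * (h * (J.q J.o * J.dq i i + J.dq i J.o * J.q i) + β * h * J.δ i * (J.q J.o * J.q i)) +
  (h * (J.a i J.o * J.dQ i + J.da i i J.o * J.Q) + β * h * J.δ i * (J.a i J.o * J.Q)) +
  -2 * β * (h * (J.a J.o J.o * (J.v * J.dq i i + J.g i * J.q i) +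
    J.da i J.o J.o * (J.v * J.q i)) + β * h * J.δ i * (J.a J.o J.o * (J.v * J.q i))) -
  (h ^ 3 * (J.a J.o J.o * (J.a i J.o * (2 * J.v * J.g i) + J.da i i J.o * J.v ^ 2) +
    J.da i J.o J.o * (J.a i J.o * J.v ^ 2)) +
    3 * h ^ 2 * (β * h * J.δ i) * (J.a J.o J.o * (J.a i J.o * J.v ^ 2)))

/-- The conjugated operator `e^Φ Div(A ∇(e^{-Φ} v))`, where `∂ᵢ Φ = h δᵢ`. -/
def conj (β h : ℝ) : ℝ :=
  J.D - 2 * h * J.q J.o + h ^ 2 * J.a J.o J.o * J.v -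
    (β * h * J.a J.o J.o + h * J.s) * J.v

/-- The terms of the multiplier identity which are quadratic in the gradient and carry no factor
`β`; they are absorbed by the term `β h α Q`. -/
def gradErr : ℝ :=
  2 * (∑ i, (∑ l, J.da i J.o l * J.g l) * J.q i) -
    (∑ i, J.a i J.o * ∑ j, (∑ l, J.da i j l * J.g l) * J.g j) - J.s * J.Q

lemma sum_δ_mul (f : Fin d → ℝ) : ∑ i, J.δ i * f i = f J.o := by
  simp [δ]

lemma sum_dQ_eq : ∑ i, J.a i J.o * J.dQ i =
    2 * (∑ i, J.dq i J.o * J.q i) - 2 * (∑ i, (∑ l, J.da i J.o l * J.g l) * J.q i) +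
      ∑ i, J.a i J.o * ∑ j, (∑ l, J.da i j l * J.g l) * J.g j := by
  have hM : ∑ i, J.dq i J.o * J.q i = (∑ i, ∑ l, J.a J.o l * J.H i l * J.q i) +
      ∑ i, (∑ l, J.da i J.o l * J.g l) * J.q i := by
    rw [← Finset.sum_add_distrib]
    refine Finset.sum_congr rfl fun i _ => ?_
    rw [dq, Finset.sum_add_distrib, add_mul, Finset.sum_mul]
  have hq : ∀ i, ∑ j, (∑ l, J.a j l * J.H i l) * J.g j = ∑ l, J.q l * J.H i l := by
    intro i
    simp_rw [Finset.sum_mul, q]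
    rw [Finset.sum_comm]
    refine Finset.sum_congr rfl fun l _ => ?_
    rw [Finset.sum_mul]
    exact Finset.sum_congr rfl fun j _ => by rw [J.a_symm j l]; ring
  have hQ : ∀ i, J.dQ i = 2 * (∑ j, J.q j * J.H i j) + ∑ j, (∑ l, J.da i j l * J.g l) * J.g j := by
    intro i
    have : ∀ j, J.dq i j * J.g j =
        (∑ l, J.a j l * J.H i l) * J.g j + (∑ l, J.da i j l * J.g l) * J.g j := by
      intro j; rw [dq, Finset.sum_add_distrib, add_mul]
    simp_rw [dQ, this, Finset.sum_add_distrib, hq]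
    ring
  have hZ : ∑ i, J.a i J.o * ∑ j, J.q j * J.H i j = ∑ i, ∑ l, J.a J.o l * J.H i l * J.q i := by
    simp_rw [Finset.mul_sum]
    rw [Finset.sum_comm]
    refine Finset.sum_congr rfl fun i _ => Finset.sum_congr rfl fun l _ => ?_
    rw [J.a_symm l, J.H_symm l i]; ring
  have hsum : ∑ i, J.a i J.o * J.dQ i = 2 * (∑ i, J.a i J.o * ∑ j, J.q j * J.H i j) +
      ∑ i, J.a i J.o * ∑ j, (∑ l, J.da i j l * J.g l) * J.g j := by
    rw [Finset.mul_sum, ← Finset.sum_add_distrib]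
    exact Finset.sum_congr rfl fun i _ => by rw [hQ i]; ring
  rw [hsum, hZ, hM]
  ring

/-- The multiplier identity: multiplying the even part `D + h² α v` of the conjugated operator by
`-2 h p - 2 β h α v` gives a divergence, positive quadratic terms carrying the factor `β`, and
lower-order terms. -/
lemma multiplier_identity (β h : ℝ) :
    (J.D + h ^ 2 * J.a J.o J.o * J.v) * (-2 * h * J.q J.o - 2 * β * h * J.a J.o J.o * J.v) =
      (∑ i, J.dF β h i) + 2 * β * h * J.q J.o ^ 2 + β * h * J.a J.o J.o * J.Q +
      β * h ^ 3 * J.a J.o J.o ^ 2 * J.v ^ 2 + h * J.gradErr +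
      2 * β ^ 2 * h * J.a J.o J.o * J.v * J.q J.o +
      2 * β * h * J.v * (∑ i, J.da i J.o J.o * J.q i) +
      h ^ 3 * ((∑ i, J.da i J.o J.o * J.a i J.o) + J.a J.o J.o * J.s) * J.v ^ 2 := by
  set α := J.a J.o J.o with hα
  set p := J.q J.o with hp
  -- `∂ᵢ Fᵢ`, sorted so that every term has its sum over `i` as a factor
  have hdF : ∀ i, J.dF β h i =
      (-2 * h * p - 2 * β * h * α * J.v) * J.dq i i + (-2 * h) * (J.dq i J.o * J.q i) +
      (-2 * β * h * p) * (J.δ i * J.q i) + h * (J.a i J.o * J.dQ i) +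
      (h * J.Q - h ^ 3 * α * J.v ^ 2) * J.da i i J.o +
      (β * h * J.Q - 3 * β * h ^ 3 * α * J.v ^ 2) * (J.δ i * J.a i J.o) +
      (-2 * β * h * α) * (J.q i * J.g i) + (-2 * β * h * J.v) * (J.da i J.o J.o * J.q i) +
      (-2 * β ^ 2 * h * α * J.v) * (J.δ i * J.q i) +
      (-2 * h ^ 3 * α * J.v) * (J.a J.o i * J.g i) +
      (-h ^ 3 * J.v ^ 2) * (J.da i J.o J.o * J.a i J.o) := by
    intro i
    rw [dF, J.a_symm J.o i, ← hα, ← hp]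
    ring
  have hpsum : ∑ i, J.a J.o i * J.g i = p := rfl
  simp_rw [hdF, Finset.sum_add_distrib, ← Finset.mul_sum, sum_δ_mul, sum_dQ_eq, hpsum]
  rw [gradErr]
  change _ = (-2 * h * p - 2 * β * h * α * J.v) * J.D + _ + _ + _ + _ * J.s + _ + _ * J.Q + _ + _
    + _ + _ + _ + _ + _ + _ + _ + _ + _
  rw [← hα, ← hp]
  ring

/-- The squared length of the gradient. -/
def G : ℝ := ∑ i, J.g i ^ 2

lemma abs_sum_le_card_mul {f : Fin d → ℝ} {M : ℝ} (hf : ∀ i, |f i| ≤ M) :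
    |∑ i, f i| ≤ d * M := by
  refine (Finset.abs_sum_le_sum_abs _ _).trans
    ((Finset.sum_le_sum fun i _ => hf i).trans (by simp))

/-- Bounds for the terms of `multiplier_identity` to be absorbed, in terms of `γ = |∇v|`. -/
lemma error_bounds {L : ℝ} (ha : ∀ i j, |J.a i j| ≤ L) (hda : ∀ i j l, |J.da i j l| ≤ L) :
    -(4 * d ^ 3 * L ^ 2 * J.G) ≤ J.gradErr ∧
    |J.a J.o J.o * J.q J.o| ≤ L * (d * (L * √J.G)) ∧
    |∑ i, J.da i J.o J.o * J.q i| ≤ d * (L * (d * (L * √J.G))) ∧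
    -(2 * d * L ^ 2) ≤ (∑ i, J.da i J.o J.o * J.a i J.o) + J.a J.o J.o * J.s ∧
    |J.s| ≤ d * L := by
  set γ := Real.sqrt J.G with hγ
  have hG0 : 0 ≤ J.G := Finset.sum_nonneg fun i _ => sq_nonneg _
  have hγ2 : γ ^ 2 = J.G := Real.sq_sqrt hG0
  have hg : ∀ i, |J.g i| ≤ γ := fun i => Real.abs_le_sqrt
    (Finset.single_le_sum (f := fun i => J.g i ^ 2) (fun i _ => sq_nonneg _) (Finset.mem_univ i))
  have hmul : ∀ {x y X Y : ℝ}, |x| ≤ X → |y| ≤ Y → |x * y| ≤ X * Y := fun hx hy => by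
    rw [abs_mul]
    exact mul_le_mul hx hy (abs_nonneg _) ((abs_nonneg _).trans hx)
  have hq : ∀ i, |J.q i| ≤ d * (L * γ) := fun i =>
    abs_sum_le_card_mul fun j => hmul (ha i j) (hg j)
  have hs : |J.s| ≤ d * L := abs_sum_le_card_mul fun i => hda i i _
  have hdag : ∀ i j, |∑ l, J.da i j l * J.g l| ≤ d * (L * γ) := fun i j =>
    abs_sum_le_card_mul fun l => hmul (hda i j l) (hg l)
  have hE1 : |∑ i, (∑ l, J.da i J.o l * J.g l) * J.q i| ≤ d * (d * (L * γ) * (d * (L * γ))) :=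
    abs_sum_le_card_mul fun i => hmul (hdag i _) (hq i)
  have hE2 : |∑ i, J.a i J.o * ∑ j, (∑ l, J.da i j l * J.g l) * J.g j| ≤
      d * (L * (d * (d * (L * γ) * γ))) :=
    abs_sum_le_card_mul fun i => hmul (ha i _)
      (abs_sum_le_card_mul fun j => hmul (hdag i j) (hg j))
  have hQle : |J.Q| ≤ d * (d * (L * γ) * γ) := abs_sum_le_card_mul fun i => hmul (hq i) (hg i)
  have hE3 := hmul hs hQle
  have hE4 : |∑ i, J.da i J.o J.o * J.q i| ≤ d * (L * (d * (L * γ))) :=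
    abs_sum_le_card_mul fun i => hmul (hda i _ _) (hq i)
  have hE5 : |∑ i, J.da i J.o J.o * J.a i J.o| ≤ d * (L * L) :=
    abs_sum_le_card_mul fun i => hmul (hda i _ _) (ha i _)
  have hE6 : |J.a J.o J.o * J.s| ≤ L * (d * L) := hmul (ha _ _) hs
  have hgradErr : -(4 * d ^ 3 * L ^ 2 * J.G) ≤ J.gradErr := by
    rw [gradErr, ← hγ2]
    have h1 := neg_abs_le (∑ i, (∑ l, J.da i J.o l * J.g l) * J.q i)
    have h2 := le_abs_self (∑ i, J.a i J.o * ∑ j, (∑ l, J.da i j l * J.g l) * J.g j)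
    have h3 := le_abs_self (J.s * J.Q)
    have e1 : (d : ℝ) * (d * (L * γ) * (d * (L * γ))) = d ^ 3 * L ^ 2 * γ ^ 2 := by ring
    have e2 : (d : ℝ) * (L * (d * (d * (L * γ) * γ))) = d ^ 3 * L ^ 2 * γ ^ 2 := by ring
    have e3 : (d : ℝ) * L * (d * (d * (L * γ) * γ)) = d ^ 3 * L ^ 2 * γ ^ 2 := by ring
    rw [e1] at hE1
    rw [e2] at hE2
    rw [e3] at hE3
    linarith
  refine ⟨hgradErr, hmul (ha _ _) (hq _), hE4, ?_, hs⟩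
  have e1 : (d : ℝ) * (L * L) = d * L ^ 2 := by ring
  have e2 : L * (d * L) = d * L ^ 2 := by ring
  rw [e1] at hE5
  rw [e2] at hE6
  have := (abs_le.1 hE5).1
  have := (abs_le.1 hE6).1
  linarith

/-- If `X Y` is bounded below, so is `P²` for `P = X + Y - R`, up to `R²`. -/
lemma mul_le_sq_add_sq (X Y R : ℝ) : X * Y ≤ (X + Y - R) ^ 2 + R ^ 2 := by
  nlinarith [sq_nonneg (X - Y), sq_nonneg (X + Y - 2 * R)]

/-- The square of the conjugated operator controls the right-hand side of `multiplier_identity`. -/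
lemma identity_le_conj_sq (β h : ℝ) :
    (∑ i, J.dF β h i) + 2 * β * h * J.q J.o ^ 2 + β * h * J.a J.o J.o * J.Q +
      β * h ^ 3 * J.a J.o J.o ^ 2 * J.v ^ 2 + h * J.gradErr +
      2 * β ^ 2 * h * J.a J.o J.o * J.v * J.q J.o +
      2 * β * h * J.v * (∑ i, J.da i J.o J.o * J.q i) +
      h ^ 3 * ((∑ i, J.da i J.o J.o * J.a i J.o) + J.a J.o J.o * J.s) * J.v ^ 2 ≤
    J.conj β h ^ 2 + (h * (-(β * J.a J.o J.o) + J.s) * J.v) ^ 2 := by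
  rw [← multiplier_identity]
  have hconj : J.conj β h = (J.D + h ^ 2 * J.a J.o J.o * J.v) +
      (-2 * h * J.q J.o - 2 * β * h * J.a J.o J.o * J.v) -
      h * (-(β * J.a J.o J.o) + J.s) * J.v := by
    rw [conj]; ring
  rw [hconj]
  exact mul_le_sq_add_sq _ _ _

/-- The Carleman inequality at a point, under explicit largeness conditions on `β` and `h`. The
positive terms are at least `c (h |∇v|² + h³ v²)`. Each of four groups of error terms costs a
quarter of `c h |∇v|²`, of `c h³ v²`, or of both, and at most three of them concern the same square;
a quarter remains, and `c ≥ 12`. The constant `K` bounds the mixed terms `v ∇v`, and `K2` the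
zero-order remainder of the conjugated operator. -/
lemma dF_le_conj_sq {L μ β h c K K2 : ℝ} (hL : 0 ≤ L) (hμ : 0 < μ)
    (ha : ∀ i j, |J.a i j| ≤ L) (hda : ∀ i j l, |J.da i j l| ≤ L) (hQ : μ * J.G ≤ J.Q)
    (hα : μ ≤ J.a J.o J.o) (hβ0 : 0 < β) (hc : c = β * μ ^ 2) (hβ12 : 12 ≤ c)
    (hβ1 : 4 * (4 * d ^ 3 * L ^ 2) ≤ c) (hβ2 : 4 * (2 * d * L ^ 2) ≤ c)
    (hK : K = 2 * β ^ 2 * (L * (d * L)) + 2 * β * (d * (L * (d * L))))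
    (hK2 : K2 = β * L + d * L) (hh1 : 1 ≤ h) (hhK : 2 * K ≤ c * h) (hhK2 : 4 * K2 ^ 2 ≤ c * h) :
    (∑ i, J.dF β h i) + 3 * (h * J.G + h ^ 3 * J.v ^ 2) ≤ J.conj β h ^ 2 := by
  have hK0 : 0 ≤ K := by rw [hK]; positivity
  have hc0 : 0 < c := by linarith
  have hh0 : 0 < h := by linarith
  set α := J.a J.o J.o with hαdef
  set p := J.q J.o with hp
  set γ := Real.sqrt J.G with hγ
  have hG0 : 0 ≤ J.G := Finset.sum_nonneg fun i _ => sq_nonneg _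
  have hγ0 : 0 ≤ γ := Real.sqrt_nonneg _
  have hγ2 : γ ^ 2 = J.G := Real.sq_sqrt hG0
  obtain ⟨hgradErr, hαp, hE4, hE56, hs⟩ := J.error_bounds ha hda
  have t1 : h * (-(4 * d ^ 3 * L ^ 2 * J.G)) ≤ h * J.gradErr :=
    mul_le_mul_of_nonneg_left hgradErr hh0.le
  have t1' : h * (4 * d ^ 3 * L ^ 2 * J.G) ≤ c / 4 * (h * J.G) := by
    have : 4 * d ^ 3 * L ^ 2 * (h * J.G) ≤ c / 4 * (h * J.G) :=
      mul_le_mul_of_nonneg_right (by linarith) (by positivity)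
    linarith
  have t2 : -(K * (h * (γ * |J.v|))) ≤ 2 * β ^ 2 * h * α * J.v * p +
      2 * β * h * J.v * (∑ i, J.da i J.o J.o * J.q i) := by
    have h2 : |2 * β ^ 2 * (α * p) + 2 * β * (∑ i, J.da i J.o J.o * J.q i)| ≤ K * γ := by
      refine (abs_add_le _ _).trans ?_
      rw [abs_mul, abs_mul (2 * β), abs_of_pos (by positivity : 0 < 2 * β ^ 2),
        abs_of_pos (by positivity : 0 < 2 * β)]
      have h3 := mul_le_mul_of_nonneg_left hαp (by positivity : 0 ≤ 2 * β ^ 2)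
      have h4 := mul_le_mul_of_nonneg_left hE4 (by positivity : 0 ≤ 2 * β)
      rw [hK]
      linarith
    have h5 := mul_le_mul_of_nonneg_right h2 (abs_nonneg J.v)
    rw [← abs_mul] at h5
    have h6 := (abs_le.1 h5).1
    have h7 := mul_le_mul_of_nonneg_left h6 hh0.le
    linarith
  have t2' : K * (h * (γ * |J.v|)) ≤ c / 4 * (h * J.G + h ^ 3 * J.v ^ 2) := by
    have h1 : 2 * (h * (γ * |J.v|)) ≤ J.G + h ^ 2 * J.v ^ 2 := by
      rw [← hγ2, ← sq_abs J.v]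
      nlinarith [sq_nonneg (γ - h * |J.v|)]
    have h2 : 0 ≤ J.G + h ^ 2 * J.v ^ 2 := by positivity
    have h3 := mul_le_mul_of_nonneg_left h1 hK0
    have h4 := mul_le_mul_of_nonneg_right hhK h2
    have e : c * h * (J.G + h ^ 2 * J.v ^ 2) = c * (h * J.G + h ^ 3 * J.v ^ 2) := by ring
    rw [e] at h4
    linarith
  have t3 : -(c / 4 * (h ^ 3 * J.v ^ 2)) ≤
      h ^ 3 * ((∑ i, J.da i J.o J.o * J.a i J.o) + α * J.s) * J.v ^ 2 := by
    have h1 : -(c / 4) ≤ (∑ i, J.da i J.o J.o * J.a i J.o) + α * J.s := by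
      linarith
    have h2 := mul_le_mul_of_nonneg_right h1 (by positivity : 0 ≤ h ^ 3 * J.v ^ 2)
    linarith
  have t4 : c * (h * J.G) ≤ β * h * α * J.Q := by
    have h1 : μ * (μ * J.G) ≤ α * J.Q :=
      mul_le_mul hα hQ (by positivity) (hμ.le.trans hα)
    have h2 := mul_le_mul_of_nonneg_left h1 (by positivity : 0 ≤ β * h)
    rw [hc]
    linarith
  have t5 : c * (h ^ 3 * J.v ^ 2) ≤ β * h ^ 3 * α ^ 2 * J.v ^ 2 := by
    have h1 : μ ^ 2 ≤ α ^ 2 := pow_le_pow_left₀ hμ.le hα 2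
    have h2 := mul_le_mul_of_nonneg_left h1 (by positivity : 0 ≤ β * (h ^ 3 * J.v ^ 2))
    rw [hc]
    linarith
  have t6 : 0 ≤ 2 * β * h * p ^ 2 := by positivity
  have hid := J.identity_le_conj_sq β h
  rw [← hαdef, ← hp] at hid
  have hr2 : (h * (-(β * α) + J.s) * J.v) ^ 2 ≤ c / 4 * (h ^ 3 * J.v ^ 2) := by
    have h1 : |h * (-(β * α) + J.s)| ≤ h * K2 := by
      rw [abs_mul, abs_of_pos hh0]
      refine mul_le_mul_of_nonneg_left ?_ hh0.le
      refine (abs_add_le _ _).trans ?_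
      rw [abs_neg, abs_mul, abs_of_pos hβ0]
      have := mul_le_mul_of_nonneg_left (ha J.o J.o) hβ0.le
      rw [hK2]
      linarith
    have h2 : (h * (-(β * α) + J.s)) ^ 2 ≤ (h * K2) ^ 2 :=
      sq_le_sq' (abs_le.1 h1).1 (abs_le.1 h1).2
    have h3 : (h * K2) ^ 2 ≤ c / 4 * h ^ 3 := by
      have := mul_le_mul_of_nonneg_left hhK2 (by positivity : 0 ≤ h ^ 2)
      linarith
    have h4 := mul_le_mul_of_nonneg_right (h2.trans h3) (sq_nonneg J.v)
    rw [mul_pow]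
    linarith
  have hfin : c / 4 * (h * J.G + h ^ 3 * J.v ^ 2) ≥ 3 * (h * J.G + h ^ 3 * J.v ^ 2) :=
    mul_le_mul_of_nonneg_right (by linarith) (by positivity)
  have hhG : 0 ≤ c / 4 * (h * J.G) := by positivity
  linarith

/-- For `β` large and then `h` large, the positive terms of `multiplier_identity` dominate. -/
lemma exists_carleman_parameters (d : ℕ) (L : ℝ) (hL : 0 ≤ L) {μ : ℝ} (hμ : 0 < μ) :
    ∃ β : ℝ, 0 < β ∧ ∃ h₀ : ℝ, 1 ≤ h₀ ∧ ∀ J : Jet d, (∀ i j, |J.a i j| ≤ L) →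
      (∀ i j l, |J.da i j l| ≤ L) → μ * J.G ≤ J.Q → μ ≤ J.a J.o J.o → ∀ h, h₀ ≤ h →
      (∑ i, J.dF β h i) + 3 * (h * J.G + h ^ 3 * J.v ^ 2) ≤ J.conj β h ^ 2 := by
  obtain ⟨β, hβ⟩ : ∃ β : ℝ, 0 < β ∧ 12 ≤ β * μ ^ 2 ∧ 4 * (4 * d ^ 3 * L ^ 2) ≤ β * μ ^ 2 ∧
      4 * (2 * d * L ^ 2) ≤ β * μ ^ 2 := by
    refine ⟨(12 + 4 * (4 * d ^ 3 * L ^ 2) + 4 * (2 * d * L ^ 2)) / μ ^ 2, by positivity, ?_⟩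
    rw [div_mul_cancel₀ _ (by positivity)]
    have h1 : 0 ≤ 4 * (4 * (d : ℝ) ^ 3 * L ^ 2) := by positivity
    have h2 : 0 ≤ 4 * (2 * (d : ℝ) * L ^ 2) := by positivity
    exact ⟨by linarith, by linarith, by linarith⟩
  obtain ⟨hβ0, hβ12, hβ1, hβ2⟩ := hβ
  set c := β * μ ^ 2 with hc
  set K := 2 * β ^ 2 * (L * (d * L)) + 2 * β * (d * (L * (d * L))) with hK
  set K2 := β * L + d * L with hK2
  have hK0 : 0 ≤ K := by positivity
  have hK20 : 0 ≤ K2 := by positivity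
  have hc0 : 0 < c := by linarith
  refine ⟨β, hβ0, 1 + 2 * K / c + 4 * K2 ^ 2 / c, by
    have : 0 ≤ 2 * K / c := by positivity
    have : 0 ≤ 4 * K2 ^ 2 / c := by positivity
    linarith, fun J ha hda hQ hα h hh => ?_⟩
  have hh1 : 1 ≤ h ∧ 2 * K ≤ c * h ∧ 4 * K2 ^ 2 ≤ c * h := by
    have h1 : 0 ≤ 2 * K / c := by positivity
    have h2 : 0 ≤ 4 * K2 ^ 2 / c := by positivity
    refine ⟨by linarith, ?_, ?_⟩
    · rw [← div_le_iff₀' hc0]; linarith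
    · rw [← div_le_iff₀' hc0]; linarith
  obtain ⟨hh1, hhK, hhK2⟩ := hh1
  exact J.dF_le_conj_sq hL hμ ha hda hQ hα hβ0 hc hβ12 hβ1 hβ2 hK hK2 hh1 hhK hhK2

end Jet

/-! ### The Carleman estimate for smooth functions -/

section calculus
variable {d : ℕ} {A : Space d → Matrix (Fin d) (Fin d) ℝ} {v w : Space d → ℝ} {β τ : ℝ} {o : Fin d}

lemma partialDeriv_pow {f : Space d → ℝ} {x : Space d} {i : Fin d} (n : ℕ)
    (hf : DifferentiableAt ℝ f x) :
    partialDeriv i (fun y => f y ^ n) x = n * f x ^ (n - 1) * partialDeriv i f x := by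
  simp [partialDeriv, fderiv_fun_pow n hf]

/-- The flux `A ∇w`. -/
noncomputable def flux (A : Space d → Matrix (Fin d) (Fin d) ℝ) (w : Space d → ℝ) (i : Fin d)
    (x : Space d) : ℝ :=
  ∑ j, A x i j * partialDeriv j w x

/-- The principal part `Div (A ∇w)`, with classical derivatives. -/
noncomputable def divForm (A : Space d → Matrix (Fin d) (Fin d) ℝ) (w : Space d → ℝ)
    (x : Space d) : ℝ :=
  ∑ i, partialDeriv i (flux A w i) x

/-- The exponential weight `e^Φ` with `Φ = τ e^{β xₒ}`. -/
noncomputable def carlemanWeight (β τ : ℝ) (o : Fin d) (x : Space d) : ℝ :=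
  Real.exp (τ * Real.exp (β * x o))

/-- The derivative `∂ₒ Φ = τ β e^{β xₒ}` of the phase `Φ = τ e^{β xₒ}`. -/
noncomputable def phaseDeriv (β τ : ℝ) (o : Fin d) (x : Space d) : ℝ :=
  τ * β * Real.exp (β * x o)

lemma contDiff_carlemanWeight (β τ : ℝ) (o : Fin d) : ContDiff ℝ ∞ (carlemanWeight β τ o) := by
  unfold carlemanWeight; fun_prop

lemma contDiff_phaseDeriv (β τ : ℝ) (o : Fin d) : ContDiff ℝ ∞ (phaseDeriv β τ o) := by
  unfold phaseDeriv; fun_prop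

lemma hasFDerivAt_exp_coord (β : ℝ) (o : Fin d) (x : Space d) :
    HasFDerivAt (fun y : Space d => Real.exp (β * y o))
      (Real.exp (β * x o) • (β • (EuclideanSpace.proj o : Space d →L[ℝ] ℝ))) x :=
  ((EuclideanSpace.proj (𝕜 := ℝ) o : Space d →L[ℝ] ℝ).hasFDerivAt.const_mul β).exp

lemma partialDeriv_phaseDeriv (β τ : ℝ) (o i : Fin d) (x : Space d) :
    partialDeriv i (phaseDeriv β τ o) x =
      β * phaseDeriv β τ o x * (if i = o then 1 else 0) := by
  have h := (hasFDerivAt_exp_coord β o x).const_mul (τ * β)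
  unfold partialDeriv
  rw [show fderiv ℝ (phaseDeriv β τ o) x = _ from h.fderiv]
  by_cases hio : i = o
  · subst hio; simp [phaseDeriv]; ring
  · simp [phaseDeriv, hio, Ne.symm hio]

lemma partialDeriv_carlemanWeight (β τ : ℝ) (o i : Fin d) (x : Space d) :
    partialDeriv i (carlemanWeight β τ o) x =
      phaseDeriv β τ o x * (if i = o then 1 else 0) * carlemanWeight β τ o x := by
  have h := ((hasFDerivAt_exp_coord β o x).const_mul τ).exp
  unfold partialDeriv
  rw [show fderiv ℝ (carlemanWeight β τ o) x = _ from h.fderiv]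
  by_cases hio : i = o
  · subst hio; simp [phaseDeriv, carlemanWeight]; ring
  · simp [hio, Ne.symm hio]

/-- The jet of `v` at `x`. -/
noncomputable def jetAt (hA : ∀ x, (A x).IsSymm) (hv : ContDiff ℝ 2 v) (o : Fin d)
    (x : Space d) : Jet d where
  o := o
  a := A x
  da i j l := partialDeriv i (fun y => A y j l) x
  v := v x
  g i := partialDeriv i v x
  H i j := partialDeriv i (partialDeriv j v) x
  a_symm i j := (hA x).apply j i
  H_symm i j := partialDeriv_comm hv i j x

lemma contDiff_flux (hA1 : ∀ i j, ContDiff ℝ 1 fun x => A x i j) (hv : ContDiff ℝ 2 v)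
    (i : Fin d) : ContDiff ℝ 1 (flux A v i) :=
  ContDiff.sum fun j _ => (hA1 i j).mul (contDiff_partialDeriv j hv (by norm_num))

lemma partialDeriv_flux (hA : ∀ x, (A x).IsSymm) (hA1 : ∀ i j, ContDiff ℝ 1 fun x => A x i j)
    (hv : ContDiff ℝ 2 v) (o i j : Fin d) (x : Space d) :
    partialDeriv i (flux A v j) x = (jetAt hA hv o x).dq i j := by
  have h1 : ∀ l, DifferentiableAt ℝ (partialDeriv l v) x := fun l =>
    (contDiff_partialDeriv (m := 1) l hv (by norm_num)).differentiable (by simp) x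
  have h2 : ∀ l, DifferentiableAt ℝ (fun y => A y j l) x := fun l =>
    (hA1 j l).differentiable (by simp) x
  unfold flux
  rw [partialDeriv_sum (F := fun l y => A y j l * partialDeriv l v y)
    fun l _ => (h2 l).mul (h1 l)]
  exact Finset.sum_congr rfl fun l _ => partialDeriv_mul (h2 l) (h1 l)

/-- The energy density `A ∇v · ∇v`. -/
noncomputable def energy (A : Space d → Matrix (Fin d) (Fin d) ℝ) (v : Space d → ℝ)
    (x : Space d) : ℝ :=
  ∑ j, flux A v j x * partialDeriv j v x

lemma contDiff_energy (hA1 : ∀ i j, ContDiff ℝ 1 fun x => A x i j) (hv : ContDiff ℝ 2 v) :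
    ContDiff ℝ 1 (energy A v) :=
  ContDiff.sum fun j _ => (contDiff_flux hA1 hv j).mul (contDiff_partialDeriv j hv (by norm_num))

lemma partialDeriv_energy (hA : ∀ x, (A x).IsSymm) (hA1 : ∀ i j, ContDiff ℝ 1 fun x => A x i j)
    (hv : ContDiff ℝ 2 v) (o i : Fin d) (x : Space d) :
    partialDeriv i (energy A v) x = (jetAt hA hv o x).dQ i := by
  have h1 : ∀ l, DifferentiableAt ℝ (partialDeriv l v) x := fun l =>
    (contDiff_partialDeriv (m := 1) l hv (by norm_num)).differentiable (by simp) x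
  have h2 : ∀ l, DifferentiableAt ℝ (flux A v l) x := fun l =>
    (contDiff_flux hA1 hv l).differentiable (by simp) x
  unfold energy
  rw [partialDeriv_sum (F := fun l y => flux A v l y * partialDeriv l v y)
    fun l _ => (h2 l).mul (h1 l)]
  refine Finset.sum_congr rfl fun l _ => ?_
  rw [partialDeriv_mul (h2 l) (h1 l), partialDeriv_flux hA hA1 hv o]
  rfl

/-- The field whose divergence appears in `Jet.multiplier_identity`. -/
noncomputable def carlemanField (A : Space d → Matrix (Fin d) (Fin d) ℝ) (v : Space d → ℝ)
    (β τ : ℝ) (o i : Fin d) (x : Space d) : ℝ :=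
  -2 * (phaseDeriv β τ o x * (flux A v o x * flux A v i x)) +
  phaseDeriv β τ o x * (A x i o * energy A v x) +
  -2 * β * (phaseDeriv β τ o x * (A x o o * (v x * flux A v i x))) -
  phaseDeriv β τ o x ^ 3 * (A x o o * (A x i o * v x ^ 2))

lemma contDiff_carlemanField (hA1 : ∀ i j, ContDiff ℝ 1 fun x => A x i j) (hv : ContDiff ℝ 2 v)
    (i : Fin d) : ContDiff ℝ 1 (carlemanField A v β τ o i) := by
  have hh : ContDiff ℝ 1 (phaseDeriv β τ o) := (contDiff_phaseDeriv β τ o).of_le (by simp)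
  have hv1 : ContDiff ℝ 1 v := hv.of_le (by norm_num)
  have hq := contDiff_flux hA1 hv
  have hQ := contDiff_energy hA1 hv
  exact (((contDiff_const.mul (hh.mul ((hq o).mul (hq i)))).add
    (hh.mul ((hA1 i o).mul hQ))).add
    (contDiff_const.mul (hh.mul ((hA1 o o).mul (hv1.mul (hq i)))))).sub
    ((hh.pow 3).mul ((hA1 o o).mul ((hA1 i o).mul (hv1.pow 2))))

lemma partialDeriv_carlemanField (hA : ∀ x, (A x).IsSymm)
    (hA1 : ∀ i j, ContDiff ℝ 1 fun x => A x i j) (hv : ContDiff ℝ 2 v) (i : Fin d) (x : Space d) :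
    partialDeriv i (carlemanField A v β τ o i) x =
      (jetAt hA hv o x).dF β (phaseDeriv β τ o x) i := by
  have dh : DifferentiableAt ℝ (phaseDeriv β τ o) x :=
    (contDiff_phaseDeriv β τ o).differentiable (by simp) x
  have dv : DifferentiableAt ℝ v x := hv.differentiable (by simp) x
  have dq : ∀ j, DifferentiableAt ℝ (flux A v j) x := fun j =>
    (contDiff_flux hA1 hv j).differentiable (by simp) x
  have dQ : DifferentiableAt ℝ (energy A v) x := (contDiff_energy hA1 hv).differentiable (by simp) x
  have da : ∀ j l, DifferentiableAt ℝ (fun y => A y j l) x := fun j l =>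
    (hA1 j l).differentiable (by simp) x
  have dqq : DifferentiableAt ℝ (fun y => flux A v o y * flux A v i y) x := (dq o).mul (dq i)
  have dhqq : DifferentiableAt ℝ
      (fun y => phaseDeriv β τ o y * (flux A v o y * flux A v i y)) x := dh.mul dqq
  have daQ : DifferentiableAt ℝ (fun y => A y i o * energy A v y) x := (da i o).mul dQ
  have dhaQ : DifferentiableAt ℝ (fun y => phaseDeriv β τ o y * (A y i o * energy A v y)) x :=
    dh.mul daQ
  have dvq : DifferentiableAt ℝ (fun y => v y * flux A v i y) x := dv.mul (dq i)
  have davq : DifferentiableAt ℝ (fun y => A y o o * (v y * flux A v i y)) x := (da o o).mul dvq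
  have dhavq : DifferentiableAt ℝ
      (fun y => phaseDeriv β τ o y * (A y o o * (v y * flux A v i y))) x := dh.mul davq
  have dv2 : DifferentiableAt ℝ (fun y => v y ^ 2) x := dv.pow 2
  have dav2 : DifferentiableAt ℝ (fun y => A y i o * v y ^ 2) x := (da i o).mul dv2
  have daav2 : DifferentiableAt ℝ (fun y => A y o o * (A y i o * v y ^ 2)) x := (da o o).mul dav2
  have dh3 : DifferentiableAt ℝ (fun y => phaseDeriv β τ o y ^ 3) x := dh.pow 3
  have dhaav2 : DifferentiableAt ℝ
      (fun y => phaseDeriv β τ o y ^ 3 * (A y o o * (A y i o * v y ^ 2))) x := dh3.mul daav2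
  have e : partialDeriv i (carlemanField A v β τ o i) x = _ := partialDeriv_sub (i := i)
    (((dhqq.const_mul (-2)).add dhaQ).add (dhavq.const_mul (-2 * β))) dhaav2
  have e' := partialDeriv_add (i := i) ((dhqq.const_mul (-2)).add dhaQ) (dhavq.const_mul (-2 * β))
  have e'' := partialDeriv_add (i := i) (dhqq.const_mul (-2)) dhaQ
  simp only [Pi.add_apply] at e e' e''
  have e3 := e.trans (congrArg₂ (· - ·) (e'.trans (congrArg₂ (· + ·) e'' rfl)) rfl)
  rw [e3, partialDeriv_const_mul _ dhqq, partialDeriv_const_mul _ dhavq, partialDeriv_mul dh dqq,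
    partialDeriv_mul (dq o) (dq i), partialDeriv_mul dh daQ, partialDeriv_mul (da i o) dQ,
    partialDeriv_mul dh davq, partialDeriv_mul (da o o) dvq, partialDeriv_mul dv (dq i),
    partialDeriv_mul dh3 daav2, partialDeriv_mul (da o o) dav2, partialDeriv_mul (da i o) dv2,
    partialDeriv_pow 3 dh, partialDeriv_pow 2 dv, partialDeriv_phaseDeriv,
    partialDeriv_flux hA hA1 hv o, partialDeriv_flux hA hA1 hv o, partialDeriv_energy hA hA1 hv o]
  set J := jetAt hA hv o x with hJ
  have e1 : A x i o = J.a i J.o := rfl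
  have e2 : A x o o = J.a J.o J.o := rfl
  have e3 : partialDeriv i (fun y => A y i o) x = J.da i i J.o := rfl
  have e4 : partialDeriv i (fun y => A y o o) x = J.da i J.o J.o := rfl
  have e5 : v x = J.v := rfl
  have e6 : partialDeriv i v x = J.g i := rfl
  have e7 : (if i = o then (1 : ℝ) else 0) = J.δ i := rfl
  have e8 : flux A v i x = J.q i := rfl
  have e9 : flux A v o x = J.q J.o := rfl
  have e10 : energy A v x = J.Q := rfl
  have e11 : J.dq i o = J.dq i J.o := rfl
  rw [e1, e2, e3, e4, e5, e6, e7, e8, e9, e10, e11, Jet.dF]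
  push_cast
  ring

lemma partialDeriv_carlemanWeight_mul (hw : ContDiff ℝ 1 w) (β τ : ℝ) (o i : Fin d)
    (x : Space d) :
    partialDeriv i (fun y => carlemanWeight β τ o y * w y) x = carlemanWeight β τ o x *
      (partialDeriv i w x + phaseDeriv β τ o x * (if i = o then 1 else 0) * w x) := by
  rw [partialDeriv_mul ((contDiff_carlemanWeight β τ o).differentiable (by simp) x)
    (hw.differentiable (by simp) x), partialDeriv_carlemanWeight]
  ring

lemma flux_carlemanWeight_mul (hw : ContDiff ℝ 1 w) (β τ : ℝ) (o i : Fin d) (x : Space d) :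
    flux A (fun y => carlemanWeight β τ o y * w y) i x = carlemanWeight β τ o x *
      (flux A w i x + phaseDeriv β τ o x * (A x i o * w x)) := by
  simp_rw [flux, partialDeriv_carlemanWeight_mul hw]
  rw [mul_add, Finset.mul_sum]
  have : ∀ j, A x i j * (carlemanWeight β τ o x * (partialDeriv j w x +
      phaseDeriv β τ o x * (if j = o then 1 else 0) * w x)) =
      carlemanWeight β τ o x * (A x i j * partialDeriv j w x) +
      (if j = o then carlemanWeight β τ o x * (phaseDeriv β τ o x * (A x i j * w x)) else 0) := by
    intro j; split_ifs <;> ring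
  simp_rw [this, Finset.sum_add_distrib]
  simp

/-- Conjugation by the weight turns `Div (A ∇w)` into `Jet.conj`. -/
lemma carlemanWeight_mul_divForm (hA : ∀ x, (A x).IsSymm)
    (hA1 : ∀ i j, ContDiff ℝ 1 fun x => A x i j) (hw : ContDiff ℝ 2 w)
    (hv : ContDiff ℝ 2 fun y => carlemanWeight β τ o y * w y) (x : Space d) :
    carlemanWeight β τ o x * divForm A w x =
      (jetAt hA hv o x).conj β (phaseDeriv β τ o x) := by
  have hw1 : ContDiff ℝ 1 w := hw.of_le (by norm_num)
  have dE := (contDiff_carlemanWeight β τ o).differentiable (by simp) x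
  have dh := (contDiff_phaseDeriv β τ o).differentiable (by simp) x
  have dw := hw1.differentiable (by simp) x
  have dq : ∀ j, DifferentiableAt ℝ (flux A w j) x := fun j =>
    (contDiff_flux hA1 hw j).differentiable (by simp) x
  have da : ∀ j l, DifferentiableAt ℝ (fun y => A y j l) x := fun j l =>
    (hA1 j l).differentiable (by simp) x
  have daw : ∀ i, DifferentiableAt ℝ (fun y => A y i o * w y) x := fun i => (da i o).mul dw
  have dhaw : ∀ i, DifferentiableAt ℝ (fun y => phaseDeriv β τ o y * (A y i o * w y)) x :=
    fun i => dh.mul (daw i)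
  have dsum : ∀ i, DifferentiableAt ℝ
      (fun y => flux A w i y + phaseDeriv β τ o y * (A y i o * w y)) x :=
    fun i => (dq i).add (dhaw i)
  set E := carlemanWeight β τ o with hE
  set h := phaseDeriv β τ o with hh
  have hq : ∀ i, (jetAt hA hv o x).dq i i =
      E x * partialDeriv i (flux A w i) x + E x * h x * (A x i o * partialDeriv i w x) +
      E x * h x * w x * partialDeriv i (fun y => A y i o) x +
      (if i = o then E x * h x * (flux A w i x + h x * (A x i o * w x)) +
        E x * (β * h x) * (A x i o * w x) else 0) := by
    intro i
    rw [← partialDeriv_flux hA hA1 hv]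
    rw [show flux A (fun y => E y * w y) i = fun y => E y *
      (flux A w i y + h y * (A y i o * w y)) from funext fun y =>
      flux_carlemanWeight_mul hw1 β τ o i y]
    rw [partialDeriv_mul dE (dsum i), partialDeriv_add (dq i) (dhaw i), partialDeriv_mul dh (daw i),
      partialDeriv_mul (da i o) dw, partialDeriv_carlemanWeight, partialDeriv_phaseDeriv]
    split_ifs <;> ring
  have hp : (jetAt hA hv o x).q o = E x * (flux A w o x + h x * (A x o o * w x)) :=
    flux_carlemanWeight_mul hw1 β τ o o x
  have hfl : ∑ i, A x i o * partialDeriv i w x = flux A w o x :=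
    Finset.sum_congr rfl fun i _ => by rw [(hA x).apply o i]
  rw [Jet.conj, Jet.D]
  change _ = _ - 2 * h x * (jetAt hA hv o x).q o + h x ^ 2 * A x o o * (E x * w x) -
    (β * h x * A x o o + h x * ∑ i, partialDeriv i (fun y => A y i o) x) * (E x * w x)
  simp_rw [hq, Finset.sum_add_distrib, ← Finset.mul_sum, hp, hfl]
  rw [Finset.sum_ite_eq' Finset.univ o]
  simp only [Finset.mem_univ, if_true]
  rw [divForm]
  ring

lemma integral_partialDeriv_eq_zero {f : Space d → ℝ} (hf : ContDiff ℝ 1 f)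
    (hc : HasCompactSupport f) (i : Fin d) : ∫ x, partialDeriv i f x = 0 := by
  have hi : Integrable (partialDeriv i f) :=
    (continuous_partialDeriv i hf).integrable_of_hasCompactSupport
      (hasCompactSupport_partialDeriv i hc)
  have := integral_mul_fderiv_eq_neg_fderiv_mul_of_integrable (μ := volume)
    (f := fun _ : Space d => (1 : ℝ)) (g := f) (v := EuclideanSpace.single i 1)
    (by simp) (by simp only [one_mul]; exact hi)
    (by simpa using hf.continuous.integrable_of_hasCompactSupport hc)
    (fun x _ => by fun_prop) (fun x _ => hf.differentiable (by simp) x)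
  simpa [partialDeriv] using this

lemma continuous_divForm (hA1 : ∀ i j, ContDiff ℝ 1 fun x => A x i j) (hw : ContDiff ℝ 2 w) :
    Continuous (divForm A w) :=
  continuous_finsetSum _ fun i _ => continuous_partialDeriv i (contDiff_flux hA1 hw i)

lemma partialDeriv_eq_zero_of_notMem {i : Fin d} {x : Space d} (hx : x ∉ tsupport w) :
    partialDeriv i w x = 0 :=
  image_eq_zero_of_notMem_tsupport fun h => hx (tsupport_partialDeriv_subset i w h)

lemma flux_eq_zero_of_notMem {i : Fin d} {x : Space d} (hx : x ∉ tsupport w) :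
    flux A w i x = 0 :=
  Finset.sum_eq_zero fun j _ => by rw [partialDeriv_eq_zero_of_notMem hx, mul_zero]

lemma divForm_eq_zero_of_notMem {x : Space d} (hx : x ∉ tsupport w) : divForm A w x = 0 := by
  refine Finset.sum_eq_zero fun i _ => partialDeriv_eq_zero_of_notMem fun h => hx ?_
  refine closure_minimal (fun y hy => ?_) (isClosed_tsupport w) h
  by_contra hcon
  exact hy (flux_eq_zero_of_notMem hcon)

lemma tsupport_carlemanField_subset (i : Fin d) :
    tsupport (carlemanField A v β τ o i) ⊆ tsupport v := by
  refine closure_minimal (fun y hy => ?_) (isClosed_tsupport v)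
  by_contra hcon
  apply hy
  have h1 : energy A v y = 0 :=
    Finset.sum_eq_zero fun j _ => by rw [flux_eq_zero_of_notMem hcon, zero_mul]
  have h2 : v y = 0 := image_eq_zero_of_notMem_tsupport hcon
  rw [carlemanField, flux_eq_zero_of_notMem hcon, flux_eq_zero_of_notMem hcon, h1, h2]
  ring

/-- The Carleman estimate for smooth compactly supported functions: the weight may be chosen
depending only on the dimension, the ellipticity constant, and a `C¹` bound for the coefficients
on the support. -/
theorem exists_carleman_smooth (d : ℕ) (o : Fin d) (L : ℝ) (hL : 0 ≤ L) {μ : ℝ} (hμ : 0 < μ) :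
    ∃ β : ℝ, 0 < β ∧ ∃ h₀ : ℝ, 1 ≤ h₀ ∧ ∀ A : Space d → Matrix (Fin d) (Fin d) ℝ,
      (∀ x, (A x).IsSymm) → (∀ i j, ContDiff ℝ 1 fun x => A x i j) →
      (∀ x (ξ : Space d), μ * ‖ξ‖ ^ 2 ≤ ∑ i, ∑ j, A x i j * ξ j * ξ i) →
      ∀ (τ : ℝ) (w : Space d → ℝ), ContDiff ℝ ∞ w → HasCompactSupport w →
      (∀ x ∈ tsupport w, h₀ ≤ phaseDeriv β τ o x ∧ ∀ i j, |A x i j| ≤ L ∧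
        ∀ k, |partialDeriv k (fun y => A y i j) x| ≤ L) →
      ∫ x, phaseDeriv β τ o x * carlemanWeight β τ o x ^ 2 *
          (w x ^ 2 + ∑ i, partialDeriv i w x ^ 2) ≤
        ∫ x, carlemanWeight β τ o x ^ 2 * divForm A w x ^ 2 := by
  obtain ⟨β, hβ, h₀, hh₀, key⟩ := Jet.exists_carleman_parameters d L hL hμ
  refine ⟨β, hβ, h₀, hh₀, fun A hA hA1 hell τ w hw hc hb => ?_⟩
  set E := carlemanWeight β τ o with hE
  set h := phaseDeriv β τ o with hh
  have hE1 : ContDiff ℝ ∞ E := contDiff_carlemanWeight β τ o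
  have hh1 : ContDiff ℝ ∞ h := contDiff_phaseDeriv β τ o
  have hw2 : ContDiff ℝ 2 w := hw.of_le (WithTop.coe_le_coe.2 le_top)
  have hw1 : ContDiff ℝ 1 w := hw.of_le (by simp)
  set v : Space d → ℝ := fun y => E y * w y with hv
  have hv2 : ContDiff ℝ 2 v := (hE1.mul hw).of_le (WithTop.coe_le_coe.2 le_top)
  have hvs : tsupport v ⊆ tsupport w := tsupport_mul_subset_right
  set F := carlemanField A v β τ o with hF
  have hFc : ∀ i, HasCompactSupport (F i) := fun i =>
    hc.of_isClosed_subset (isClosed_tsupport _) ((tsupport_carlemanField_subset i).trans hvs)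
  have hF1 : ∀ i, ContDiff ℝ 1 (F i) := contDiff_carlemanField hA1 hv2
  have hFint : ∀ i, Integrable (partialDeriv i (F i)) := fun i =>
    (continuous_partialDeriv i (hF1 i)).integrable_of_hasCompactSupport
      (hasCompactSupport_partialDeriv i (hFc i))
  have hpt : ∀ x, (∑ i, partialDeriv i (F i) x) + h x * E x ^ 2 *
      (w x ^ 2 + ∑ i, partialDeriv i w x ^ 2) ≤ E x ^ 2 * divForm A w x ^ 2 := by
    intro x
    by_cases hx : x ∈ tsupport w
    · obtain ⟨hx1, hx2⟩ := hb x hx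
      have hξ := hell x (WithLp.toLp 2 fun i => partialDeriv i v x)
      rw [EuclideanSpace.real_norm_sq_eq] at hξ
      -- ellipticity in the direction of the `o`-th coordinate vector
      have hα := hell x (EuclideanSpace.single o 1)
      have hQ : μ * (jetAt hA hv2 o x).G ≤ (jetAt hA hv2 o x).Q := by
        refine hξ.trans_eq (Finset.sum_congr rfl fun i _ => ?_)
        rw [Jet.q, Finset.sum_mul]
        rfl
      have hα' : μ ≤ A x o o := by simpa [PiLp.single_apply, Pi.single_apply] using hα
      have hk := key (jetAt hA hv2 o x) (fun i j => (hx2 i j).1) (fun i j l => (hx2 j l).2 i)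
        hQ hα' (h x) hx1
      rw [← carlemanWeight_mul_divForm hA hA1 hw2 hv2, mul_pow] at hk
      have hdF : ∑ i, partialDeriv i (F i) x = ∑ i, (jetAt hA hv2 o x).dF β (h x) i :=
        Finset.sum_congr rfl fun i _ => partialDeriv_carlemanField hA hA1 hv2 i x
      rw [hdF]
      have hg : ∑ i, (E x * partialDeriv i w x) ^ 2 ≤
          2 * (jetAt hA hv2 o x).G + 2 * (h x ^ 2 * v x ^ 2) := by
        -- `E ∂ᵢw = ∂ᵢv - h δᵢ v`
        have e : ∀ i, (E x * partialDeriv i w x) ^ 2 ≤ 2 * partialDeriv i v x ^ 2 +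
            (if i = o then 2 * (h x ^ 2 * v x ^ 2) else 0) := by
          intro i
          rw [partialDeriv_carlemanWeight_mul hw1]
          have hv' : v x = E x * w x := rfl
          rw [hv']
          split_ifs
          · nlinarith [sq_nonneg (E x * partialDeriv i w x + 2 * (h x * (E x * w x)))]
          · nlinarith [sq_nonneg (E x * partialDeriv i w x)]
        refine (Finset.sum_le_sum fun i _ => e i).trans_eq ?_
        rw [Finset.sum_add_distrib, ← Finset.mul_sum, Finset.sum_ite_eq' Finset.univ o]
        simp [Jet.G, jetAt]
      have hh1 : 1 ≤ h x := hh₀.trans hx1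
      have e1 : h x * E x ^ 2 * (w x ^ 2 + ∑ i, partialDeriv i w x ^ 2) =
          h x * v x ^ 2 + h x * ∑ i, (E x * partialDeriv i w x) ^ 2 := by
        simp_rw [mul_pow, ← Finset.mul_sum, hv, mul_pow]; ring
      have e2 : h x * v x ^ 2 ≤ h x ^ 3 * v x ^ 2 :=
        mul_le_mul_of_nonneg_right (by nlinarith) (sq_nonneg _)
      have e3 := mul_le_mul_of_nonneg_left hg (zero_le_one.trans hh1)
      have e4 : 0 ≤ h x * (jetAt hA hv2 o x).G :=
        mul_nonneg (zero_le_one.trans hh1) (Finset.sum_nonneg fun i _ => sq_nonneg _)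
      have e5 : (jetAt hA hv2 o x).v = v x := rfl
      rw [e5] at hk
      rw [e1]
      refine le_trans ?_ hk
      linarith
    · have h1 : ∀ i, partialDeriv i w x = 0 := fun i => partialDeriv_eq_zero_of_notMem hx
      have h2 : ∀ i, partialDeriv i (F i) x = 0 := fun i =>
        partialDeriv_eq_zero_of_notMem fun hx' =>
          hx (hvs (tsupport_carlemanField_subset i hx'))
      have h3 : w x = 0 := image_eq_zero_of_notMem_tsupport hx
      have : 0 ≤ E x ^ 2 * divForm A w x ^ 2 := by positivity
      simpa [h1, h2, h3] using this
  have hi1 : Integrable fun x => h x * E x ^ 2 * (w x ^ 2 + ∑ i, partialDeriv i w x ^ 2) := by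
    refine Continuous.integrable_of_hasCompactSupport ?_ ?_
    · exact (hh1.continuous.mul (hE1.continuous.pow 2)).mul ((hw.continuous.pow 2).add
        (continuous_finsetSum _ fun i _ => (continuous_partialDeriv i hw1).pow 2))
    · refine HasCompactSupport.intro hc fun x hx => ?_
      have h1 : ∀ i, partialDeriv i w x = 0 := fun i => partialDeriv_eq_zero_of_notMem hx
      simp [h1, image_eq_zero_of_notMem_tsupport hx]
  have hi2 : Integrable fun x => E x ^ 2 * divForm A w x ^ 2 := by
    refine Continuous.integrable_of_hasCompactSupport ?_ ?_
    · exact (hE1.continuous.pow 2).mul ((continuous_divForm hA1 hw2).pow 2)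
    · refine HasCompactSupport.intro hc fun x hx => ?_
      simp [divForm_eq_zero_of_notMem hx]
  have hsum : ∫ x, ∑ i, partialDeriv i (F i) x = 0 := by
    rw [integral_finsetSum _ fun i _ => hFint i]
    exact Finset.sum_eq_zero fun i _ => integral_partialDeriv_eq_zero (hF1 i) (hFc i) i
  have := integral_mono ((integrable_finsetSum _ fun i _ => hFint i).add hi1) hi2 hpt
  simp only [Pi.add_apply] at this
  rw [integral_add (integrable_finsetSum _ fun i _ => hFint i) hi1, hsum, zero_add] at this
  exact this

end calculus

/-! ### The Carleman estimate in `H²` -/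

section carlemanH2
variable {d : ℕ} {A : Space d → Matrix (Fin d) (Fin d) ℝ}

/-- `Div (A ∇u)`, expanded by the product rule, for a function with gradient `u₁` and second
derivatives `u₂ i j = ∂ᵢ ∂ⱼ u`. -/
noncomputable def expandedDiv (A : Space d → Matrix (Fin d) (Fin d) ℝ) (u₁ : Fin d → Space d → ℝ)
    (u₂ : Fin d → Fin d → Space d → ℝ) (x : Space d) : ℝ :=
  ∑ i, ∑ l, (A x i l * u₂ i l x + partialDeriv i (fun y => A y i l) x * u₁ l x)

lemma integrable_continuous_mul {K : Set (Space d)} (hK : IsCompact K) {c f : Space d → ℝ}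
    (hc : Continuous c) (hf : Integrable f) (hs : ∀ x, x ∉ K → f x = 0) :
    Integrable fun x => c x * f x := by
  obtain ⟨M, hM⟩ := hK.exists_bound_of_continuousOn hc.continuousOn
  refine (hf.norm.const_mul M).mono' (hc.aestronglyMeasurable.mul hf.1)
    (Eventually.of_forall fun x => ?_)
  by_cases hx : x ∈ K
  · rw [norm_mul]
    exact mul_le_mul_of_nonneg_right (hM x hx) (norm_nonneg _)
  · simp [hs x hx]

lemma memLp_continuous_mul {K : Set (Space d)} (hK : IsCompact K) {c f : Space d → ℝ}
    (hc : Continuous c) (hf : MemLp f 2) (hs : ∀ x, x ∉ K → f x = 0) :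
    MemLp (fun x => c x * f x) 2 := by
  obtain ⟨M, hM⟩ := hK.exists_bound_of_continuousOn hc.continuousOn
  refine hf.of_le_mul (c := M) (hc.aestronglyMeasurable.mul hf.1)
    (Eventually.of_forall fun x => ?_)
  by_cases hx : x ∈ K
  · rw [norm_mul]
    exact mul_le_mul_of_nonneg_right (hM x hx) (norm_nonneg _)
  · simp [hs x hx]

lemma memLp_expandedDiv {K : Set (Space d)} (hK : IsCompact K)
    (hA1 : ∀ i j, ContDiff ℝ 1 fun x => A x i j) {u₁ : Fin d → Space d → ℝ}
    {u₂ : Fin d → Fin d → Space d → ℝ} (h1 : ∀ i, MemLp (u₁ i) 2) (h2 : ∀ i j, MemLp (u₂ i j) 2)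
    (s1 : ∀ x, x ∉ K → ∀ i, u₁ i x = 0) (s2 : ∀ x, x ∉ K → ∀ i j, u₂ i j x = 0) :
    MemLp (expandedDiv A u₁ u₂) 2 :=
  memLp_finsetSum _ fun i _ => memLp_finsetSum _ fun l _ =>
    (memLp_continuous_mul hK (hA1 i l).continuous (h2 i l) fun x hx => s2 x hx i l).add
    (memLp_continuous_mul hK (continuous_partialDeriv i (hA1 i l)) (h1 l) fun x hx => s1 x hx l)

lemma expandedDiv_sub (u₁ u₁' : Fin d → Space d → ℝ) (u₂ u₂' : Fin d → Fin d → Space d → ℝ)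
    (x : Space d) : expandedDiv A u₁ u₂ x - expandedDiv A u₁' u₂' x =
      expandedDiv A (fun i y => u₁ i y - u₁' i y) (fun i j y => u₂ i j y - u₂' i j y) x := by
  simp only [expandedDiv, ← Finset.sum_sub_distrib]
  exact Finset.sum_congr rfl fun i _ => Finset.sum_congr rfl fun l _ => by ring

lemma sq_expandedDiv_le {L : ℝ} {u₁ : Fin d → Space d → ℝ} {u₂ : Fin d → Fin d → Space d → ℝ}
    {x : Space d} (hb : ∀ i j, |A x i j| ≤ L ∧ ∀ k, |partialDeriv k (fun y => A y i j) x| ≤ L) :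
    expandedDiv A u₁ u₂ x ^ 2 ≤
      2 * L ^ 2 * d ^ 2 * ((∑ i, ∑ j, u₂ i j x ^ 2) + d * ∑ j, u₁ j x ^ 2) := by
  have h1 : ∀ i l, (A x i l * u₂ i l x + partialDeriv i (fun y => A y i l) x * u₁ l x) ^ 2 ≤
      2 * L ^ 2 * (u₂ i l x ^ 2 + u₁ l x ^ 2) := by
    intro i l
    have ha : A x i l ^ 2 ≤ L ^ 2 := sq_le_sq' (abs_le.1 (hb i l).1).1 (abs_le.1 (hb i l).1).2
    have hd : partialDeriv i (fun y => A y i l) x ^ 2 ≤ L ^ 2 :=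
      sq_le_sq' (abs_le.1 ((hb i l).2 i)).1 (abs_le.1 ((hb i l).2 i)).2
    have h3 := mul_le_mul_of_nonneg_right ha (sq_nonneg (u₂ i l x))
    have h4 := mul_le_mul_of_nonneg_right hd (sq_nonneg (u₁ l x))
    nlinarith [sq_nonneg (A x i l * u₂ i l x - partialDeriv i (fun y => A y i l) x * u₁ l x)]
  have hcs : ∀ f : Fin d → ℝ, (∑ i, f i) ^ 2 ≤ d * ∑ i, f i ^ 2 := fun f => by
    simpa using sq_sum_le_card_mul_sum_sq (s := Finset.univ) (f := f)
  calc expandedDiv A u₁ u₂ x ^ 2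
      ≤ d * ∑ i, (∑ l, (A x i l * u₂ i l x + partialDeriv i (fun y => A y i l) x * u₁ l x)) ^ 2 :=
        hcs _
    _ ≤ (d : ℝ) * ∑ i : Fin d, ((d : ℝ) * ∑ l, 2 * L ^ 2 * (u₂ i l x ^ 2 + u₁ l x ^ 2)) := by
        refine mul_le_mul_of_nonneg_left (Finset.sum_le_sum fun i _ => (hcs _).trans ?_)
          (Nat.cast_nonneg _)
        exact mul_le_mul_of_nonneg_left (Finset.sum_le_sum fun l _ => h1 i l) (Nat.cast_nonneg _)
    _ = _ := by
        simp_rw [← Finset.mul_sum, Finset.sum_add_distrib]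
        simp only [Finset.sum_const, Finset.card_univ, Fintype.card_fin, nsmul_eq_mul]
        ring

lemma divForm_eq_expandedDiv (hA1 : ∀ i j, ContDiff ℝ 1 fun x => A x i j) {w : Space d → ℝ}
    (hw : ContDiff ℝ 2 w) (x : Space d) :
    divForm A w x = expandedDiv A (fun i => partialDeriv i w)
      (fun i j => partialDeriv i (partialDeriv j w)) x := by
  refine Finset.sum_congr rfl fun i _ => ?_
  have h1 : ∀ l, DifferentiableAt ℝ (partialDeriv l w) x := fun l =>
    (contDiff_partialDeriv (m := 1) l hw (by norm_num)).differentiable (by simp) x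
  have h2 : ∀ l, DifferentiableAt ℝ (fun y => A y i l) x := fun l =>
    (hA1 i l).differentiable (by simp) x
  unfold flux
  rw [partialDeriv_sum (F := fun l y => A y i l * partialDeriv l w y)
    fun l _ => (h2 l).mul (h1 l)]
  exact Finset.sum_congr rfl fun l _ => partialDeriv_mul (h2 l) (h1 l)

/-- The Carleman estimate for `H²` functions of compact support on the whole space, obtained
from the smooth case by mollification. -/
theorem exists_carleman (d : ℕ) (o : Fin d) (L : ℝ) (hL : 0 ≤ L) {μ : ℝ} (hμ : 0 < μ) :
    ∃ β : ℝ, 0 < β ∧ ∃ h₀ : ℝ, 1 ≤ h₀ ∧ ∀ A : Space d → Matrix (Fin d) (Fin d) ℝ,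
      (∀ x, (A x).IsSymm) → (∀ i j, ContDiff ℝ 1 fun x => A x i j) →
      (∀ x (ξ : Space d), μ * ‖ξ‖ ^ 2 ≤ ∑ i, ∑ j, A x i j * ξ j * ξ i) →
      ∀ (τ : ℝ) (K U : Set (Space d)), IsCompact K → IsOpen U → K ⊆ U →
      (∀ x ∈ U, h₀ ≤ phaseDeriv β τ o x ∧ ∀ i j, |A x i j| ≤ L ∧
        ∀ k, |partialDeriv k (fun y => A y i j) x| ≤ L) →
      ∀ (u : Space d → ℝ) (u₁ : Fin d → Space d → ℝ) (u₂ : Fin d → Fin d → Space d → ℝ),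
      MemLp u 2 → (∀ i, MemLp (u₁ i) 2) → (∀ i j, MemLp (u₂ i j) 2) →
      (∀ i, HasWeakPartial univ i u (u₁ i)) → (∀ i j, HasWeakPartial univ i (u₁ j) (u₂ i j)) →
      (∀ x, x ∉ K → u x = 0) → (∀ x, x ∉ K → ∀ i, u₁ i x = 0) →
      (∀ x, x ∉ K → ∀ i j, u₂ i j x = 0) →
      ∫ x, phaseDeriv β τ o x * carlemanWeight β τ o x ^ 2 * (u x ^ 2 + ∑ i, u₁ i x ^ 2) ≤
        4 * ∫ x, carlemanWeight β τ o x ^ 2 * expandedDiv A u₁ u₂ x ^ 2 := by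
  obtain ⟨β, hβ, h₀, hh₀, key⟩ := exists_carleman_smooth d o L hL hμ
  refine ⟨β, hβ, h₀, hh₀, ?_⟩
  intro A hA hA1 hell τ K U hK hU hKU hb u u₁ u₂ m0 m1 m2 w1 w2 s0 s1 s2
  set E := carlemanWeight β τ o with hE
  set h := phaseDeriv β τ o with hh
  have hEc : Continuous E := (contDiff_carlemanWeight β τ o).continuous
  have hhc : Continuous h := (contDiff_phaseDeriv β τ o).continuous
  obtain ⟨δ, hδ, hδU⟩ := hK.exists_cthickening_subset_open hU hKU
  set K' := Metric.cthickening δ K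
  have hK' : IsCompact K' := hK.cthickening
  have hKK' : K ⊆ K' := Metric.self_subset_cthickening K
  obtain ⟨M, hM⟩ := hK'.exists_bound_of_continuousOn (f := fun x => h x * E x ^ 2)
    (hhc.mul (hEc.pow 2)).continuousOn
  obtain ⟨M', hM'⟩ := hK'.exists_bound_of_continuousOn (f := fun x => E x ^ 2)
    (hEc.pow 2).continuousOn
  -- the squared error of the `k`-th mollification, with all derivatives up to order two
  set s : ℕ → Space d → ℝ := fun k x => (mollify k u x - u x) ^ 2 +
    ((∑ i, (mollify k (u₁ i) x - u₁ i x) ^ 2) +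
      ∑ i, ∑ j, (mollify k (u₂ i j) x - u₂ i j x) ^ 2) with hs
  have is0 : ∀ k, Integrable fun x => (mollify k u x - u x) ^ 2 := fun k =>
    ((memLp_mollify k m0).sub m0).integrable_sq
  have is1 : ∀ k i, Integrable fun x => (mollify k (u₁ i) x - u₁ i x) ^ 2 := fun k i =>
    ((memLp_mollify k (m1 i)).sub (m1 i)).integrable_sq
  have is2 : ∀ k i j, Integrable fun x => (mollify k (u₂ i j) x - u₂ i j x) ^ 2 := fun k i j =>
    ((memLp_mollify k (m2 i j)).sub (m2 i j)).integrable_sq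
  have is1' : ∀ k, Integrable fun x => ∑ i, (mollify k (u₁ i) x - u₁ i x) ^ 2 := fun k =>
    integrable_finsetSum _ fun i _ => is1 k i
  have is2' : ∀ k, Integrable fun x => ∑ i, ∑ j, (mollify k (u₂ i j) x - u₂ i j x) ^ 2 := fun k =>
    integrable_finsetSum _ fun i _ => integrable_finsetSum _ fun j _ => is2 k i j
  have hsint : ∀ k, Integrable (s k) := fun k => (is0 k).add ((is1' k).add (is2' k))
  have hslim : Tendsto (fun k => ∫ x, s k x) atTop (𝓝 0) := by
    have e : ∀ k, ∫ x, s k x = (∫ x, (mollify k u x - u x) ^ 2) +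
        ((∑ i, ∫ x, (mollify k (u₁ i) x - u₁ i x) ^ 2) +
          ∑ i, ∑ j, ∫ x, (mollify k (u₂ i j) x - u₂ i j x) ^ 2) := by
      intro k
      rw [hs]
      have i3 : Integrable fun x => (∑ i, (mollify k (u₁ i) x - u₁ i x) ^ 2) +
        ∑ i, ∑ j, (mollify k (u₂ i j) x - u₂ i j x) ^ 2 := (is1' k).add (is2' k)
      rw [integral_add (is0 k) i3, integral_add (is1' k) (is2' k),
        integral_finsetSum _ fun i _ => is1 k i,
        integral_finsetSum _ fun i _ => integrable_finsetSum _ fun j _ => is2 k i j]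
      congr 2
      exact Finset.sum_congr rfl fun i _ => integral_finsetSum _ fun j _ => is2 k i j
    simp_rw [e]
    have := (tendsto_integral_sq_mollify_sub m0).add
      ((tendsto_finsetSum Finset.univ fun i _ => tendsto_integral_sq_mollify_sub (m1 i)).add
        (tendsto_finsetSum Finset.univ fun i _ => tendsto_finsetSum Finset.univ fun j _ =>
          tendsto_integral_sq_mollify_sub (m2 i j)))
    simpa using this
  have hsn : ∀ k x, 0 ≤ s k x := fun k x => by simp only [hs]; positivity
  set C := 2 * M' * (2 * L ^ 2 * d ^ 2 * (d + 1)) with hC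
  have iP : ∀ (v : Space d → ℝ) (v₁ : Fin d → Space d → ℝ), MemLp v 2 → (∀ i, MemLp (v₁ i) 2) →
      (∀ x, x ∉ K' → v x = 0) → (∀ x, x ∉ K' → ∀ i, v₁ i x = 0) →
      Integrable fun x => h x * E x ^ 2 * (v x ^ 2 + ∑ i, v₁ i x ^ 2) := fun v v₁ hv hv1 t0 t1 =>
    integrable_continuous_mul hK' (hhc.mul (hEc.pow 2))
      (hv.integrable_sq.add (integrable_finsetSum _ fun i _ => (hv1 i).integrable_sq))
      fun x hx => by simp [t0 x hx, t1 x hx]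
  have iR : ∀ (v₁ : Fin d → Space d → ℝ) (v₂ : Fin d → Fin d → Space d → ℝ),
      (∀ i, MemLp (v₁ i) 2) → (∀ i j, MemLp (v₂ i j) 2) →
      (∀ x, x ∉ K' → ∀ i, v₁ i x = 0) → (∀ x, x ∉ K' → ∀ i j, v₂ i j x = 0) →
      Integrable fun x => E x ^ 2 * expandedDiv A v₁ v₂ x ^ 2 := fun v₁ v₂ hv1 hv2 t1 t2 =>
    integrable_continuous_mul hK' (hEc.pow 2)
      (memLp_expandedDiv hK' hA1 hv1 hv2 t1 t2).integrable_sq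
      fun x hx => by simp [expandedDiv, t1 x hx, t2 x hx]
  -- the inequality for the mollifications, rewritten for `u` at the cost of the error `s k`
  have hmain : ∀ᶠ k in atTop, ∫ x, h x * E x ^ 2 * (u x ^ 2 + ∑ i, u₁ i x ^ 2) ≤
      4 * (∫ x, E x ^ 2 * expandedDiv A u₁ u₂ x ^ 2) + (2 * C + 2 * M) * ∫ x, s k x := by
    filter_upwards [(tendsto_rOut_bumpSeq d).eventually (eventually_le_nhds hδ)] with k hk
    set w := mollify k u with hw
    have hws : ContDiff ℝ ∞ w := contDiff_mollify k (m0.locallyIntegrable (by norm_num))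
    have hws2 : ContDiff ℝ 2 w := hws.of_le (WithTop.coe_le_coe.2 le_top)
    have hd1 : ∀ i, partialDeriv i w = mollify k (u₁ i) := fun i =>
      funext fun x => (w1 i).partialDeriv_mollify k x
    have hd2 : ∀ i j, partialDeriv i (partialDeriv j w) = mollify k (u₂ i j) := fun i j => by
      rw [hd1]; exact funext fun x => (w2 i j).partialDeriv_mollify k x
    have hsup : ∀ {f : Space d → ℝ}, (∀ x, x ∉ K → f x = 0) → tsupport (mollify k f) ⊆ K' :=
      fun hf => tsupport_mollify_subset k (fun x hx => by_contra fun hxK => hx (hf x hxK)) hk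
    have hz : ∀ {f : Space d → ℝ}, (∀ x, x ∉ K → f x = 0) → ∀ x, x ∉ K' → mollify k f x = 0 :=
      fun hf x hx => image_eq_zero_of_notMem_tsupport fun hx' => hx (hsup hf hx')
    have hwc : HasCompactSupport w := hK'.of_isClosed_subset (isClosed_tsupport _) (hsup s0)
    have hcar := key A hA hA1 hell τ w hws hwc fun x hx => hb x (hδU (hsup s0 hx))
    simp_rw [divForm_eq_expandedDiv hA1 hws2, hd2, hd1] at hcar
    have iP0 := iP u u₁ m0 m1 (fun x hx => s0 x fun h => hx (hKK' h))
      (fun x hx => s1 x fun h => hx (hKK' h))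
    have iPk := iP w (fun i => mollify k (u₁ i)) (memLp_mollify k m0)
      (fun i => memLp_mollify k (m1 i)) (hz s0) (fun x hx i => hz (fun y hy => s1 y hy i) x hx)
    have iR0 := iR u₁ u₂ m1 m2 (fun x hx => s1 x fun h => hx (hKK' h))
      (fun x hx => s2 x fun h => hx (hKK' h))
    have iRk := iR (fun i => mollify k (u₁ i)) (fun i j => mollify k (u₂ i j))
      (fun i => memLp_mollify k (m1 i)) (fun i j => memLp_mollify k (m2 i j))
      (fun x hx i => hz (fun y hy => s1 y hy i) x hx)
      (fun x hx i j => hz (fun y hy => s2 y hy i j) x hx)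
    have hsq : ∀ a b : ℝ, a ^ 2 ≤ 2 * b ^ 2 + 2 * (b - a) ^ 2 := fun a b => by
      nlinarith [sq_nonneg (2 * b - a)]
    have hP : ∫ x, h x * E x ^ 2 * (u x ^ 2 + ∑ i, u₁ i x ^ 2) ≤
        2 * (∫ x, h x * E x ^ 2 * (w x ^ 2 + ∑ i, mollify k (u₁ i) x ^ 2)) +
          2 * M * ∫ x, s k x := by
      rw [← integral_const_mul, ← integral_const_mul,
        ← integral_add (iPk.const_mul 2) ((hsint k).const_mul _)]
      refine integral_mono iP0 ((iPk.const_mul 2).add ((hsint k).const_mul _)) fun x => ?_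
      by_cases hx : x ∈ K'
      · have hMx : h x * E x ^ 2 ≤ M := (le_abs_self _).trans (hM x hx)
        have h0 : 0 ≤ h x * E x ^ 2 :=
          mul_nonneg ((zero_le_one.trans hh₀).trans (hb x (hδU hx)).1) (sq_nonneg _)
        have h1 : u x ^ 2 + ∑ i, u₁ i x ^ 2 ≤
            2 * (w x ^ 2 + ∑ i, mollify k (u₁ i) x ^ 2) + 2 * s k x := by
          have e1 := hsq (u x) (w x)
          have e2 : ∑ i, u₁ i x ^ 2 ≤ 2 * (∑ i, mollify k (u₁ i) x ^ 2) +
              2 * ∑ i, (mollify k (u₁ i) x - u₁ i x) ^ 2 := by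
            rw [Finset.mul_sum, Finset.mul_sum, ← Finset.sum_add_distrib]
            exact Finset.sum_le_sum fun i _ => hsq _ _
          have e3 : 0 ≤ ∑ i, ∑ j, (mollify k (u₂ i j) x - u₂ i j x) ^ 2 := by positivity
          simp only [hs]
          linarith
        have h2 := mul_le_mul_of_nonneg_left h1 h0
        have h3 := mul_le_mul_of_nonneg_right hMx (hsn k x)
        change _ ≤ 2 * (h x * E x ^ 2 * (w x ^ 2 + ∑ i, mollify k (u₁ i) x ^ 2)) + 2 * M * s k x
        linarith
      · have hxK : x ∉ K := fun h => hx (hKK' h)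
        have e0 : ∀ f : Space d → ℝ, (∀ x, x ∉ K → f x = 0) → mollify k f x = 0 :=
          fun f hf => hz hf x hx
        have e1 : s k x = 0 := by
          simp only [hs, s0 x hxK, s1 x hxK, s2 x hxK, e0 u s0, e0 _ fun y hy => s1 y hy _,
            e0 _ fun y hy => s2 y hy _ _]
          simp
        have e2 : w x = 0 := e0 u s0
        change _ ≤ 2 * (h x * E x ^ 2 * (w x ^ 2 + ∑ i, mollify k (u₁ i) x ^ 2)) + 2 * M * s k x
        simp only [e1, e2, s0 x hxK, s1 x hxK, e0 _ fun y hy => s1 y hy _]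
        simp
    have hR : ∫ x, E x ^ 2 * expandedDiv A (fun i => mollify k (u₁ i))
          (fun i j => mollify k (u₂ i j)) x ^ 2 ≤
        2 * (∫ x, E x ^ 2 * expandedDiv A u₁ u₂ x ^ 2) + C * ∫ x, s k x := by
      rw [← integral_const_mul, ← integral_const_mul,
        ← integral_add (iR0.const_mul 2) ((hsint k).const_mul _)]
      refine integral_mono iRk ((iR0.const_mul 2).add ((hsint k).const_mul _)) fun x => ?_
      change _ ≤ 2 * (E x ^ 2 * expandedDiv A u₁ u₂ x ^ 2) + C * s k x
      by_cases hx : x ∈ K'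
      · have hMx : E x ^ 2 ≤ M' := (le_abs_self _).trans (hM' x hx)
        have h1 := hsq (expandedDiv A (fun i => mollify k (u₁ i)) (fun i j => mollify k (u₂ i j)) x)
          (expandedDiv A u₁ u₂ x)
        rw [expandedDiv_sub] at h1
        have h2 := sq_expandedDiv_le (u₁ := fun i y => u₁ i y - mollify k (u₁ i) y)
          (u₂ := fun i j y => u₂ i j y - mollify k (u₂ i j) y) (hb x (hδU hx)).2
        have h3 : (∑ i, ∑ j, (u₂ i j x - mollify k (u₂ i j) x) ^ 2) +
            d * ∑ j, (u₁ j x - mollify k (u₁ j) x) ^ 2 ≤ (d + 1) * s k x := by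
          have e1 : ∑ i, ∑ j, (u₂ i j x - mollify k (u₂ i j) x) ^ 2 =
              ∑ i, ∑ j, (mollify k (u₂ i j) x - u₂ i j x) ^ 2 :=
            Finset.sum_congr rfl fun i _ => Finset.sum_congr rfl fun j _ => by ring
          have e2 : ∑ j, (u₁ j x - mollify k (u₁ j) x) ^ 2 =
              ∑ j, (mollify k (u₁ j) x - u₁ j x) ^ 2 :=
            Finset.sum_congr rfl fun j _ => by ring
          have p0 : 0 ≤ (mollify k u x - u x) ^ 2 := sq_nonneg _
          have p1 : 0 ≤ ∑ i, (mollify k (u₁ i) x - u₁ i x) ^ 2 := by positivity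
          have p2 : 0 ≤ ∑ i, ∑ j, (mollify k (u₂ i j) x - u₂ i j x) ^ 2 := by positivity
          rw [e1, e2]
          have le1 : ∑ i, ∑ j, (mollify k (u₂ i j) x - u₂ i j x) ^ 2 ≤ s k x := by
            simp only [hs]; linarith
          have le2 : ∑ i, (mollify k (u₁ i) x - u₁ i x) ^ 2 ≤ s k x := by
            simp only [hs]; linarith
          have := mul_le_mul_of_nonneg_left le2 (Nat.cast_nonneg (α := ℝ) d)
          linarith
        have h4 := h2.trans (mul_le_mul_of_nonneg_left h3 (by positivity))
        have h5 := mul_le_mul_of_nonneg_left h1 (sq_nonneg (E x))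
        have h6 := mul_le_mul hMx h4 (sq_nonneg _) ((sq_nonneg _).trans hMx)
        rw [hC]
        linarith
      · have hxK : x ∉ K := fun h => hx (hKK' h)
        have e0 : ∀ f : Space d → ℝ, (∀ x, x ∉ K → f x = 0) → mollify k f x = 0 :=
          fun f hf => hz hf x hx
        have e1 : s k x = 0 := by
          simp only [hs, s0 x hxK, s1 x hxK, s2 x hxK, e0 u s0, e0 _ fun y hy => s1 y hy _,
            e0 _ fun y hy => s2 y hy _ _]
          simp
        have e2 : expandedDiv A (fun i => mollify k (u₁ i))
            (fun i j => mollify k (u₂ i j)) x = 0 := by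
          simp only [expandedDiv, e0 _ fun y hy => s1 y hy _, e0 _ fun y hy => s2 y hy _ _]
          simp
        rw [e1, e2]
        simp only [ne_eq, OfNat.ofNat_ne_zero, not_false_eq_true, zero_pow, mul_zero, add_zero]
        positivity
    linarith
  have hlim : Tendsto (fun k => 4 * (∫ x, E x ^ 2 * expandedDiv A u₁ u₂ x ^ 2) +
      (2 * C + 2 * M) * ∫ x, s k x) atTop
      (𝓝 (4 * (∫ x, E x ^ 2 * expandedDiv A u₁ u₂ x ^ 2) + (2 * C + 2 * M) * 0)) :=
    (hslim.const_mul _).const_add _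
  rw [mul_zero, add_zero] at hlim
  exact ge_of_tendsto hlim hmain

end carlemanH2

/-! ### Sobolev norms -/

section norms
variable {d N : ℕ} {Ω : Set (Space d)} {u v : Space d → ℝ} {k : ℕ}

lemma normSqH_nonneg (Ω : Set (Space d)) (k : ℕ) (u : Space d → ℝ) : 0 ≤ normSqH Ω k u := by
  induction k generalizing u with
  | zero => exact integral_nonneg fun _ => sq_nonneg _
  | succ k ih =>
    exact add_nonneg (integral_nonneg fun _ => sq_nonneg _) (Finset.sum_nonneg fun i _ => ih _)

lemma normSqH_le_succ (Ω : Set (Space d)) (k : ℕ) (u : Space d → ℝ) :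
    normSqH Ω k u ≤ normSqH Ω (k + 1) u := by
  induction k generalizing u with
  | zero => exact le_add_of_nonneg_right (Finset.sum_nonneg fun i _ => normSqH_nonneg _ _ _)
  | succ k ih => exact add_le_add le_rfl (Finset.sum_le_sum fun i _ => ih _)

lemma normSqH_congr (h : u =ᵐ[volume.restrict Ω] v) : normSqH Ω k u = normSqH Ω k v := by
  have h0 : ∫ x in Ω, u x ^ 2 = ∫ x in Ω, v x ^ 2 :=
    integral_congr_ae (h.mono fun x hx => by simp only [hx])
  cases k with
  | zero => exact h0
  | succ k =>
    simp only [normSqH]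
    rw [h0]
    simp_rw [weakPartial_congr h]

lemma normSqH_linComb_le (hΩ : IsOpen Ω) (a b : ℝ) (hu : MemH Ω k u) (hv : MemH Ω k v) :
    normSqH Ω k (fun x => a * u x + b * v x) ≤
      2 * a ^ 2 * normSqH Ω k u + 2 * b ^ 2 * normSqH Ω k v := by
  have h0 : ∀ {u v : Space d → ℝ}, MemLp u 2 (volume.restrict Ω) →
      MemLp v 2 (volume.restrict Ω) → ∫ x in Ω, (a * u x + b * v x) ^ 2 ≤
        2 * a ^ 2 * (∫ x in Ω, u x ^ 2) + 2 * b ^ 2 * ∫ x in Ω, v x ^ 2 := by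
    intro u v hu hv
    rw [← integral_const_mul, ← integral_const_mul,
      ← integral_add (hu.integrable_sq.const_mul _) (hv.integrable_sq.const_mul _)]
    refine integral_mono ((hu.const_mul a).add (hv.const_mul b)).integrable_sq
      ((hu.integrable_sq.const_mul _).add (hv.integrable_sq.const_mul _)) fun x => ?_
    change (a * u x + b * v x) ^ 2 ≤ 2 * a ^ 2 * u x ^ 2 + 2 * b ^ 2 * v x ^ 2
    nlinarith [sq_nonneg (a * u x - b * v x)]
  induction k generalizing u v with
  | zero => exact h0 hu hv
  | succ k ih =>
    simp only [normSqH]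
    rw [mul_add, mul_add, Finset.mul_sum, Finset.mul_sum]
    have h1 := h0 hu.1 hv.1
    have h2 : ∑ i, normSqH Ω k (weakPartial Ω i fun x => a * u x + b * v x) ≤
        (∑ i, 2 * a ^ 2 * normSqH Ω k (weakPartial Ω i u)) +
          ∑ i, 2 * b ^ 2 * normSqH Ω k (weakPartial Ω i v) := by
      rw [← Finset.sum_add_distrib]
      refine Finset.sum_le_sum fun i _ => ?_
      rw [normSqH_congr (weakPartial_linComb hΩ a b hu hv i)]
      exact ih (hu.weakPartial hΩ i) (hv.weakPartial hΩ i)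
    linarith

lemma normH_sq (Ω : Set (Space d)) (k : ℕ) (U : Fin N → Space d → ℝ) :
    normH Ω k U ^ 2 = ∑ m, normSqH Ω k (U m) :=
  Real.sq_sqrt (Finset.sum_nonneg fun _ _ => normSqH_nonneg _ _ _)

lemma normH_sq_le_succ (Ω : Set (Space d)) (k : ℕ) (U : Fin N → Space d → ℝ) :
    normH Ω k U ^ 2 ≤ normH Ω (k + 1) U ^ 2 := by
  rw [normH_sq, normH_sq]
  exact Finset.sum_le_sum fun m _ => normSqH_le_succ _ _ _

lemma MemHVec.linComb (a b : ℝ) {U V : Fin N → Space d → ℝ} (hU : MemHVec Ω k U)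
    (hV : MemHVec Ω k V) : MemHVec Ω k fun m x => a * U m x + b * V m x := fun m =>
  (hU m).linComb a b (hV m)

lemma normH_linComb_sq_le (hΩ : IsOpen Ω) (a b : ℝ) {U V : Fin N → Space d → ℝ}
    (hU : MemHVec Ω k U) (hV : MemHVec Ω k V) :
    normH Ω k (fun m x => a * U m x + b * V m x) ^ 2 ≤
      2 * a ^ 2 * normH Ω k U ^ 2 + 2 * b ^ 2 * normH Ω k V ^ 2 := by
  rw [normH_sq, normH_sq, normH_sq, Finset.mul_sum, Finset.mul_sum, ← Finset.sum_add_distrib]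
  exact Finset.sum_le_sum fun m _ => normSqH_linComb_le hΩ a b (hU m) (hV m)

end norms

/-! ### The residual -/

section residual
variable {d N : ℕ} {Ω : Set (Space d)} {A : Space d → Matrix (Fin d) (Fin d) ℝ}
  {b : Space d → Space d} {c : Space d → ℝ} {T : ℝ} {U V : Fin N → Space d → ℝ}

/-- The principal part of `ℒ u`, expanded by the product rule. -/
noncomputable def principalPart (Ω : Set (Space d)) (A : Space d → Matrix (Fin d) (Fin d) ℝ)
    (u : Space d → ℝ) : Space d → ℝ :=
  expandedDiv A (fun j => weakPartial Ω j u) fun i j => weakPartial Ω i (weakPartial Ω j u)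

/-- The lower-order part of the `m`-th component of `ℒU - SU`. -/
noncomputable def lowerPart (Ω : Set (Space d)) (b : Space d → Space d) (c : Space d → ℝ) (T : ℝ)
    (U : Fin N → Space d → ℝ) (m : Fin N) (x : Space d) : ℝ :=
  (∑ i, b x i * weakPartial Ω i (U m) x) + c x * U m x - ∑ n, matS T N m n * U n x

/-- The divergence in `ℒ` may be expanded by the product rule, the entries of `A` being `C¹`. -/
lemma residual_ae_eq (hΩ : IsOpen Ω) (hA1 : ∀ i j, ContDiff ℝ 1 fun x => A x i j) {m : Fin N}
    (hU : MemH Ω 2 (U m)) : residual Ω A b c T U m =ᵐ[volume.restrict Ω]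
      fun x => principalPart Ω A (U m) x + lowerPart Ω b c T U m x := by
  have h1 : ∀ i, weakPartial Ω i (fun y => ∑ j, A y i j * weakPartial Ω j (U m) y)
      =ᵐ[volume.restrict Ω] fun x => ∑ l, (A x i l * weakPartial Ω i (weakPartial Ω l (U m)) x +
        partialDeriv i (fun y => A y i l) x * weakPartial Ω l (U m) x) := by
    intro i
    have := HasWeakPartial.sum (Ω := Ω) (i := i) Finset.univ
      (U := fun j y => A y i j * weakPartial Ω j (U m) y) fun j _ =>
      (((hU.weakPartial hΩ j).hasWeakPartial i).contDiff_mul hΩ (hA1 i j))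
    refine (this.ae_eq hΩ).trans (Eventually.of_forall fun x => ?_)
    exact Finset.sum_congr rfl fun j _ => add_comm _ _
  filter_upwards [ae_all_iff.2 h1] with x hx
  rw [residual, ellipticOp, principalPart, expandedDiv, lowerPart, Finset.sum_congr rfl
    fun i _ => hx i]
  ring

lemma residual_linComb (hΩ : IsOpen Ω) (hA1 : ∀ i j, ContDiff ℝ 1 fun x => A x i j) (α β : ℝ)
    (hU : MemHVec Ω 2 U) (hV : MemHVec Ω 2 V) (m : Fin N) :
    residual Ω A b c T (fun m x => α * U m x + β * V m x) m =ᵐ[volume.restrict Ω]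
      fun x => α * residual Ω A b c T U m x + β * residual Ω A b c T V m x := by
  have h1 := fun i => weakPartial_linComb hΩ α β (hU m) (hV m) i
  have h2 : ∀ i j, weakPartial Ω i (weakPartial Ω j fun x => α * U m x + β * V m x)
      =ᵐ[volume.restrict Ω] fun x => α * weakPartial Ω i (weakPartial Ω j (U m)) x +
        β * weakPartial Ω i (weakPartial Ω j (V m)) x := by
    intro i j
    rw [weakPartial_congr (h1 j)]
    exact weakPartial_linComb hΩ α β ((hU m).weakPartial hΩ j) ((hV m).weakPartial hΩ j) i
  filter_upwards [residual_ae_eq (b := b) (c := c) (T := T) hΩ hA1 (hU m),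
    residual_ae_eq (b := b) (c := c) (T := T) hΩ hA1 (hV m),
    residual_ae_eq (b := b) (c := c) (T := T) (m := m)
      (U := fun m x => α * U m x + β * V m x) hΩ hA1 (hU.linComb α β hV m),
    ae_all_iff.2 h1, ae_all_iff.2 fun i => ae_all_iff.2 (h2 i)] with x e1 e2 e3 e4 e5
  rw [e1, e2, e3]
  simp only [principalPart, expandedDiv, lowerPart, e4, e5]
  have p : ∑ i, ∑ l, (A x i l * (α * weakPartial Ω i (weakPartial Ω l (U m)) x +
      β * weakPartial Ω i (weakPartial Ω l (V m)) x) + partialDeriv i (fun y => A y i l) x *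
      (α * weakPartial Ω l (U m) x + β * weakPartial Ω l (V m) x)) =
      α * (∑ i, ∑ l, (A x i l * weakPartial Ω i (weakPartial Ω l (U m)) x +
        partialDeriv i (fun y => A y i l) x * weakPartial Ω l (U m) x)) +
      β * (∑ i, ∑ l, (A x i l * weakPartial Ω i (weakPartial Ω l (V m)) x +
        partialDeriv i (fun y => A y i l) x * weakPartial Ω l (V m) x)) := by
    simp_rw [Finset.mul_sum, ← Finset.sum_add_distrib]
    exact Finset.sum_congr rfl fun i _ => Finset.sum_congr rfl fun l _ => by ring
  have q : ∑ i, b x i * (α * weakPartial Ω i (U m) x + β * weakPartial Ω i (V m) x) =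
      α * (∑ i, b x i * weakPartial Ω i (U m) x) + β * ∑ i, b x i * weakPartial Ω i (V m) x := by
    simp_rw [Finset.mul_sum, ← Finset.sum_add_distrib]
    exact Finset.sum_congr rfl fun i _ => by ring
  have r : ∑ n, matS T N m n * (α * U n x + β * V n x) =
      α * (∑ n, matS T N m n * U n x) + β * ∑ n, matS T N m n * V n x := by
    simp_rw [Finset.mul_sum, ← Finset.sum_add_distrib]
    exact Finset.sum_congr rfl fun i _ => by ring
  rw [p, q, r]
  ring

/-- The `H¹` density `∑ₘ (|Uₘ|² + |∇Uₘ|²)`. -/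
noncomputable def density (Ω : Set (Space d)) (U : Fin N → Space d → ℝ) (x : Space d) : ℝ :=
  ∑ m, (U m x ^ 2 + ∑ i, weakPartial Ω i (U m) x ^ 2)

lemma exists_bound_matS (T : ℝ) (N : ℕ) : ∃ σ : ℝ, ∀ m n : Fin N, |matS T N m n| ≤ σ :=
  ⟨∑ m, ∑ n, |matS T N m n|, fun m n =>
    (Finset.single_le_sum (f := fun n => |matS T N m n|) (fun _ _ => abs_nonneg _)
      (Finset.mem_univ n)).trans (Finset.single_le_sum (f := fun m => ∑ n, |matS T N m n|)
      (fun _ _ => Finset.sum_nonneg fun _ _ => abs_nonneg _) (Finset.mem_univ m))⟩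

lemma sum_sq_lowerPart_le {B σ : ℝ} {x : Space d} (hb : ‖b x‖ ≤ B) (hc : |c x| ≤ B)
    (hσ : ∀ m n : Fin N, |matS T N m n| ≤ σ) :
    ∑ m, lowerPart Ω b c T U m x ^ 2 ≤ 3 * (B ^ 2 + N ^ 2 * σ ^ 2) * density Ω U x := by
  have hB2 : ‖b x‖ ^ 2 ≤ B ^ 2 := pow_le_pow_left₀ (norm_nonneg _) hb 2
  have hc2 : c x ^ 2 ≤ B ^ 2 := sq_le_sq' (abs_le.1 hc).1 (abs_le.1 hc).2
  set X := ∑ n, U n x ^ 2 with hX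
  have hX0 : 0 ≤ X := by positivity
  have h1 : ∀ m, lowerPart Ω b c T U m x ^ 2 ≤
      3 * B ^ 2 * (U m x ^ 2 + ∑ i, weakPartial Ω i (U m) x ^ 2) + 3 * (N * σ ^ 2) * X := by
    intro m
    have e1 : (∑ i, b x i * weakPartial Ω i (U m) x) ^ 2 ≤
        B ^ 2 * ∑ i, weakPartial Ω i (U m) x ^ 2 := by
      refine (Finset.sum_mul_sq_le_sq_mul_sq _ _ _).trans ?_
      rw [← EuclideanSpace.real_norm_sq_eq]
      exact mul_le_mul_of_nonneg_right hB2 (by positivity)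
    have e2 : (c x * U m x) ^ 2 ≤ B ^ 2 * U m x ^ 2 := by
      rw [mul_pow]
      exact mul_le_mul_of_nonneg_right hc2 (sq_nonneg _)
    have e3 : (∑ n, matS T N m n * U n x) ^ 2 ≤ N * σ ^ 2 * X := by
      refine (Finset.sum_mul_sq_le_sq_mul_sq _ _ _).trans ?_
      refine mul_le_mul_of_nonneg_right ?_ hX0
      refine (Finset.sum_le_sum (g := fun _ => σ ^ 2) fun n _ =>
        sq_le_sq' (abs_le.1 (hσ m n)).1 (abs_le.1 (hσ m n)).2).trans_eq ?_
      simp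
    have e4 : ∀ p q r : ℝ, (p + q - r) ^ 2 ≤ 3 * (p ^ 2 + q ^ 2 + r ^ 2) := fun p q r => by
      nlinarith [sq_nonneg (p - q), sq_nonneg (p + r), sq_nonneg (q + r)]
    refine (e4 _ _ _).trans ?_
    linarith
  have hXd : X ≤ density Ω U x := Finset.sum_le_sum fun m _ =>
    le_add_of_nonneg_right (Finset.sum_nonneg fun _ _ => sq_nonneg _)
  refine (Finset.sum_le_sum fun m _ => h1 m).trans ?_
  rw [Finset.sum_add_distrib, ← Finset.mul_sum]
  simp only [Finset.sum_const, Finset.card_univ, Fintype.card_fin, nsmul_eq_mul]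
  have := mul_le_mul_of_nonneg_left hXd (by positivity : 0 ≤ 3 * (N : ℝ) ^ 2 * σ ^ 2)
  change 3 * B ^ 2 * density Ω U x + _ ≤ _
  linarith

lemma memLp_bdd_mul (hΩ : IsOpen Ω) {f a : Space d → ℝ} {M : ℝ}
    (hf : MemLp f 2 (volume.restrict Ω)) (ha : Continuous a) (hM : ∀ x ∈ Ω, |a x| ≤ M) :
    MemLp (fun x => a x * f x) 2 (volume.restrict Ω) := by
  refine hf.of_le_mul (c := M) (ha.aestronglyMeasurable.mul hf.1)
    ((ae_restrict_iff' hΩ.measurableSet).2 (Eventually.of_forall fun x hx => ?_))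
  rw [norm_mul]
  exact mul_le_mul_of_nonneg_right (hM x hx) (norm_nonneg _)

lemma memLp_principalPart (hΩ : IsOpen Ω) (hA1 : ∀ i j, ContDiff ℝ 1 fun x => A x i j) {L : ℝ}
    (hb : C1NormLE Ω A L) {u : Space d → ℝ} (hu : MemH Ω 2 u) :
    MemLp (principalPart Ω A u) 2 (volume.restrict Ω) := by
  unfold principalPart expandedDiv
  exact memLp_finsetSum _ fun i _ => memLp_finsetSum _ fun l _ =>
    (memLp_bdd_mul hΩ ((hu.weakPartial hΩ l).weakPartial hΩ i).memLp (hA1 i l).continuous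
      fun x hx => (hb x (subset_closure hx) i l).1).add
    (memLp_bdd_mul hΩ (hu.weakPartial hΩ l).memLp (continuous_partialDeriv i (hA1 i l))
      fun x hx => (hb x (subset_closure hx) i l).2 i)

lemma memLp_lowerPart (hΩ : IsOpen Ω) {B : ℝ} (hbc : Continuous b) (hcc : Continuous c)
    (hb : ∀ x ∈ Ω, ‖b x‖ ≤ B) (hc : ∀ x ∈ Ω, |c x| ≤ B) (hU : MemHVec Ω 2 U) (m : Fin N) :
    MemLp (lowerPart Ω b c T U m) 2 (volume.restrict Ω) := by
  refine ((memLp_finsetSum _ fun i _ => memLp_bdd_mul (M := B) hΩ ((hU m).weakPartial hΩ i).memLp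
    (by fun_prop) fun x hx => ?_).add (memLp_bdd_mul hΩ (hU m).memLp hcc hc)).sub
    (memLp_finsetSum _ fun n _ => (hU n).memLp.const_mul _)
  exact (PiLp.norm_apply_le (b x) i).trans (hb x hx)

lemma memLp_residual (hΩ : IsOpen Ω) (hA1 : ∀ i j, ContDiff ℝ 1 fun x => A x i j) {L B : ℝ}
    (hL : C1NormLE Ω A L) (hbc : Continuous b) (hcc : Continuous c)
    (hb : ∀ x ∈ Ω, ‖b x‖ ≤ B) (hc : ∀ x ∈ Ω, |c x| ≤ B) (hU : MemHVec Ω 2 U) (m : Fin N) :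
    MemLp (residual Ω A b c T U m) 2 (volume.restrict Ω) :=
  (memLp_congr_ae (residual_ae_eq hΩ hA1 (hU m))).2
    ((memLp_principalPart hΩ hA1 hL (hU m)).add (memLp_lowerPart hΩ hbc hcc hb hc hU m))

lemma integrable_density (hΩ : IsOpen Ω) (hU : MemHVec Ω 1 U) :
    Integrable (density Ω U) (volume.restrict Ω) :=
  integrable_finsetSum _ fun m _ => (hU m).memLp.integrable_sq.add
    (integrable_finsetSum _ fun i _ => ((hU m).weakPartial hΩ i).memLp.integrable_sq)

lemma normH_one_sq (hΩ : IsOpen Ω) (hU : MemHVec Ω 1 U) :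
    normH Ω 1 U ^ 2 = ∫ x in Ω, density Ω U x := by
  rw [normH_sq]
  unfold density
  have hi : ∀ m, Integrable (fun x => U m x ^ 2 + ∑ i, weakPartial Ω i (U m) x ^ 2)
      (volume.restrict Ω) := fun m => (hU m).memLp.integrable_sq.add
    (integrable_finsetSum _ fun i _ => ((hU m).weakPartial hΩ i).memLp.integrable_sq)
  rw [integral_finsetSum _ fun m _ => hi m]
  refine Finset.sum_congr rfl fun m _ => ?_
  rw [integral_add (hU m).memLp.integrable_sq
    (integrable_finsetSum _ fun i _ => ((hU m).weakPartial hΩ i).memLp.integrable_sq),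
    integral_finsetSum _ fun i _ => ((hU m).weakPartial hΩ i).memLp.integrable_sq]
  rfl

end residual

/-! ### Stability for functions with zero Cauchy data -/

section stability
variable {d N : ℕ} {Ω : Set (Space d)} {A : Space d → Matrix (Fin d) (Fin d) ℝ}
  {b : Space d → Space d} {c : Space d → ℝ} {T : ℝ} {U V : Fin N → Space d → ℝ}

/-- The `C¹` bound on `closure Ω` persists, slightly enlarged, on a bounded neighbourhood of it. -/
lemma exists_open_bound {Λ R : ℝ} (hA1 : ∀ i j, ContDiff ℝ 1 fun x => A x i j)
    (hΛ : C1NormLE Ω A Λ) (hR : closure Ω ⊆ Metric.ball 0 R) :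
    ∃ U : Set (Space d), IsOpen U ∧ closure Ω ⊆ U ∧ U ⊆ Metric.ball 0 R ∧
      ∀ x ∈ U, ∀ i j, |A x i j| ≤ |Λ| + 1 ∧
        ∀ k, |partialDeriv k (fun y => A y i j) x| ≤ |Λ| + 1 := by
  refine ⟨Metric.ball 0 R ∩ ⋂ i, ⋂ j, ({x | |A x i j| < |Λ| + 1} ∩
    ⋂ k, {x | |partialDeriv k (fun y => A y i j) x| < |Λ| + 1}), ?_, ?_, inter_subset_left, ?_⟩
  · refine Metric.isOpen_ball.inter (isOpen_iInter_of_finite fun i => isOpen_iInter_of_finite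
      fun j => IsOpen.inter ?_ (isOpen_iInter_of_finite fun k => ?_))
    · exact isOpen_lt (hA1 i j).continuous.abs continuous_const
    · exact isOpen_lt (continuous_partialDeriv k (hA1 i j)).abs continuous_const
  · refine fun x hx => ⟨hR hx, ?_⟩
    simp only [mem_iInter, mem_inter_iff, mem_ofPred_eq]
    have hlt : Λ < |Λ| + 1 := by linarith [le_abs_self Λ]
    exact fun i j => ⟨(hΛ x hx i j).1.trans_lt hlt, fun k => ((hΛ x hx i j).2 k).trans_lt hlt⟩
  · intro x hx i j
    have := hx.2
    simp only [mem_iInter, mem_inter_iff, mem_ofPred_eq] at this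
    exact ⟨(this i j).1.le, fun k => ((this i j).2 k).le⟩

lemma indicator_eq_zero_of_notMem_closure {f : Space d → ℝ} {x : Space d} (hx : x ∉ closure Ω) :
    Ω.indicator f x = 0 :=
  indicator_of_notMem (fun h => hx (subset_closure h)) f

/-- For zero Cauchy data the `H¹` norm is controlled by the residual: the zero extension lies in
`H²(ℝᵈ)`, and in the Carleman estimate for the principal part the large parameter absorbs the
lower-order terms. -/
theorem exists_stability_zeroData (hd : 0 < d) (hΩ : IsOpen Ω) (hb : Bornology.IsBounded Ω)
    (hs : HasSmoothBoundary Ω) (N : ℕ) (T : ℝ) {μ : ℝ} (hμ : 0 < μ) (Λ B : ℝ) :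
    ∃ C : ℝ, 0 ≤ C ∧ ∀ (A : Space d → Matrix (Fin d) (Fin d) ℝ) (b : Space d → Space d)
      (c : Space d → ℝ), IsCoefficients μ A b c → C1NormLE Ω A Λ →
      (∀ x ∈ Ω, ‖b x‖ ≤ B) → (∀ x ∈ Ω, |c x| ≤ B) →
      ∀ W : Fin N → Space d → ℝ, MemHVec Ω 2 W →
      HasCauchyData Ω A W (fun _ _ => 0) (fun _ _ => 0) →
      normH Ω 1 W ^ 2 ≤ C * ∫ x in Ω, ∑ m, residual Ω A b c T W m x ^ 2 := by
  obtain ⟨R, hR0, hR⟩ : ∃ R : ℝ, 0 < R ∧ closure Ω ⊆ Metric.ball 0 R := by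
    obtain ⟨R, hR⟩ := hb.closure.subset_ball 0
    exact ⟨max R 1, by positivity, hR.trans (Metric.ball_subset_ball (le_max_left _ _))⟩
  obtain ⟨σ, hσ⟩ := exists_bound_matS T N
  let o : Fin d := ⟨0, hd⟩
  obtain ⟨β, hβ, h₀, hh₀, key⟩ := exists_carleman d o (|Λ| + 1) (by positivity) hμ
  set K₁ := 3 * (B ^ 2 + N ^ 2 * σ ^ 2) with hK₁
  have hK₁0 : 0 ≤ K₁ := by positivity
  -- the lower bound for `∂ₒ Φ` needed to absorb the lower-order terms
  set H := h₀ + 8 * K₁ + 1 with hH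
  have hH0 : 0 < H := by linarith
  -- chosen such that `∂ₒ Φ ≥ H` on the ball of radius `R`
  set τ := H / β * Real.exp (β * R) with hτ
  have hτ0 : 0 < τ := by positivity
  set M := Real.exp (τ * Real.exp (β * R)) ^ 2 with hM
  have hcoord : ∀ x ∈ Metric.ball (0 : Space d) R, |x o| ≤ R := fun x hx =>
    (PiLp.norm_apply_le x o).trans (by simpa using (mem_ball_zero_iff.1 hx).le)
  have hphase : ∀ x ∈ Metric.ball (0 : Space d) R, H ≤ phaseDeriv β τ o x := by
    intro x hx
    have h1 : H = τ * β * Real.exp (-(β * R)) := by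
      rw [hτ, Real.exp_neg]; field_simp
    rw [h1, phaseDeriv]
    refine mul_le_mul_of_nonneg_left (Real.exp_le_exp.2 ?_) (by positivity)
    nlinarith [(abs_le.1 (hcoord x hx)).1]
  have hweight : ∀ x ∈ Metric.ball (0 : Space d) R, carlemanWeight β τ o x ^ 2 ≤ M := by
    intro x hx
    refine pow_le_pow_left₀ (Real.exp_pos _).le (Real.exp_le_exp.2 ?_) 2
    refine mul_le_mul_of_nonneg_left (Real.exp_le_exp.2 ?_) hτ0.le
    exact mul_le_mul_of_nonneg_left (abs_le.1 (hcoord x hx)).2 hβ.le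
  have hweight1 : ∀ x, 1 ≤ carlemanWeight β τ o x ^ 2 := fun x =>
    one_le_pow₀ (Real.one_le_exp (by positivity))
  refine ⟨8 * M, by positivity, fun A b c hco hΛ hbB hcB W hW hcd => ?_⟩
  have hA1 : ∀ i j, ContDiff ℝ 1 fun x => A x i j := fun i j =>
    (hco.contDiff_A i j).of_le (by norm_num)
  obtain ⟨U, hUo, hKU, hUR, hUb⟩ := exists_open_bound hA1 hΛ hR
  set E := carlemanWeight β τ o with hE
  set h := phaseDeriv β τ o with hh
  have hEc : Continuous E := (contDiff_carlemanWeight β τ o).continuous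
  have hΩball : Ω ⊆ Metric.ball 0 R := subset_closure.trans hR
  have mInd : ∀ {f : Space d → ℝ}, MemLp f 2 (volume.restrict Ω) → MemLp (Ω.indicator f) 2 :=
    fun hf => (memLp_indicator_iff_restrict hΩ.measurableSet).2 hf
  -- the Carleman estimate for the zero extension of each component
  have hcar : ∀ m, ∫ x in Ω, h x * E x ^ 2 * (W m x ^ 2 + ∑ i, weakPartial Ω i (W m) x ^ 2) ≤
      4 * ∫ x in Ω, E x ^ 2 * principalPart Ω A (W m) x ^ 2 := by
    intro m
    have htr := (hcd m).1
    have htr1 := fun j => (hcd m).2.isTrace_weakPartial hΩ hb hs hμ hco.elliptic htr j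
    have := key A hco.symm hA1 hco.elliptic τ (closure Ω) U hb.isCompact_closure hUo hKU
      (fun x hx => ⟨le_trans (by linarith) (hphase x (hUR hx)), hUb x hx⟩)
      (Ω.indicator (W m)) (fun i => Ω.indicator (weakPartial Ω i (W m)))
      (fun i j => Ω.indicator (weakPartial Ω i (weakPartial Ω j (W m))))
      (mInd (hW m).memLp) (fun i => mInd ((hW m).weakPartial hΩ i).memLp)
      (fun i j => mInd (((hW m).weakPartial hΩ j).weakPartial hΩ i).memLp)
      (fun i => htr.hasWeakPartial_indicator hΩ i)
      (fun i j => (htr1 j).hasWeakPartial_indicator hΩ i)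
      (fun x hx => indicator_eq_zero_of_notMem_closure hx)
      (fun x hx i => indicator_eq_zero_of_notMem_closure hx)
      (fun x hx i j => indicator_eq_zero_of_notMem_closure hx)
    have e1 : ∀ x, Ω.indicator (fun x => h x * E x ^ 2 *
        (W m x ^ 2 + ∑ i, weakPartial Ω i (W m) x ^ 2)) x = h x * E x ^ 2 *
        (Ω.indicator (W m) x ^ 2 + ∑ i, Ω.indicator (weakPartial Ω i (W m)) x ^ 2) := by
      intro x
      by_cases hx : x ∈ Ω <;> simp [hx]
    have e2 : ∀ x, Ω.indicator (fun x => E x ^ 2 * principalPart Ω A (W m) x ^ 2) x =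
        E x ^ 2 * expandedDiv A (fun i => Ω.indicator (weakPartial Ω i (W m)))
          (fun i j => Ω.indicator (weakPartial Ω i (weakPartial Ω j (W m)))) x ^ 2 := by
      intro x
      by_cases hx : x ∈ Ω <;> simp [hx, principalPart, expandedDiv]
    rw [← integral_indicator hΩ.measurableSet, ← integral_indicator hΩ.measurableSet]
    simp only [e1, e2]
    exact this
  have hE2 : ∀ {f : Space d → ℝ}, Integrable f (volume.restrict Ω) →
      Integrable (fun x => E x ^ 2 * f x) (volume.restrict Ω) := fun hf =>
    hf.bdd_mul (c := M) (hEc.pow 2).aestronglyMeasurable ((ae_restrict_iff' hΩ.measurableSet).2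
      (Eventually.of_forall fun x hx => by
        rw [Real.norm_of_nonneg (sq_nonneg _)]
        exact hweight x (hΩball hx)))
  have hdens := integrable_density hΩ (fun m => (hW m).of_succ : MemHVec Ω 1 W)
  have hdensE := hE2 hdens
  have hpp : ∀ m, Integrable (fun x => principalPart Ω A (W m) x ^ 2) (volume.restrict Ω) :=
    fun m => (memLp_principalPart hΩ hA1 hΛ (hW m)).integrable_sq
  have hres : ∀ m, Integrable (fun x => residual Ω A b c T W m x ^ 2) (volume.restrict Ω) :=
    fun m => (memLp_residual hΩ hA1 hΛ hco.contDiff_b.continuous hco.contDiff_c.continuous hbB hcB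
      hW m).integrable_sq
  have hressum : Integrable (fun x => ∑ m, residual Ω A b c T W m x ^ 2) (volume.restrict Ω) :=
    integrable_finsetSum _ fun m _ => hres m
  have hmΩ := (ae_restrict_iff' (μ := (volume : Measure (Space d))) hΩ.measurableSet
    (p := fun x => x ∈ Ω)).2 (Eventually.of_forall fun x hx => hx)
  have hlow : ∀ m, H * ∫ x in Ω, E x ^ 2 * (W m x ^ 2 + ∑ i, weakPartial Ω i (W m) x ^ 2) ≤
      4 * ∫ x in Ω, E x ^ 2 * principalPart Ω A (W m) x ^ 2 := by
    intro m
    refine le_trans ?_ (hcar m)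
    have hi : Integrable (fun x => W m x ^ 2 + ∑ i, weakPartial Ω i (W m) x ^ 2)
        (volume.restrict Ω) := (hW m).memLp.integrable_sq.add
      (integrable_finsetSum _ fun i _ => ((hW m).weakPartial hΩ i).memLp.integrable_sq)
    rw [← integral_const_mul]
    refine integral_mono_ae ((hE2 hi).const_mul H) ?_ ?_
    · have hhc : Continuous h := (contDiff_phaseDeriv β τ o).continuous
      obtain ⟨M', hM'⟩ := hb.isCompact_closure.exists_bound_of_continuousOn hhc.continuousOn
      refine ((hE2 hi).bdd_mul (c := M') hhc.aestronglyMeasurable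
        (hmΩ.mono fun x hx => hM' x (subset_closure hx))).congr
        (Eventually.of_forall fun x => ?_)
      simp only
      ring
    · filter_upwards [hmΩ] with x hx
      have h1 : 0 ≤ E x ^ 2 * (W m x ^ 2 + ∑ i, weakPartial Ω i (W m) x ^ 2) := by positivity
      have h2 := mul_le_mul_of_nonneg_right (hphase x (hΩball hx)) h1
      linarith
  have hsum : H * ∫ x in Ω, E x ^ 2 * density Ω W x ≤
      4 * ∫ x in Ω, E x ^ 2 * ∑ m, principalPart Ω A (W m) x ^ 2 := by
    have e1 : ∫ x in Ω, E x ^ 2 * density Ω W x =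
        ∑ m, ∫ x in Ω, E x ^ 2 * (W m x ^ 2 + ∑ i, weakPartial Ω i (W m) x ^ 2) := by
      simp_rw [density, Finset.mul_sum]
      exact integral_finsetSum _ fun m _ => hE2 ((hW m).memLp.integrable_sq.add
        (integrable_finsetSum _ fun i _ => ((hW m).weakPartial hΩ i).memLp.integrable_sq))
    have e2 : ∫ x in Ω, E x ^ 2 * ∑ m, principalPart Ω A (W m) x ^ 2 =
        ∑ m, ∫ x in Ω, E x ^ 2 * principalPart Ω A (W m) x ^ 2 := by
      simp_rw [Finset.mul_sum]
      exact integral_finsetSum _ fun m _ => hE2 (hpp m)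
    rw [e1, e2, Finset.mul_sum, Finset.mul_sum]
    exact Finset.sum_le_sum fun m _ => hlow m
  -- the principal part is the residual minus the lower-order part
  have hpr : ∫ x in Ω, E x ^ 2 * ∑ m, principalPart Ω A (W m) x ^ 2 ≤
      2 * (∫ x in Ω, E x ^ 2 * ∑ m, residual Ω A b c T W m x ^ 2) +
        2 * K₁ * ∫ x in Ω, E x ^ 2 * density Ω W x := by
    rw [← integral_const_mul, ← integral_const_mul,
      ← integral_add ((hE2 hressum).const_mul 2) (hdensE.const_mul _)]
    refine integral_mono_ae (hE2 (integrable_finsetSum _ fun m _ => hpp m))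
      (((hE2 hressum).const_mul 2).add (hdensE.const_mul _)) ?_
    filter_upwards [hmΩ, ae_all_iff.2 fun m => residual_ae_eq (b := b) (c := c) (T := T) hΩ hA1
      (hW m)] with x hx hx2
    have h1 : ∑ m, principalPart Ω A (W m) x ^ 2 ≤ 2 * (∑ m, residual Ω A b c T W m x ^ 2) +
        2 * ∑ m, lowerPart Ω b c T W m x ^ 2 := by
      rw [Finset.mul_sum, Finset.mul_sum, ← Finset.sum_add_distrib]
      refine Finset.sum_le_sum fun m _ => ?_
      rw [hx2 m]
      nlinarith [sq_nonneg (principalPart Ω A (W m) x + 2 * lowerPart Ω b c T W m x)]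
    have h2 := sum_sq_lowerPart_le (Ω := Ω) (U := W) (hbB x hx) (hcB x hx) hσ
    have h3 := mul_le_mul_of_nonneg_left (h1.trans (add_le_add_right
      (mul_le_mul_of_nonneg_left h2 zero_le_two) _)) (sq_nonneg (E x))
    change _ ≤ 2 * (E x ^ 2 * ∑ m, residual Ω A b c T W m x ^ 2) +
      2 * K₁ * (E x ^ 2 * density Ω W x)
    linarith
  have hd0 : ∀ x, 0 ≤ density Ω W x := fun x => by unfold density; positivity
  have hI0 : 0 ≤ ∫ x in Ω, E x ^ 2 * density Ω W x :=
    integral_nonneg fun x => mul_nonneg (sq_nonneg _) (hd0 x)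
  have hup : ∫ x in Ω, E x ^ 2 * ∑ m, residual Ω A b c T W m x ^ 2 ≤
      M * ∫ x in Ω, ∑ m, residual Ω A b c T W m x ^ 2 := by
    rw [← integral_const_mul]
    refine integral_mono_ae (hE2 hressum) (hressum.const_mul M) (hmΩ.mono fun x hx => ?_)
    exact mul_le_mul_of_nonneg_right (hweight x (hΩball hx)) (by positivity)
  have hdown : ∫ x in Ω, density Ω W x ≤ ∫ x in Ω, E x ^ 2 * density Ω W x :=
    integral_mono hdens hdensE fun x => le_mul_of_one_le_left (hd0 x) (hweight1 x)
  rw [normH_one_sq hΩ (fun m => (hW m).of_succ : MemHVec Ω 1 W)]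
  -- of `H ≥ 8 K₁ + 1`, the part `8 K₁` is used up by the lower-order terms
  have hH1 : (8 * K₁ + 1) * (∫ x in Ω, E x ^ 2 * density Ω W x) ≤
      H * ∫ x in Ω, E x ^ 2 * density Ω W x :=
    mul_le_mul_of_nonneg_right (by linarith) hI0
  linarith

/-- The `H²` density: the sum of the squared weak derivatives of order at most two. -/
noncomputable def density₂ (Ω : Set (Space d)) (u : Space d → ℝ) (x : Space d) : ℝ :=
  (u x ^ 2 + ∑ i, weakPartial Ω i u x ^ 2) + ∑ j, ∑ i, weakPartial Ω i (weakPartial Ω j u) x ^ 2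

lemma sq_principalPart_le {Λ : ℝ} (hΛ : C1NormLE Ω A Λ) (u : Space d → ℝ) {x : Space d}
    (hx : x ∈ Ω) :
    principalPart Ω A u x ^ 2 ≤ 2 * Λ ^ 2 * d ^ 2 * (d + 1) * density₂ Ω u x := by
  refine (sq_expandedDiv_le (hΛ x (subset_closure hx))).trans ?_
  rw [mul_assoc (2 * Λ ^ 2 * (d : ℝ) ^ 2)]
  refine mul_le_mul_of_nonneg_left ?_ (by positivity)
  rw [Finset.sum_comm, density₂]
  have p0 : 0 ≤ u x ^ 2 := sq_nonneg _
  have p1 : 0 ≤ ∑ i, weakPartial Ω i u x ^ 2 := Finset.sum_nonneg fun i _ => sq_nonneg _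
  have p2 : 0 ≤ ∑ j, ∑ i, weakPartial Ω i (weakPartial Ω j u) x ^ 2 :=
    Finset.sum_nonneg fun j _ => Finset.sum_nonneg fun i _ => sq_nonneg _
  generalize ∑ j, ∑ i, weakPartial Ω i (weakPartial Ω j u) x ^ 2 = s₂ at p2 ⊢
  generalize ∑ i, weakPartial Ω i u x ^ 2 = s₁ at p1 ⊢
  have p3 : 0 ≤ (d : ℝ) * u x ^ 2 := by positivity
  have p4 : 0 ≤ (d : ℝ) * s₂ := by positivity
  linarith

lemma density_le_sum_density₂ (x : Space d) : density Ω U x ≤ ∑ m, density₂ Ω (U m) x :=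
  Finset.sum_le_sum fun _ _ => le_add_of_nonneg_right <|
    Finset.sum_nonneg fun _ _ => Finset.sum_nonneg fun _ _ => sq_nonneg _

/-- The residual is bounded by the `H³` norm. -/
theorem exists_residual_bound (hΩ : IsOpen Ω) (N : ℕ) (T : ℝ) (Λ B : ℝ) :
    ∃ C : ℝ, 0 ≤ C ∧ ∀ (A : Space d → Matrix (Fin d) (Fin d) ℝ) (b : Space d → Space d)
      (c : Space d → ℝ), (∀ i j, ContDiff ℝ 1 fun x => A x i j) → Continuous b → Continuous c →
      C1NormLE Ω A Λ → (∀ x ∈ Ω, ‖b x‖ ≤ B) → (∀ x ∈ Ω, |c x| ≤ B) →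
      ∀ W : Fin N → Space d → ℝ, MemHVec Ω 3 W →
      ∫ x in Ω, ∑ m, residual Ω A b c T W m x ^ 2 ≤ C * normH Ω 3 W ^ 2 := by
  obtain ⟨σ, hσ⟩ := exists_bound_matS T N
  set K₁ := 3 * (B ^ 2 + N ^ 2 * σ ^ 2) with hK₁
  set K₂ := 2 * Λ ^ 2 * d ^ 2 * (d + 1) with hK₂
  have hK₁0 : 0 ≤ K₁ := by positivity
  have hK₂0 : 0 ≤ K₂ := by positivity
  refine ⟨2 * K₂ + 2 * K₁, by positivity, fun A b c hA1 hbc hcc hΛ hbB hcB W hW => ?_⟩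
  have hW2 : MemHVec Ω 2 W := fun m => (hW m).of_succ
  have hW1 : MemHVec Ω 1 W := fun m => (hW2 m).of_succ
  have hmΩ := (ae_restrict_iff' (μ := (volume : Measure (Space d))) hΩ.measurableSet
    (p := fun x => x ∈ Ω)).2 (Eventually.of_forall fun x hx => hx)
  have i0 : ∀ m, Integrable (fun x => W m x ^ 2) (volume.restrict Ω) := fun m =>
    (hW m).memLp.integrable_sq
  have i1 : ∀ m i, Integrable (fun x => weakPartial Ω i (W m) x ^ 2) (volume.restrict Ω) :=
    fun m i => ((hW m).weakPartial hΩ i).memLp.integrable_sq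
  have i2 : ∀ m i j, Integrable (fun x => weakPartial Ω i (weakPartial Ω j (W m)) x ^ 2)
      (volume.restrict Ω) := fun m i j =>
    (((hW m).weakPartial hΩ j).weakPartial hΩ i).memLp.integrable_sq
  have i2' : ∀ m, Integrable (fun x => ∑ j, ∑ i, weakPartial Ω i (weakPartial Ω j (W m)) x ^ 2)
      (volume.restrict Ω) := fun m =>
    integrable_finsetSum _ fun j _ => integrable_finsetSum _ fun i _ => i2 m i j
  have i1' : ∀ m, Integrable (fun x => ∑ i, weakPartial Ω i (W m) x ^ 2) (volume.restrict Ω) :=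
    fun m => integrable_finsetSum _ fun i _ => i1 m i
  have i01 : ∀ m, Integrable (fun x => W m x ^ 2 + ∑ i, weakPartial Ω i (W m) x ^ 2)
    (volume.restrict Ω) := fun m => (i0 m).add (i1' m)
  have i012 : ∀ m, Integrable (density₂ Ω (W m)) (volume.restrict Ω) :=
    fun m => (i01 m).add (i2' m)
  have hnorm : ∑ m, ∫ x in Ω, density₂ Ω (W m) x ≤ normH Ω 3 W ^ 2 := by
    refine le_trans (le_of_eq ?_) (normH_sq_le_succ Ω 2 W)
    rw [normH_sq]
    refine Finset.sum_congr rfl fun m _ => ?_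
    simp only [density₂]
    rw [integral_add (i01 m) (i2' m), integral_add (i0 m) (i1' m),
      integral_finsetSum _ fun i _ => i1 m i,
      integral_finsetSum _ fun j _ => integrable_finsetSum _ fun i _ => i2 m i j]
    simp only [normSqH]
    rw [Finset.sum_add_distrib, add_assoc]
    congr 2
    exact Finset.sum_congr rfl fun j _ => integral_finsetSum _ fun i _ => i2 m i j
  refine le_trans ?_ (mul_le_mul_of_nonneg_left hnorm (by positivity))
  rw [← integral_finsetSum _ fun m _ => i012 m, ← integral_const_mul]
  refine integral_mono_ae (integrable_finsetSum _ fun m _ => (memLp_residual hΩ hA1 hΛ hbc hcc hbB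
    hcB hW2 m).integrable_sq) ((integrable_finsetSum _ fun m _ => i012 m).const_mul _) ?_
  filter_upwards [hmΩ, ae_all_iff.2 fun m => residual_ae_eq (b := b) (c := c) (T := T) hΩ hA1
    (hW2 m)] with x hx hx2
  have h1 : ∑ m, residual Ω A b c T W m x ^ 2 ≤ 2 * (∑ m, principalPart Ω A (W m) x ^ 2) +
      2 * ∑ m, lowerPart Ω b c T W m x ^ 2 := by
    rw [Finset.mul_sum, Finset.mul_sum, ← Finset.sum_add_distrib]
    refine Finset.sum_le_sum fun m _ => ?_
    rw [hx2 m]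
    nlinarith [sq_nonneg (principalPart Ω A (W m) x - lowerPart Ω b c T W m x)]
  have h2 := sum_sq_lowerPart_le (Ω := Ω) (U := W) (hbB x hx) (hcB x hx) hσ
  have h3 := Finset.sum_le_sum fun m (_ : m ∈ Finset.univ) => sq_principalPart_le hΛ (W m) hx
  rw [← Finset.mul_sum] at h3
  have h5 := density_le_sum_density₂ (Ω := Ω) (U := W) x
  have h6 := mul_le_mul_of_nonneg_left h5 hK₁0
  linarith

end stability

/-! ### The convergence estimate -/

section convergence
variable {d N : ℕ} {Ω : Set (Space d)} {A : Space d → Matrix (Fin d) (Fin d) ℝ}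
  {b : Space d → Space d} {c : Space d → ℝ} {T B Λ ε δ C₂ : ℝ}
  {F G F' G' U V W E : Fin N → Space d → ℝ}

/-- The residual of a linear combination, in the `L²` norm. -/
lemma integral_sq_residual_linComb_le (hΩ : IsOpen Ω)
    (hA1 : ∀ i j, ContDiff ℝ 1 fun x => A x i j) (hΛ : C1NormLE Ω A Λ) (hbc : Continuous b)
    (hcc : Continuous c) (hbB : ∀ x ∈ Ω, ‖b x‖ ≤ B) (hcB : ∀ x ∈ Ω, |c x| ≤ B) (α β : ℝ)
    (hU : MemHVec Ω 2 U) (hV : MemHVec Ω 2 V) :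
    ∫ x in Ω, ∑ m, residual Ω A b c T (fun m x => α * U m x + β * V m x) m x ^ 2 ≤
      2 * α ^ 2 * (∫ x in Ω, ∑ m, residual Ω A b c T U m x ^ 2) +
        2 * β ^ 2 * ∫ x in Ω, ∑ m, residual Ω A b c T V m x ^ 2 := by
  have hint : ∀ {W : Fin N → Space d → ℝ}, MemHVec Ω 2 W → Integrable
      (fun x => ∑ m, residual Ω A b c T W m x ^ 2) (volume.restrict Ω) := fun hW =>
    integrable_finsetSum _ fun m _ =>
      (memLp_residual hΩ hA1 hΛ hbc hcc hbB hcB hW m).integrable_sq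
  rw [← integral_const_mul, ← integral_const_mul,
    ← integral_add ((hint hU).const_mul _) ((hint hV).const_mul _)]
  refine integral_mono_ae (hint (hU.linComb α β hV))
    (((hint hU).const_mul _).add ((hint hV).const_mul _)) ?_
  filter_upwards [ae_all_iff.2 fun m => residual_linComb (b := b) (c := c) (T := T) hΩ hA1 α β
    hU hV m] with x hx
  rw [Finset.mul_sum, Finset.mul_sum, ← Finset.sum_add_distrib]
  refine Finset.sum_le_sum fun m _ => ?_
  rw [hx m]
  nlinarith [sq_nonneg (α * residual Ω A b c T U m x - β * residual Ω A b c T V m x)]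

/-- Adding an exact solution does not change the residual. -/
lemma integral_sq_residual_add_of_isSolution (hΩ : IsOpen Ω)
    (hA1 : ∀ i j, ContDiff ℝ 1 fun x => A x i j) (hU : IsSolution Ω A b c T F G U)
    (hV : MemHVec Ω 2 V) :
    ∫ x in Ω, ∑ m, residual Ω A b c T (fun m x => 1 * U m x + 1 * V m x) m x ^ 2 =
      ∫ x in Ω, ∑ m, residual Ω A b c T V m x ^ 2 := by
  refine integral_congr_ae ?_
  filter_upwards [ae_all_iff.2 hU.2.1, ae_all_iff.2 fun m => residual_linComb (b := b) (c := c)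
    (T := T) hΩ hA1 1 1 (fun m => (hU.1 m).of_succ) hV m] with x hx hx2
  exact Finset.sum_congr rfl fun m _ => by rw [hx2 m, hx m]; ring

lemma integral_sq_residual_nonneg :
    0 ≤ ∫ x in Ω, ∑ m, residual Ω A b c T U m x ^ 2 :=
  integral_nonneg fun _ => Finset.sum_nonneg fun _ _ => sq_nonneg _

lemma normH_one_sq_le_three (U : Fin N → Space d → ℝ) :
    normH Ω 1 U ^ 2 ≤ normH Ω 3 U ^ 2 :=
  (normH_sq_le_succ Ω 1 U).trans (normH_sq_le_succ Ω 2 U)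

end convergence

end QuasiReversibility

open QuasiReversibility in
theorem mainTheorem1 {d : ℕ} (hd : 2 ≤ d) (Ω : Set (QuasiReversibility.Space d))
    (hΩ_open : IsOpen Ω) (hΩ_bdd : Bornology.IsBounded Ω)
    (hΩ_smooth : QuasiReversibility.HasSmoothBoundary Ω)
    (N : ℕ) (hN : 0 < N) (T : ℝ) (hT : 0 < T) (μ : ℝ) (hμ : 0 < μ) (Λ B : ℝ) :
    ∃ C : ℝ, 0 < C ∧
      ∀ (A : QuasiReversibility.Space d → Matrix (Fin d) (Fin d) ℝ)
        (b : QuasiReversibility.Space d → QuasiReversibility.Space d)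
        (c : QuasiReversibility.Space d → ℝ),
        QuasiReversibility.IsCoefficients μ A b c →
        QuasiReversibility.C1NormLE Ω A Λ →
        (∀ x ∈ Ω, ‖b x‖ ≤ B) → (∀ x ∈ Ω, |c x| ≤ B) →
        ∀ (ε δ : ℝ), 0 < ε → 0 < δ →
        ∀ Fstar Gstar Fδ Gδ Ustar Uδ E : Fin N → QuasiReversibility.Space d → ℝ,
          QuasiReversibility.IsSolution Ω A b c T Fstar Gstar Ustar →
          QuasiReversibility.IsRegularizedSolution Ω A b c T ε Fδ Gδ Uδ →
          QuasiReversibility.MemHVec Ω 3 E →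
          QuasiReversibility.HasCauchyData Ω A E (Fδ - Fstar) (Gδ - Gstar) →
          QuasiReversibility.normH Ω 3 E < δ →
          QuasiReversibility.normH Ω 1 (Uδ - Ustar) ^ 2 ≤
            C * (δ ^ 2 + ε * QuasiReversibility.normH Ω 3 Ustar ^ 2) := by
  -- `C₁` is the stability constant, `C₂` bounds the residual by the `H³` norm
  obtain ⟨C₁, hC₁, hstab⟩ := exists_stability_zeroData (by omega : 0 < d) hΩ_open hΩ_bdd hΩ_smooth
    N T hμ Λ B
  obtain ⟨C₂, hC₂, hres⟩ := exists_residual_bound hΩ_open N T Λ B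
  refine ⟨4 * C₁ * (2 * C₂ + 2) + 2 * C₂ + 6, by positivity, ?_⟩
  intro A b c hco hΛ hbB hcB ε δ hε hδ Fs Gs Fδ Gδ Us Uδ E hUs hUδ hE hEdata hEδ
  have hA1 : ∀ i j, ContDiff ℝ 1 fun x => A x i j := fun i j =>
    (hco.contDiff_A i j).of_le (by norm_num)
  have hbc := hco.contDiff_b.continuous
  have hcc := hco.contDiff_c.continuous
  have down : ∀ {W : Fin N → Space d → ℝ}, MemHVec Ω 3 W → MemHVec Ω 2 W :=
    fun h m => (h m).of_succ
  have down₁ : ∀ {W : Fin N → Space d → ℝ}, MemHVec Ω 3 W → MemHVec Ω 1 W :=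
    fun h m => ((h m).of_succ).of_succ
  -- the competitor `U* + E`
  set V : Fin N → Space d → ℝ := fun m x => 1 * Us m x + 1 * E m x with hV
  have hV3 : MemHVec Ω 3 V := hUs.1.linComb 1 1 hE
  have hVdata : HasCauchyData Ω A V Fδ Gδ := by
    have := hUs.2.2.linComb hΩ_open hΩ_bdd hΩ_smooth 1 1 hEdata
    simpa [hV] using this
  have hEn : normH Ω 3 E ^ 2 ≤ δ ^ 2 := pow_le_pow_left₀ (Real.sqrt_nonneg _) hEδ.le 2
  have hVn := normH_linComb_sq_le hΩ_open 1 1 hUs.1 hE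
  rw [← hV] at hVn
  have hEres := hres A b c hA1 hbc hcc hΛ hbB hcB E hE
  have hVres := integral_sq_residual_add_of_isSolution hΩ_open hA1 hUs (down hE)
  rw [← hV] at hVres
  have hmin : functionalJ Ω A b c T ε Uδ ≤ functionalJ Ω A b c T ε V := hUδ.2 ⟨hV3, hVdata⟩
  rw [functionalJ, functionalJ, hVres] at hmin
  set r := ∫ x in Ω, ∑ m, residual Ω A b c T E m x ^ 2
  set rδ := ∫ x in Ω, ∑ m, residual Ω A b c T Uδ m x ^ 2
  have hrδ : 0 ≤ rδ := integral_sq_residual_nonneg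
  set n := normH Ω 3 Us ^ 2
  have hn : 0 ≤ n := sq_nonneg _
  have hnδ : 0 ≤ normH Ω 3 Uδ ^ 2 := sq_nonneg _
  have hr : r ≤ C₂ * δ ^ 2 := hEres.trans (mul_le_mul_of_nonneg_left hEn hC₂)
  have hVn' : normH Ω 3 V ^ 2 ≤ 2 * n + 2 * δ ^ 2 := by linarith
  have hmin' : rδ + ε * normH Ω 3 Uδ ^ 2 ≤ C₂ * δ ^ 2 + ε * (2 * n + 2 * δ ^ 2) :=
    hmin.trans (add_le_add hr (mul_le_mul_of_nonneg_left hVn' hε.le))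
  have hδ2 : 0 ≤ δ ^ 2 := sq_nonneg δ
  have hεn : 0 ≤ ε * n := mul_nonneg hε.le hn
  rcases le_total ε 1 with hε1 | hε1
  · -- the difference to the competitor has zero Cauchy data
    set W : Fin N → Space d → ℝ := fun m x => 1 * Uδ m x + (-1) * V m x with hW
    have hW3 : MemHVec Ω 3 W := hUδ.1.1.linComb 1 (-1) hV3
    have hWdata : HasCauchyData Ω A W (fun _ _ => 0) (fun _ _ => 0) := by
      have := hUδ.1.2.linComb hΩ_open hΩ_bdd hΩ_smooth 1 (-1) hVdata
      simpa [hW] using this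
    have h1 := hstab A b c hco hΛ hbB hcB W (down hW3) hWdata
    have h2 := integral_sq_residual_linComb_le (T := T) hΩ_open hA1 hΛ hbc hcc hbB hcB 1 (-1)
      (down hUδ.1.1) (down hV3)
    rw [hVres, ← hW] at h2
    have h3 := normH_linComb_sq_le hΩ_open 1 1 (down₁ hW3) (down₁ hE)
    have e : (fun m x => 1 * W m x + 1 * E m x) = Uδ - Us := by
      funext m x
      simp only [hW, hV, Pi.sub_apply]
      ring
    rw [e] at h3
    have h4 := normH_one_sq_le_three (Ω := Ω) E
    have h5 : rδ ≤ (C₂ + 2) * δ ^ 2 + 2 * (ε * n) := by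
      have : 0 ≤ ε * normH Ω 3 Uδ ^ 2 := mul_nonneg hε.le hnδ
      have : ε * δ ^ 2 ≤ 1 * δ ^ 2 := mul_le_mul_of_nonneg_right hε1 hδ2
      nlinarith
    have h6 : normH Ω 1 W ^ 2 ≤ C₁ * (2 * (2 * C₂ + 2) * (δ ^ 2 + ε * n)) := by
      refine h1.trans (mul_le_mul_of_nonneg_left ?_ hC₁)
      have : 0 ≤ C₂ * (ε * n) := mul_nonneg hC₂ hεn
      nlinarith
    have h7 : 0 ≤ C₂ * (δ ^ 2 + ε * n) := mul_nonneg hC₂ (add_nonneg hδ2 hεn)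
    nlinarith
  · -- for large `ε` the penalty alone bounds the minimizer
    have h1 : normH Ω 3 Uδ ^ 2 ≤ (C₂ + 2) * δ ^ 2 + 2 * n := by
      have h : C₂ * δ ^ 2 ≤ ε * (C₂ * δ ^ 2) :=
        le_mul_of_one_le_left (mul_nonneg hC₂ hδ2) hε1
      refine le_of_mul_le_mul_left ?_ hε
      nlinarith
    have h2 := normH_linComb_sq_le hΩ_open 1 (-1) (down₁ hUδ.1.1) (down₁ hUs.1)
    have e : (fun m x => 1 * Uδ m x + (-1) * Us m x) = Uδ - Us := by
      funext m x
      simp only [Pi.sub_apply]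
      ring
    rw [e] at h2
    have h3 := normH_one_sq_le_three (Ω := Ω) Uδ
    have h4 : normH Ω 1 Us ^ 2 ≤ n := normH_one_sq_le_three (Ω := Ω) Us
    have h5 : n ≤ ε * n := le_mul_of_one_le_left hn hε1
    have h6 : 0 ≤ C₁ * (2 * C₂ + 2) * (δ ^ 2 + ε * n) := by positivity
    have h7 : 0 ≤ C₂ * (ε * n) := mul_nonneg hC₂ hεn
    nlinarith
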